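/- Let $p$ be a prime and let $L/K$ be an extension of complete discrete valuation fields of equal characteristic $p$, that is, $\mathcal O_K\to\mathcal O_L$ is a local homomorphism of complete discrete valuation rings of characteristic $p$. Assume that the residue field of $K$ is perfect (the residue field of $L$ is arbitrary, and $L/K$ may be transcendental), and that $L/K$ is separable; since $[K:K^p]=p$, this means $K\not\subset L^p$. Notation. Let $e(L/K)$ be the ramification index. For $F\in\{K,L\}$ let $\Omega^1_{\mathcal O_F}(\log)$ be the quotient of $\Omega^1_{\mathcal O_F/\mathbb Z}\oplus(\mathcal O_F\otimes_{\mathbb Z}F^\times)$ by the $\mathcal O_F$-submodule generated by the elements $da-a\otimes a$ ($0\neq a\in\mathcal O_F$), let $\hat\Omega^1_{\mathcal O_F}(\log)=\varprojlim_m\Omega^1_{\mathcal O_F}(\log)/\mathfrak m_F^m\Omega^1_{\mathcal O_F}(\log)$, and let $\delta_{\mathrm{tor}}(L/K)$ be the length of the torsion part of the $\mathcal O_L$-module $$\hat\Omega^1_{\mathcal O_L}(\log)\big/\bigl(\mathcal O_L\otimes_{\mathcal O_K}\hat\Omega^1_{\mathcal O_K}(\log)\bigr),$$ the quotient being taken by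 the image of the natural map. Let $H^1(F,\mathbb Q/\mathbb Z)$ be the group of continuous characters of the absolute Galois group $G_F$. For $n\ge 0$ let $F_nW_s(F)$ be the set of Witt vectors $(a_{s-1},\dots,a_0)$ of length $s$ over $F$ with $p^iv_F(a_i)\ge -n$ for all $i$, where $v_F$ is the normalized valuation of $F$. Let $F_nH^1(F,\mathbb Q/\mathbb Z)$ be the set of those $\chi$ for which there are $m\geq 1$ prime to $p$ and $s\ge 0$ such that $m\chi$ is in the image of $F_nW_s(F)$ under the Artin–Schreier–Witt map $W_s(F)\to H^1(F,\mathbb Z/p^s\mathbb Z)\subset H^1(F,\mathbb Q/\mathbb Z)$. Kato's Swan conductor $\operatorname{Sw}\chi$ is the smallest $n\ge 0$ with $\chi\in F_nH^1(F,\mathbb Q/\mathbb Z)$. Let $\chi\in H^1(K,\mathbb Q/\mathbb Z)$ satisfy $$\operatorname{Sw}\chi>\frac{p}{p-1}\,\frac{\delta_{\mathrm{tor}}(L/K)}{e(L/K)},$$ and let $\chi_L$ be its image in $H^1(L,\mathbb Q/\mathbb Z)$ under restriction along $G_L\to G_K$ (induced by any $K$-embedding of the algebraic closure of $K$ into that of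 $L$). Then $\delta_{\mathrm{tor}}(L/K)$ is finite and $$\operatorname{Sw}\chi_L=e(L/K)\operatorname{Sw}\chi-\delta_{\mathrm{tor}}(L/K).$$ -/

import Mathlib

open IsLocalRing
open scoped TensorProduct

noncomputable section

/-! ### The group `H¹(K, ℚ/ℤ)` of characters of the absolute Galois group -/

/-- The abelian group `ℚ/ℤ`, with the discrete topology. -/
def QModZ : Type := ℚ ⧸ AddSubgroup.zmultiples (1 : ℚ)

instance : AddCommGroup QModZ :=
  inferInstanceAs (AddCommGroup (ℚ ⧸ AddSubgroup.zmultiples (1 : ℚ)))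

instance : TopologicalSpace QModZ := ⊥

instance : DiscreteTopology QModZ := ⟨rfl⟩

/-- The class in `ℚ/ℤ` of a rational number. -/
def QModZ.mk (r : ℚ) : QModZ :=
  (QuotientAddGroup.mk r : ℚ ⧸ AddSubgroup.zmultiples (1 : ℚ))

/-- The absolute Galois group `G_K`: the automorphisms over `K` of an algebraic closure of `K`
(equivalently, by restriction, of the separable closure inside it). -/
abbrev AbsGal (K : Type*) [Field K] : Type _ := AlgebraicClosure K ≃ₐ[K] AlgebraicClosure K

/-- `H¹(K, ℚ/ℤ)`: the continuous homomorphisms from the absolute Galois group of `K` (with its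
Krull topology) to the discrete group `ℚ/ℤ`. The group law is written multiplicatively, so the
multiple `m • χ` of the mathematical text is `χ ^ m`. -/
abbrev GalH1 (K : Type*) [Field K] : Type _ :=
  AbsGal K →ₜ* Multiplicative QModZ

section Restriction

variable {K L : Type*} [Field K] [Field L] [Algebra K L]

/-- The restriction map `G_L → G_K` attached to a `K`-embedding `ι` of the algebraic closure of `K`
into that of `L`, as a homomorphism of abstract groups. -/
def absGalRestrictHom (ι : AlgebraicClosure K →ₐ[K] AlgebraicClosure L) :
    AbsGal L →* AbsGal K :=
  letI : Algebra (AlgebraicClosure K) (AlgebraicClosure L) := ι.toRingHom.toAlgebra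
  haveI : IsScalarTower K (AlgebraicClosure K) (AlgebraicClosure L) :=
    IsScalarTower.of_algebraMap_eq fun x => (ι.commutes x).symm
  (AlgEquiv.restrictNormalHom (F := K) (K₁ := AlgebraicClosure L) (AlgebraicClosure K)).comp
    (AlgEquiv.restrictScalarsHom K (S := L) (A := AlgebraicClosure L))

/-- `absGalRestrictHom ι σ` is the automorphism induced by `σ` through the embedding `ι`. -/
theorem absGalRestrictHom_spec (ι : AlgebraicClosure K →ₐ[K] AlgebraicClosure L)
    (σ : AbsGal L) (x : AlgebraicClosure K) :
    ι (absGalRestrictHom ι σ x) = σ (ι x) := by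
  let : Algebra (AlgebraicClosure K) (AlgebraicClosure L) := ι.toRingHom.toAlgebra
  have : IsScalarTower K (AlgebraicClosure K) (AlgebraicClosure L) :=
    IsScalarTower.of_algebraMap_eq fun x => (ι.commutes x).symm
  exact AlgEquiv.restrictNormal_commutes (σ.restrictScalars K) (AlgebraicClosure K) x

theorem absGalRestrictHom_continuous (ι : AlgebraicClosure K →ₐ[K] AlgebraicClosure L) :
    Continuous (absGalRestrictHom ι) := by
  apply continuous_of_continuousAt_one
  intro U hU
  rw [map_one] at hU
  obtain ⟨E, hE, hEU⟩ := (krullTopology_mem_nhds_one_iff K (AlgebraicClosure K) U).1 hU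
  obtain ⟨S, hS⟩ := IntermediateField.fg_def.1
    (IntermediateField.essFiniteType_iff.1 inferInstance : E.FG)
  let E' : IntermediateField L (AlgebraicClosure L) := IntermediateField.adjoin L (ι '' S)
  have : Finite (ι '' S : Set (AlgebraicClosure L)) := hS.1.image ι
  have : FiniteDimensional L E' := IntermediateField.finiteDimensional_adjoin
    fun x _ => (AlgebraicClosure.isAlgebraic L).isAlgebraic x |>.isIntegral
  rw [Filter.mem_map]
  refine Filter.mem_of_superset
    ((IntermediateField.fixingSubgroup_isOpen E').mem_nhds (one_mem E'.fixingSubgroup)) ?_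
  intro σ hσ
  refine hEU ?_
  have h1 : ∀ x ∈ S, absGalRestrictHom ι σ x = x := by
    intro x hx
    refine ι.injective ((absGalRestrictHom_spec ι σ x).trans ?_)
    exact (IntermediateField.mem_fixingSubgroup_iff E' σ).1 hσ _
      (IntermediateField.subset_adjoin L _ ⟨x, hx, rfl⟩)
  refine (IntermediateField.mem_fixingSubgroup_iff E _).2 fun x hx => ?_
  rw [← hS.2] at hx
  induction hx using IntermediateField.adjoin_induction with
  | mem x hx => exact h1 x hx
  | algebraMap x => exact AlgEquiv.commutes _ x
  | add x y _ _ hx hy => exact (map_add _ x y).trans (congrArg₂ _ hx hy)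
  | inv x _ hx => exact (map_inv₀ _ x).trans (congrArg _ hx)
  | mul x y _ _ hx hy => exact (map_mul _ x y).trans (congrArg₂ _ hx hy)

/-- The restriction map `G_L → G_K` as a continuous homomorphism. -/
def absGalRestrict (ι : AlgebraicClosure K →ₐ[K] AlgebraicClosure L) :
    AbsGal L →ₜ* AbsGal K where
  toMonoidHom := absGalRestrictHom ι
  continuous_toFun := absGalRestrictHom_continuous ι

/-- The image `χ_L` in `H¹(L, ℚ/ℤ)` of a character `χ ∈ H¹(K, ℚ/ℤ)`: its composite with the
restriction map `G_L → G_K`. -/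
def GalH1.res (ι : AlgebraicClosure K →ₐ[K] AlgebraicClosure L) (χ : GalH1 K) : GalH1 L :=
  ContinuousMonoidHom.comp χ (absGalRestrict ι)

end Restriction

/-! ### Kato's Swan conductor in characteristic `p`, by Artin–Schreier–Witt theory -/

section Swan

/-- The map `W_s(R) → W_s(S)` given by a function `R → S` on the Witt components. For a ring
homomorphism this is the functorial map; for `x ↦ x ^ p` on a ring of characteristic `p` it is the
Frobenius `F`. -/
def wittMap (p : ℕ) {s : ℕ} {R S : Type*} (f : R → S) (a : TruncatedWittVector p s R) :
    TruncatedWittVector p s S :=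
  TruncatedWittVector.mk p fun i => f (a.coeff i)

/-- For a field `K` of characteristic `p`: the character `χ` is the image of the Witt vector `a`
under the Artin–Schreier–Witt isomorphism `W_s(K)/(F - 1) ≃ H¹(K, ℤ/p^s)` and the inclusion of
`ℤ/p^s = p^{-s}ℤ/ℤ` in `ℚ/ℤ`. That is, for a solution `x` of `F x - x = a` over the algebraic
closure, `σ x - x` is the image in `W_s` of an integer `k`, and `χ σ` is the class of `k / p^s`. -/
def IsArtinSchreierWitt (p : ℕ) [Fact p.Prime] {K : Type*} [Field K] {s : ℕ}
    (a : TruncatedWittVector p s K) (χ : GalH1 K) : Prop :=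
  ∃ x : TruncatedWittVector p s (AlgebraicClosure K),
    wittMap p (fun y => y ^ p) x - x = wittMap p (algebraMap K (AlgebraicClosure K)) a ∧
    ∀ σ : AbsGal K, ∃ k : ℤ,
      wittMap p σ x - x = (k : TruncatedWittVector p s (AlgebraicClosure K)) ∧
      χ σ = Multiplicative.ofAdd (QModZ.mk ((k : ℚ) / (p : ℚ) ^ s))

variable (A : Type*) [CommRing A] [IsDomain A] [IsDiscreteValuationRing A]

/-- Brylinski's filtration `F_n W_s(K)`: the Witt vectors `(a_{s-1}, …, a_0)` with
`p^i v_K(a_i) ≥ -n` for all `i`. The Witt component number `j` (from `0`) is `a_{s-1-j}`.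
The valuation is written multiplicatively: `v (π) = exp (-1)`. -/
def wittFil (p : ℕ) (K : Type*) [Field K] [Algebra A K] [IsFractionRing A K] (s n : ℕ) :
    Set (TruncatedWittVector p s K) :=
  {a | ∀ j : Fin s, (IsDiscreteValuationRing.maximalIdeal A).valuation K (a.coeff j) ^
    (p ^ (j.rev : ℕ)) ≤ WithZero.exp (n : ℤ)}

/-- Kato's filtration `F_n H¹(K, ℚ/ℤ)`: on the `p`-primary part it is the union over `s` of the
images of the `F_n W_s(K)`, and it contains the prime-to-`p` part. -/
def swanFil (p : ℕ) [Fact p.Prime] (K : Type*) [Field K] [Algebra A K] [IsFractionRing A K]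
    (n : ℕ) : Set (GalH1 K) :=
  {χ | ∃ m : ℕ, m.Coprime p ∧ ∃ s : ℕ, ∃ a ∈ wittFil A p K s n, IsArtinSchreierWitt p a (χ ^ m)}

/-- Kato's Swan conductor `Sw χ`: the smallest `n ≥ 0` with `χ ∈ F_n H¹(K, ℚ/ℤ)`. -/
def swan (p : ℕ) [Fact p.Prime] {K : Type*} [Field K] [Algebra A K] [IsFractionRing A K]
    (χ : GalH1 K) : ℕ :=
  sInf {n : ℕ | χ ∈ swanFil A p K n}

end Swan

/-! ### Differential forms with log poles and `δ_tor` -/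

section LogDifferentials

/-- The relations `da - a ⊗ a`, for `a ∈ A` nonzero. -/
def logRelations (A K : Type*) [CommRing A] [Field K] [Algebra A K] :
    Submodule A (Ω[A⁄ℤ] × (A ⊗[ℤ] Additive Kˣ)) :=
  Submodule.span A {ω | ∃ (a : A) (u : Kˣ), algebraMap A K a = u ∧
    ω = (KaehlerDifferential.D ℤ A a, -(a ⊗ₜ[ℤ] Additive.ofMul u))}

/-- `Ω¹_A(log)`, for `A` with fraction field `K`: the quotient of `Ω¹_A ⊕ (A ⊗_ℤ Kˣ)` by the
relations `da - a ⊗ a`. -/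
abbrev LogDiff (A K : Type*) [CommRing A] [Field K] [Algebra A K] : Type _ :=
  (Ω[A⁄ℤ] × (A ⊗[ℤ] Additive Kˣ)) ⧸ logRelations A K

/-- The completed module `Ω̂¹_A(log) = lim_m Ω¹_A(log) / 𝔪^m Ω¹_A(log)`. -/
abbrev ComplLogDiff (A K : Type*) [CommRing A] [IsLocalRing A] [Field K] [Algebra A K] : Type _ :=
  AdicCompletion (maximalIdeal A) (LogDiff A K)

variable (A K B L : Type*) [CommRing A] [Field K] [Algebra A K]
  [CommRing B] [Field L] [Algebra B L] [Algebra A B] [Algebra K L] [Algebra A L]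
  [IsScalarTower A K L] [IsScalarTower A B L]

/-- The map `Ω¹_A ⊕ (A ⊗ Kˣ) → Ω¹_B ⊕ (B ⊗ Lˣ)`, `(da, b ⊗ u) ↦ (da, b ⊗ u)`. -/
def logPreMap : (Ω[A⁄ℤ] × (A ⊗[ℤ] Additive Kˣ)) →ₛₗ[algebraMap A B]
    (Ω[B⁄ℤ] × (B ⊗[ℤ] Additive Lˣ)) where
  toFun ω := (KaehlerDifferential.map ℤ ℤ A B ω.1,
    TensorProduct.map (algebraMap A B).toAddMonoidHom.toIntLinearMap
      (MonoidHom.toAdditive (Units.map (algebraMap K L : K →* L))).toIntLinearMap ω.2)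
  map_add' := by intro x y; simp
  map_smul' := by
    intro a ω
    ext1
    · simp
    · simp only [Prod.smul_snd]
      induction ω.2 with
      | zero => simp
      | add x y hx hy => simp only [smul_add, map_add, hx, hy]
      | tmul x y => simp [TensorProduct.smul_tmul', smul_eq_mul, Algebra.smul_def]

theorem logPreMap_relations : logRelations A K ≤ (logRelations B L).comap (logPreMap A K B L) := by
  refine Submodule.span_le.2 ?_
  rintro _ ⟨a, u, hu, rfl⟩
  refine Submodule.subset_span ⟨algebraMap A B a, Units.map (algebraMap K L : K →* L) u, ?_, ?_⟩
  · rw [← IsScalarTower.algebraMap_apply, IsScalarTower.algebraMap_apply A K L, hu]; rfl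
  · simp [logPreMap]

/-- The natural map `Ω¹_A(log) → Ω¹_B(log)`. -/
def logMap : LogDiff A K →ₛₗ[algebraMap A B] LogDiff B L :=
  Submodule.mapQ _ _ (logPreMap A K B L) (logPreMap_relations A K B L)

variable [IsLocalRing A] [IsLocalRing B] [IsLocalHom (algebraMap A B)]

theorem logMap_pow (n : ℕ) :
    (maximalIdeal A ^ n • ⊤ : Submodule A (LogDiff A K)) ≤
      (maximalIdeal B ^ n • ⊤ : Submodule B (LogDiff B L)).comap (logMap A K B L) := by
  refine Submodule.smul_le.2 fun r hr x _ => ?_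
  rw [Submodule.mem_comap, LinearMap.map_smulₛₗ]
  refine Submodule.smul_mem_smul ?_ trivial
  have h : (maximalIdeal A ^ n).map (algebraMap A B) ≤ maximalIdeal B ^ n := by
    rw [Ideal.map_pow]
    exact Ideal.pow_right_mono (map_maximalIdeal_le (algebraMap A B)) n
  exact h (Ideal.mem_map_of_mem _ hr)

/-- The natural map `Ω̂¹_A(log) → Ω̂¹_B(log)`: on each level it is the map
`Ω¹_A(log)/𝔪_A^n → Ω¹_B(log)/𝔪_B^n` induced by `logMap`. -/
def complLogMap : ComplLogDiff A K →ₛₗ[algebraMap A B] ComplLogDiff B L where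
  toFun x := ⟨fun n => Submodule.mapQ _ _ (logMap A K B L) (logMap_pow A K B L n) (x.1 n), by
    intro m n hmn
    have h := x.2 hmn
    obtain ⟨y, hy⟩ := Submodule.Quotient.mk_surjective _ (x.1 n)
    rw [← hy] at h
    beta_reduce
    rw [← hy, ← h]
    rfl⟩
  map_add' x y := by
    refine Subtype.ext (funext fun n => ?_)
    exact map_add _ (x.1 n) (y.1 n)
  map_smul' a x := by
    refine Subtype.ext (funext fun n => ?_)
    exact LinearMap.map_smulₛₗ _ a (x.1 n)

/-- The quotient of `Ω̂¹_B(log)` by (the image of) `B ⊗_A Ω̂¹_A(log)`. -/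
abbrev ComplRelLogDiff : Type _ :=
  ComplLogDiff B L ⧸ Submodule.span B (Set.range (complLogMap A K B L))

/-- The length, as a `B`-module, of the torsion part of `Ω̂¹_B(log) / (B ⊗_A Ω̂¹_A(log))`. -/
def deltaTor : ℕ∞ :=
  Module.length B (Submodule.torsion B (ComplRelLogDiff A K B L))

end LogDifferentials

end

open IsLocalRing
open scoped TensorProduct

noncomputable section

set_option linter.unusedSectionVars false

/-! ### Operations on truncated Witt vectors -/

section WittOperations

variable {p : ℕ} [Fact p.Prime]

/-! For a Witt vector a consider F^{s-1}da = ∑ a_i^{p^i-1} da_i in Brylinski's numbering, evaluated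
along derivations D as `wittDeriv D a`. It is additive and kills Frobenius images, so replacing a by
a - (F - 1)b only adds the derivative of b. If D is logarithmic (|Dx| ≤ |x|) and a ∈ F_n, its
absolute value is at most exp n.

The key is a converse: if n ≥ 1, a ∈ F_n and every logarithmic derivation gives a value smaller than
exp n, then a ∈ F_{n-1} + (F - 1)F_{⌊n/p⌋} (`exists_sub_frob_sub_mem_wittFil_pred`). On leading
coefficients this becomes a statement about the residue field: ∑ y_i^{p^i-1} dy_i = 0 forces every
y_i to be a p-th power. It is proved with D^{p-1}, for a suitable D with D^p = 0, in the role of the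
Cartier operator. Enough logarithmic derivations exist because a complete discrete valuation ring of
characteristic p is a power series ring over its residue field.

Hence Swan conductors can be read off from derivatives (`swan_eq_of_dvrVal_wittDeriv`): if a ∈ F_N
represents a prime-to-p multiple of χ, and the largest value of its derivatives along logarithmic
derivations is exp n' with ⌊N/p⌋ < n', then Sw χ = n'. The ambiguity b lies in F_{⌊N/p⌋}, too small
to be seen at level n'.

Let t be a uniformizer of K. As the residue field is perfect, K = ∑ t^i K^p, so every derivation of
K is a multiple of E = t d/dt and the completed logarithmic forms are spanned by d log t. If a
realizes n = Sw χ > 0, its derivative along E has absolute value exactly exp n. A derivation D of L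
restricts to (Dt/t)E on K, so D has the value |Dt/t| exp(en) on a, and the maximum over logarithmic
D is exp(en - δ), where δ is the least valuation of Dt/t. Separability makes δ finite. Logarithmic
derivations detect divisibility of logarithmic forms (`mem_maximalIdeal_pow_smul_top_of_hom_mem`),
so d log t = π^δ z over O_L with z taken to a unit by some functional; the torsion of the quotient
is then O_L/π^δ, whence δ = δ_tor (`exists_deltaTor_eq`). The criterion applies with N = en and n' =
en - δ, because the lower bound on Sw χ says exactly that en/p < en - δ. -/

theorem wittMap_truncate {R S : Type*} [CommRing R] [CommRing S] (s : ℕ) (f : R →+* S)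
    (x : WittVector p R) :
    wittMap p f (WittVector.truncate s x) = WittVector.truncate s (WittVector.map f x) := by
  ext i
  simp [wittMap, WittVector.coeff_truncate]

theorem exists_truncate_eq {R : Type*} [CommRing R] {s : ℕ} (a : TruncatedWittVector p s R) :
    ∃ x : WittVector p R, WittVector.truncate s x = a :=
  WittVector.truncate_surjective p s R a

@[simp] theorem coeff_wittMap {R S : Type*} {s : ℕ} (f : R → S)
    (a : TruncatedWittVector p s R) (j : Fin s) : (wittMap p f a).coeff j = f (a.coeff j) := by
  simp [wittMap]

theorem wittMap_sub {R S : Type*} [CommRing R] [CommRing S] {s : ℕ} (f : R →+* S)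
    (a b : TruncatedWittVector p s R) : wittMap p f (a - b) = wittMap p f a - wittMap p f b := by
  obtain ⟨x, rfl⟩ := exists_truncate_eq a
  obtain ⟨y, rfl⟩ := exists_truncate_eq b
  simp only [← map_sub, wittMap_truncate]

theorem wittMap_intCast {R S : Type*} [CommRing R] [CommRing S] {s : ℕ} (f : R →+* S) (k : ℤ) :
    wittMap p f (k : TruncatedWittVector p s R) = k := by
  rw [← map_intCast (WittVector.truncate (p := p) (R := R) s), wittMap_truncate, map_intCast,
    map_intCast]

/-- The functorial map on truncated Witt vectors, as an additive homomorphism. -/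
def wittMapHom {R S : Type*} [CommRing R] [CommRing S] (s : ℕ) (f : R →+* S) :
    TruncatedWittVector p s R →+ TruncatedWittVector p s S :=
  AddMonoidHom.ofMapSub (wittMap p f) (wittMap_sub f)

theorem wittMapHom_apply {R S : Type*} [CommRing R] [CommRing S] {s : ℕ} (f : R →+* S)
    (a : TruncatedWittVector p s R) : wittMapHom s f a = wittMap p f a := rfl

/-- The Frobenius of `W_s(R)`, for `R` of characteristic `p`. -/
def wittFrob (s : ℕ) (R : Type*) [CommRing R] [CharP R p] :
    TruncatedWittVector p s R →+ TruncatedWittVector p s R :=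
  wittMapHom s (frobenius R p)

theorem wittFrob_eq {s : ℕ} {R : Type*} [CommRing R] [CharP R p]
    (a : TruncatedWittVector p s R) : wittFrob s R a = wittMap p (fun y => y ^ p) a := rfl

@[simp] theorem coeff_wittFrob {s : ℕ} {R : Type*} [CommRing R] [CharP R p]
    (a : TruncatedWittVector p s R) (j : Fin s) : (wittFrob s R a).coeff j = a.coeff j ^ p := by
  simp [wittFrob_eq]

/-- After extending coefficients to ℚ the prime p becomes invertible and the ghost map bijective.
This allows Witt vector identities to be checked on ghost components in the universal case. -/
theorem ghostMap_injective_mvPolynomial (σ : Type*) :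
    Function.Injective (WittVector.ghostMap (p := p) (R := MvPolynomial σ ℤ)) := by
  intro x y hxy
  have : Invertible (p : ℚ) := invertibleOfNonzero (by exact_mod_cast (Fact.out : p.Prime).ne_zero)
  have : Invertible (p : MvPolynomial σ ℚ) :=
    (Invertible.map (MvPolynomial.C (σ := σ) (R := ℚ)) (p : ℚ)).copy _ (by simp)
  refine WittVector.map_injective (MvPolynomial.map (Int.castRingHom ℚ))
    (MvPolynomial.map_injective _ Int.cast_injective) ?_
  refine (WittVector.ghostMap.bijective_of_invertible p (MvPolynomial σ ℚ)).1 (funext fun n => ?_)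
  have h := congrFun hxy n
  simp only [WittVector.ghostMap_apply, WittVector.ghostComponent_apply,
    aeval_wittPolynomial] at h ⊢
  simpa [WittVector.map_coeff] using congrArg (MvPolynomial.map (Int.castRingHom ℚ)) h

/-- Every ring is a quotient of a polynomial ring over ℤ, where ghost components suffice:
multiplying the n-th one by c^{p^n} multiplies each summand p^i x_i^{p^{n-i}} accordingly. -/
theorem coeff_teichmuller_mul {R : Type*} [CommRing R] (c : R) (x : WittVector p R) (n : ℕ) :
    (WittVector.teichmuller p c * x).coeff n = c ^ p ^ n * x.coeff n := by
  let f : MvPolynomial R ℤ →+* R := (MvPolynomial.aeval (R := ℤ) (id : R → R)).toRingHom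
  have hf : Function.Surjective f := fun r => ⟨MvPolynomial.X r, by simp [f]⟩
  obtain ⟨x, rfl⟩ := WittVector.map_surjective f hf x
  obtain ⟨c, rfl⟩ := hf c
  have key : WittVector.teichmuller p c * x = WittVector.mk p fun n => c ^ p ^ n * x.coeff n := by
    refine ghostMap_injective_mvPolynomial R (funext fun n => ?_)
    simp only [WittVector.ghostMap_apply, map_mul, WittVector.ghostComponent_teichmuller]
    simp only [WittVector.ghostComponent_apply, aeval_wittPolynomial, Finset.mul_sum]
    refine Finset.sum_congr rfl fun i hi => ?_
    rw [WittVector.coeff_mk, mul_pow, ← pow_mul, ← pow_add,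
      Nat.add_sub_cancel' (Nat.lt_succ_iff.1 (Finset.mem_range.1 hi))]
    ring
  rw [← WittVector.map_teichmuller, ← map_mul, key]
  simp [WittVector.map_coeff]

/-- Multiplication of `W_s(R)` by the Teichmüller representative of `c`. -/
def wittScale {R : Type*} [CommRing R] (s : ℕ) (c : R) :
    TruncatedWittVector p s R →+ TruncatedWittVector p s R :=
  AddMonoidHom.mulLeft (WittVector.truncate s (WittVector.teichmuller p c))

@[simp] theorem coeff_wittScale {R : Type*} [CommRing R] {s : ℕ} (c : R)
    (a : TruncatedWittVector p s R) (j : Fin s) :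
    (wittScale s c a).coeff j = c ^ p ^ (j : ℕ) * a.coeff j := by
  obtain ⟨x, rfl⟩ := exists_truncate_eq a
  simp only [wittScale, AddMonoidHom.coe_mulLeft, ← map_mul, WittVector.coeff_truncate,
    coeff_teichmuller_mul]

/-- The Verschiebung `W_s(R) → W_{s+1}(R)`. -/
def wittVer {R : Type*} [CommRing R] {s : ℕ} (a : TruncatedWittVector p s R) :
    TruncatedWittVector p (s + 1) R :=
  TruncatedWittVector.mk p (Fin.cons 0 a.coeff)

theorem coeff_wittVer_zero {R : Type*} [CommRing R] {s : ℕ} (a : TruncatedWittVector p s R) :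
    (wittVer a).coeff 0 = 0 := by simp [wittVer]

theorem coeff_wittVer_succ {R : Type*} [CommRing R] {s : ℕ} (a : TruncatedWittVector p s R)
    (j : Fin s) : (wittVer a).coeff j.succ = a.coeff j := by
  simp [wittVer]

theorem wittVer_truncate {R : Type*} [CommRing R] (s : ℕ) (x : WittVector p R) :
    wittVer (WittVector.truncate s x) = WittVector.truncate (s + 1) (WittVector.verschiebung x) := by
  ext i
  refine Fin.cases ?_ (fun i => ?_) i
  · rw [coeff_wittVer_zero, WittVector.coeff_truncate]; simp
  · rw [coeff_wittVer_succ, WittVector.coeff_truncate, WittVector.coeff_truncate]; simp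

theorem wittVer_sub {R : Type*} [CommRing R] {s : ℕ} (a b : TruncatedWittVector p s R) :
    wittVer (a - b) = wittVer a - wittVer b := by
  obtain ⟨x, rfl⟩ := exists_truncate_eq a
  obtain ⟨y, rfl⟩ := exists_truncate_eq b
  simp only [← map_sub, wittVer_truncate]

theorem wittMap_wittVer {R S : Type*} [CommRing R] [CommRing S] {s : ℕ} (f : R →+* S)
    (a : TruncatedWittVector p s R) : wittMap p f (wittVer a) = wittVer (wittMap p f a) := by
  obtain ⟨x, rfl⟩ := exists_truncate_eq a
  simp only [wittMap_truncate, wittVer_truncate, WittVector.map_verschiebung]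

/-- Frobenius fixes integers and VF = p in characteristic p. -/
theorem wittVer_intCast {R : Type*} [CommRing R] [CharP R p] {s : ℕ} (k : ℤ) :
    wittVer (k : TruncatedWittVector p s R) = ((p * k : ℤ) : TruncatedWittVector p (s + 1) R) := by
  rw [← map_intCast (WittVector.truncate (p := p) (R := R) s), wittVer_truncate,
    ← map_intCast (WittVector.truncate (p := p) (R := R) (s + 1)), Int.cast_mul, Int.cast_natCast, mul_comm]
  congr 1
  rw [← WittVector.verschiebung_frobenius, map_intCast (WittVector.frobenius (p := p) (R := R))]

theorem natCast_pow_eq_zero_truncated {R : Type*} [CommRing R] [CharP R p] (s : ℕ) :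
    (p : TruncatedWittVector p s R) ^ s = 0 := by
  rw [← map_natCast (WittVector.truncate (p := p) (R := R) s), ← map_pow]
  ext j
  rw [WittVector.coeff_truncate, WittVector.coeff_p_pow_eq_zero p R (Nat.ne_of_lt j.2),
    TruncatedWittVector.coeff_zero]

end WittOperations

/-! ### The additive map `F^{s-1} d` -/

section WittDeriv

variable {p : ℕ} [Fact p.Prime]

/-- The map `a ↦ ∑ a_i ^ (p ^ i - 1) D a_i`, the sum being over the Brylinski numbering `a_i` of the
components of `a`. -/
def wittDeriv {R M : Type*} [CommRing R] [AddCommGroup M] [Module R M] (D : Derivation ℤ R M)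
    {s : ℕ} (a : TruncatedWittVector p s R) : M :=
  ∑ j : Fin s, a.coeff j ^ (p ^ (j.rev : ℕ) - 1) • D (a.coeff j)

/-- D(p^j x_j^{p^{s-j}}) = p^s x_j^{p^{s-j}-1} D x_j, so `wittDeriv` is the derivative of a ghost
component divided by p^s. Ghost components being additive, this is the source of the additivity of
`wittDeriv`. -/
theorem derivation_ghostComponent {R M : Type*} [CommRing R] [AddCommGroup M] [Module R M]
    (D : Derivation ℤ R M) (s : ℕ) (x : WittVector p R) :
    D (WittVector.ghostComponent s x) =
      p ^ s • wittDeriv D (WittVector.truncate (s + 1) x) := by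
  rw [WittVector.ghostComponent_apply, aeval_wittPolynomial, map_sum, wittDeriv,
    Finset.smul_sum, Finset.sum_range]
  refine Finset.sum_congr rfl fun j _ => ?_
  have hj : (j.rev : ℕ) = s - j := by rw [Fin.val_rev]; omega
  have h1 : D ((p : R) ^ (j : ℕ)) = 0 := by
    rw [← Nat.cast_pow]; exact D.map_natCast _
  rw [D.leibniz, h1, smul_zero, add_zero, D.leibniz_pow, WittVector.coeff_truncate, hj,
    ← Nat.cast_smul_eq_nsmul R, ← Nat.cast_smul_eq_nsmul R, smul_smul, smul_smul, smul_smul]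
  congr 1
  push_cast
  rw [← pow_add, Nat.add_sub_cancel' (Nat.lt_succ_iff.1 j.2)]

theorem wittDeriv_comp {R R' M M' : Type*} [CommRing R] [CommRing R'] [Algebra R' R]
    [AddCommGroup M] [Module R M] [AddCommGroup M'] [Module R' M']
    (D : Derivation ℤ R M) (D' : Derivation ℤ R' M') (g : M' →+ M)
    (hg : ∀ (r : R') (m : M'), g (r • m) = algebraMap R' R r • g m)
    (h : ∀ r, g (D' r) = D (algebraMap R' R r)) {s : ℕ} (a : TruncatedWittVector p s R') :
    wittDeriv D (wittMap p (algebraMap R' R) a) = g (wittDeriv D' a) := by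
  simp [wittDeriv, hg, h]

theorem wittDeriv_truncate_sub_of_injective {R : Type*} [CommRing R] {s : ℕ}
    (h : Function.Injective fun ω : Ω[R⁄ℤ] => p ^ s • ω) (x y : WittVector p R) :
    wittDeriv (KaehlerDifferential.D ℤ R) (WittVector.truncate (s + 1) (x - y)) =
      wittDeriv (KaehlerDifferential.D ℤ R) (WittVector.truncate (s + 1) x) -
        wittDeriv (KaehlerDifferential.D ℤ R) (WittVector.truncate (s + 1) y) := by
  apply h
  simp only [smul_sub]
  rw [← derivation_ghostComponent, ← derivation_ghostComponent, ← derivation_ghostComponent,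
    map_sub, map_sub]

theorem nsmul_kaehler_mvPolynomial_injective (σ : Type*) [inst : Algebra ℤ (MvPolynomial σ ℤ)]
    {n : ℕ} (hn : n ≠ 0) :
    Function.Injective fun ω : Ω[MvPolynomial σ ℤ⁄ℤ] => n • ω := by
  obtain rfl : inst = AddMonoidAlgebra.algebra := Subsingleton.elim _ _
  intro ω ω' h
  refine (KaehlerDifferential.mvPolynomialBasis ℤ σ).repr.injective (Finsupp.ext fun i => ?_)
  have h' := DFunLike.congr_fun
    (congrArg (KaehlerDifferential.mvPolynomialBasis ℤ σ).repr h) i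
  simp only [map_nsmul, Finsupp.smul_apply, nsmul_eq_mul] at h'
  exact mul_left_cancel₀ (Nat.cast_ne_zero.2 hn) h'

/-- Both vectors lift to a polynomial ring P over ℤ. The differentials of P have no p-torsion, so
the factor p^s in `derivation_ghostComponent` can be cancelled there; the result specializes along P
→ R. -/
theorem wittDeriv_sub {R M : Type*} [CommRing R] [AddCommGroup M] [Module R M]
    (D : Derivation ℤ R M) {s : ℕ} (a b : TruncatedWittVector p s R) :
    wittDeriv D (a - b) = wittDeriv D a - wittDeriv D b := by
  obtain _ | s := s
  · simp [wittDeriv]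
  obtain ⟨P, _, _, hP, htf⟩ : ∃ (P : Type _) (_ : CommRing P) (_ : Algebra P R),
      Function.Surjective (algebraMap P R) ∧
        Function.Injective fun ω : Ω[P⁄ℤ] => p ^ s • ω := by
    refine ⟨MvPolynomial R ℤ, inferInstance,
      (MvPolynomial.aeval (R := ℤ) (id : R → R)).toRingHom.toAlgebra, ?_, ?_⟩
    · exact fun r => ⟨MvPolynomial.X r, MvPolynomial.aeval_X _ _⟩
    · exact nsmul_kaehler_mvPolynomial_injective R (pow_ne_zero _ (Fact.out : p.Prime).ne_zero)
  let : Module P M := Module.compHom M (algebraMap P R)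
  have : IsScalarTower P R M := ⟨fun x y m => by rw [Algebra.smul_def, mul_smul]; rfl⟩
  let D' : Derivation ℤ P M := D.compAlgebraMap P
  obtain ⟨x, rfl⟩ := exists_truncate_eq a
  obtain ⟨y, rfl⟩ := exists_truncate_eq b
  obtain ⟨x, rfl⟩ := WittVector.map_surjective _ hP x
  obtain ⟨y, rfl⟩ := WittVector.map_surjective _ hP y
  have key : ∀ x : WittVector p P,
      wittDeriv D (WittVector.truncate (s + 1) (WittVector.map (algebraMap P R) x)) =
      D'.liftKaehlerDifferential (wittDeriv (KaehlerDifferential.D ℤ P)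
        (WittVector.truncate (s + 1) x)) := by
    intro x
    rw [← wittMap_truncate]
    refine wittDeriv_comp D (KaehlerDifferential.D ℤ P)
      D'.liftKaehlerDifferential.toAddMonoidHom (fun r m => ?_) (fun r => ?_) _
    · exact map_smul D'.liftKaehlerDifferential r m
    · exact D'.liftKaehlerDifferential_comp_D r
  rw [← map_sub, ← map_sub, key, key, key, ← map_sub, wittDeriv_truncate_sub_of_injective htf]

/-- The map `F^{s-1} d` as an additive homomorphism. -/
def wittDerivHom {R M : Type*} [CommRing R] [AddCommGroup M] [Module R M]
    (D : Derivation ℤ R M) (s : ℕ) : TruncatedWittVector p s R →+ M :=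
  AddMonoidHom.ofMapSub (wittDeriv D) (wittDeriv_sub D)

theorem wittDeriv_nsmul {R M : Type*} [CommRing R] [AddCommGroup M] [Module R M]
    (D : Derivation ℤ R M) {s : ℕ} (m : ℕ) (a : TruncatedWittVector p s R) :
    wittDeriv D (m • a) = m • wittDeriv D a :=
  map_nsmul (wittDerivHom D s) m a

theorem derivation_pow_char {R M : Type*} [CommRing R] [CharP R p] [AddCommGroup M] [Module R M]
    (D : Derivation ℤ R M) (x : R) : D (x ^ p) = 0 := by
  rw [D.leibniz_pow, ← Nat.cast_smul_eq_nsmul R, CharP.cast_eq_zero, zero_smul]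

theorem wittDeriv_frob {R M : Type*} [CommRing R] [CharP R p] [AddCommGroup M] [Module R M]
    (D : Derivation ℤ R M) {s : ℕ} (a : TruncatedWittVector p s R) :
    wittDeriv D (wittFrob s R a) = 0 := by
  simp only [wittDeriv, coeff_wittFrob, derivation_pow_char, smul_zero, Finset.sum_const_zero]

/-- Exponents are counted from the last component, and V inserts its zero at the front. -/
theorem wittDeriv_wittVer {R M : Type*} [CommRing R] [AddCommGroup M] [Module R M]
    (D : Derivation ℤ R M) {s : ℕ} (a : TruncatedWittVector p s R) :
    wittDeriv D (wittVer a) = wittDeriv D a := by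
  simp only [wittDeriv]
  rw [Fin.sum_univ_succ]
  simp only [coeff_wittVer_zero, coeff_wittVer_succ, map_zero, smul_zero, zero_add, Fin.rev_succ,
    Fin.val_castSucc]

end WittDeriv

/-! ### Brylinski's filtration -/

section Filtration

theorem WithZero.lt_exp_natCast_iff {w : WithZero (Multiplicative ℤ)} {n : ℕ} (hn : n ≠ 0) :
    w < exp (n : ℤ) ↔ w ≤ exp ((n - 1 : ℕ) : ℤ) := by
  obtain rfl | ⟨m, rfl⟩ : w = 0 ∨ ∃ m, w = exp m := by
    by_cases h : w = 0
    · exact Or.inl h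
    · exact Or.inr ⟨log w, (exp_log h).symm⟩
  · simp
  · rw [exp_lt_exp, exp_le_exp]; omega

theorem WithZero.pow_le_exp_natCast_iff {w : WithZero (Multiplicative ℤ)} {n p : ℕ} (hp : 0 < p) :
    w ^ p ≤ exp (n : ℤ) ↔ w ≤ exp ((n / p : ℕ) : ℤ) := by
  obtain rfl | ⟨m, rfl⟩ : w = 0 ∨ ∃ m, w = exp m := by
    by_cases h : w = 0
    · exact Or.inl h
    · exact Or.inr ⟨log w, (exp_log h).symm⟩
  · simp [hp.ne']
  · rw [← exp_nsmul, exp_le_exp, exp_le_exp, nsmul_eq_mul]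
    push_cast
    rw [Int.le_ediv_iff_mul_le (by exact_mod_cast hp), mul_comm]

variable {p : ℕ} [Fact p.Prime]
variable (A K : Type*) [CommRing A] [IsDomain A] [IsDiscreteValuationRing A]
  [Field K] [Algebra A K] [IsFractionRing A K]

/-- The normalized valuation of the fraction field of a discrete valuation ring. -/
abbrev dvrVal : Valuation K (WithZero (Multiplicative ℤ)) :=
  (IsDiscreteValuationRing.maximalIdeal A).valuation K

variable {A K}

theorem exists_algebraMap_eq_of_dvrVal_le_one {x : K} (hx : dvrVal A K x ≤ 1) :
    ∃ a : A, algebraMap A K a = x :=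
  IsDedekindDomain.HeightOneSpectrum.mem_integers_of_valuation_le_one K x fun v => by
    have : v = IsDiscreteValuationRing.maximalIdeal A := by
      ext1
      exact IsLocalRing.eq_maximalIdeal v.isMaximal
    rw [this]
    exact hx

theorem dvrVal_lt_one_iff {a : A} : dvrVal A K (algebraMap A K a) < 1 ↔ a ∈ maximalIdeal A :=
  IsDedekindDomain.HeightOneSpectrum.valuation_lt_one_iff_mem _ a

theorem dvrVal_le_one (a : A) : dvrVal A K (algebraMap A K a) ≤ 1 :=
  IsDedekindDomain.HeightOneSpectrum.valuation_le_one _ a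

theorem exists_wittMap_eq_of_dvrVal_le_one {s : ℕ} {a : TruncatedWittVector p s K}
    (ha : ∀ j, dvrVal A K (a.coeff j) ≤ 1) :
    ∃ α : TruncatedWittVector p s A, wittMap p (algebraMap A K) α = a := by
  choose α hα using fun j => exists_algebraMap_eq_of_dvrVal_le_one (ha j)
  refine ⟨TruncatedWittVector.mk p α, ?_⟩
  ext j
  simp [hα]

theorem dvrVal_coeff_sub_le_one {s : ℕ} {a b : TruncatedWittVector p s K}
    (ha : ∀ j, dvrVal A K (a.coeff j) ≤ 1) (hb : ∀ j, dvrVal A K (b.coeff j) ≤ 1) (j : Fin s) :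
    dvrVal A K ((a - b).coeff j) ≤ 1 := by
  obtain ⟨α, rfl⟩ := exists_wittMap_eq_of_dvrVal_le_one ha
  obtain ⟨β, rfl⟩ := exists_wittMap_eq_of_dvrVal_le_one hb
  rw [← wittMap_sub, coeff_wittMap]
  exact dvrVal_le_one _

/-- Congruent integral vectors have the same image in the Witt vectors of the residue field, so
their difference reduces to zero. -/
theorem dvrVal_coeff_sub_lt_one {s : ℕ} {a b : TruncatedWittVector p s K}
    (ha : ∀ j, dvrVal A K (a.coeff j) ≤ 1) (hb : ∀ j, dvrVal A K (b.coeff j) ≤ 1)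
    (hab : ∀ j, dvrVal A K (a.coeff j - b.coeff j) < 1) (j : Fin s) :
    dvrVal A K ((a - b).coeff j) < 1 := by
  obtain ⟨α, rfl⟩ := exists_wittMap_eq_of_dvrVal_le_one ha
  obtain ⟨β, rfl⟩ := exists_wittMap_eq_of_dvrVal_le_one hb
  have h : wittMap p (residue A) α = wittMap p (residue A) β := by
    ext j
    have h1 := hab j
    rw [coeff_wittMap, coeff_wittMap, ← map_sub, dvrVal_lt_one_iff, ← residue_eq_zero_iff, map_sub,
      sub_eq_zero] at h1
    rw [coeff_wittMap, coeff_wittMap, h1]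
  rw [← wittMap_sub, coeff_wittMap, dvrVal_lt_one_iff, ← residue_eq_zero_iff,
    ← coeff_wittMap (residue A) (α - β) j, wittMap_sub, h, sub_self, TruncatedWittVector.coeff_zero]

variable (A K) in
theorem exists_dvrVal_eq_exp (m : ℤ) : ∃ x : K, dvrVal A K x = WithZero.exp m :=
  (IsDiscreteValuationRing.maximalIdeal A).valuation_surjective (K := K) (WithZero.exp m)

variable [CharP K p]

/-- The additive map `a ↦ [c] F^{s-1} a`, used to move the steps of Brylinski's filtration to the
integral Witt vectors. -/
def wittRescale (s : ℕ) (c : K) : TruncatedWittVector p s K →+ TruncatedWittVector p s K :=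
  (wittScale s c).comp (wittMapHom s (iterateFrobenius K p (s - 1)))

/-- The exponents match since s - 1 is the sum of j and its reverse. When v(c) = n, integrality of
every component on the right is exactly membership of a in F_n, and the left side is additive in a.
-/
theorem coeff_wittRescale {s : ℕ} (c : K) (a : TruncatedWittVector p s K) (j : Fin s) :
    (wittRescale s c a).coeff j = (c * a.coeff j ^ p ^ (j.rev : ℕ)) ^ p ^ (j : ℕ) := by
  have h : s - 1 = (j.rev : ℕ) + j := by rw [Fin.val_rev]; omega
  simp only [wittRescale, AddMonoidHom.comp_apply, wittMapHom_apply, coeff_wittScale,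
    coeff_wittMap, iterateFrobenius_def]
  rw [mul_pow, ← pow_mul, ← pow_add, h]

theorem pow_p_pow_le_one_iff {w : WithZero (Multiplicative ℤ)} (j : ℕ) :
    w ^ p ^ j ≤ 1 ↔ w ≤ 1 :=
  pow_le_one_iff (pow_ne_zero _ (Fact.out : p.Prime).ne_zero)

theorem pow_p_pow_lt_one_iff {w : WithZero (Multiplicative ℤ)} (j : ℕ) :
    w ^ p ^ j < 1 ↔ w < 1 :=
  pow_lt_one_iff (pow_ne_zero _ (Fact.out : p.Prime).ne_zero)

theorem dvrVal_coeff_wittRescale_le_one_iff {s n : ℕ} {c : K}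
    (hc : dvrVal A K c = WithZero.exp (-n : ℤ)) {a : TruncatedWittVector p s K} (j : Fin s) :
    dvrVal A K ((wittRescale s c a).coeff j) ≤ 1 ↔
      dvrVal A K (a.coeff j) ^ p ^ (j.rev : ℕ) ≤ WithZero.exp (n : ℤ) := by
  rw [coeff_wittRescale, map_pow, pow_p_pow_le_one_iff, map_mul, hc, map_pow, WithZero.exp_neg,
    inv_mul_le_iff₀ (WithZero.exp_pos), mul_one]

theorem dvrVal_coeff_wittRescale_lt_one_iff {s n : ℕ} {c : K}
    (hc : dvrVal A K c = WithZero.exp (-n : ℤ)) {a : TruncatedWittVector p s K} (j : Fin s) :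
    dvrVal A K ((wittRescale s c a).coeff j) < 1 ↔
      dvrVal A K (a.coeff j) ^ p ^ (j.rev : ℕ) < WithZero.exp (n : ℤ) := by
  rw [coeff_wittRescale, map_pow, pow_p_pow_lt_one_iff, map_mul, hc, map_pow, WithZero.exp_neg,
    inv_mul_lt_iff₀ (WithZero.exp_pos), mul_one]

theorem sub_mem_wittFil {s n : ℕ} {a b : TruncatedWittVector p s K}
    (ha : a ∈ wittFil A p K s n) (hb : b ∈ wittFil A p K s n) : a - b ∈ wittFil A p K s n := by
  obtain ⟨c, hc⟩ := exists_dvrVal_eq_exp A K (-n : ℤ)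
  intro j
  rw [← dvrVal_coeff_wittRescale_le_one_iff hc, map_sub]
  exact dvrVal_coeff_sub_le_one (fun j => (dvrVal_coeff_wittRescale_le_one_iff hc j).2 (ha j))
    (fun j => (dvrVal_coeff_wittRescale_le_one_iff hc j).2 (hb j)) j

variable (A K) in
/-- The filtration step `F_n W_s(K)` as a subgroup. -/
def wittFilSubgroup (s n : ℕ) : AddSubgroup (TruncatedWittVector p s K) :=
  AddSubgroup.ofSub (wittFil A p K s n)
    ⟨0, fun j => by
      rw [TruncatedWittVector.coeff_zero, map_zero, zero_pow
        (pow_ne_zero _ (Fact.out : p.Prime).ne_zero)]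
      exact zero_le⟩
    fun a ha b hb => by rw [← sub_eq_add_neg]; exact sub_mem_wittFil ha hb

/-- After rescaling by c with v(c) = n, the hypothesis says that two integral vectors agree modulo
the maximal ideal componentwise; p-power maps commute with subtraction, so the components of the
rescaled vectors can be compared. -/
theorem sub_mem_wittFil_pred {s n : ℕ} (hn : n ≠ 0) {a b : TruncatedWittVector p s K}
    (ha : a ∈ wittFil A p K s n) (hb : b ∈ wittFil A p K s n)
    (hab : ∀ j : Fin s, dvrVal A K (a.coeff j - b.coeff j) ^ p ^ (j.rev : ℕ) <
      WithZero.exp (n : ℤ)) : a - b ∈ wittFil A p K s (n - 1) := by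
  obtain ⟨c, hc⟩ := exists_dvrVal_eq_exp A K (-n : ℤ)
  intro j
  rw [← WithZero.lt_exp_natCast_iff hn, ← dvrVal_coeff_wittRescale_lt_one_iff hc, map_sub]
  refine dvrVal_coeff_sub_lt_one
    (fun j => (dvrVal_coeff_wittRescale_le_one_iff hc j).2 (ha j))
    (fun j => (dvrVal_coeff_wittRescale_le_one_iff hc j).2 (hb j)) (fun j => ?_) j
  have h := (dvrVal_coeff_wittRescale_lt_one_iff
    (a := TruncatedWittVector.mk p fun j => a.coeff j - b.coeff j) hc j).2 (by simpa using hab j)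
  rw [coeff_wittRescale] at h ⊢
  rw [coeff_wittRescale, ← sub_pow_char_pow, ← mul_sub, ← sub_pow_char_pow]
  simpa using h

theorem wittFil_mono {s n n' : ℕ} (h : n ≤ n') : wittFil A p K s n ⊆ wittFil A p K s n' :=
  fun _ ha j => (ha j).trans (WithZero.exp_le_exp.2 (by exact_mod_cast h))

theorem exists_mem_wittFil {s : ℕ} (a : TruncatedWittVector p s K) :
    ∃ n, a ∈ wittFil A p K s n := by
  have h : ∀ j : Fin s, ∃ n : ℕ,
      dvrVal A K (a.coeff j) ^ p ^ (j.rev : ℕ) ≤ WithZero.exp (n : ℤ) := by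
    intro j
    by_cases h0 : dvrVal A K (a.coeff j) ^ p ^ (j.rev : ℕ) = 0
    · exact ⟨0, by rw [h0]; exact zero_le⟩
    · refine ⟨(WithZero.log (dvrVal A K (a.coeff j) ^ p ^ (j.rev : ℕ))).toNat, ?_⟩
      rw [← WithZero.log_le_iff_le_exp h0]
      exact Int.self_le_toNat _
  choose n hn using h
  exact ⟨∑ j, n j, fun j => (hn j).trans (WithZero.exp_le_exp.2
    (by exact_mod_cast Finset.single_le_sum (fun _ _ => Nat.zero_le _) (Finset.mem_univ j)))⟩

theorem wittFrob_mem_wittFil_iff {s n : ℕ} {b : TruncatedWittVector p s K} :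
    wittFrob s K b ∈ wittFil A p K s n ↔ b ∈ wittFil A p K s (n / p) := by
  refine forall_congr' fun j => ?_
  rw [coeff_wittFrob, map_pow, ← pow_mul, mul_comm, pow_mul,
    WithZero.pow_le_exp_natCast_iff (Fact.out : p.Prime).pos]

/-- Frobenius multiplies pole orders by p. If the least N with b ∈ F_N exceeded n, then Fb = (Fb -
b) + b would lie in F_N, hence b in F_{⌊N/p⌋}, against minimality. -/
theorem mem_wittFil_div_of_frob_sub_mem {s n : ℕ} {b : TruncatedWittVector p s K}
    (h : wittFrob s K b - b ∈ wittFil A p K s n) : b ∈ wittFil A p K s (n / p) := by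
  have hp := (Fact.out : p.Prime)
  suffices hb : b ∈ wittFil A p K s n by
    rw [← wittFrob_mem_wittFil_iff]
    have h1 := (wittFilSubgroup A K s n).add_mem h hb
    rwa [sub_add_cancel] at h1
  classical
  have hex := exists_mem_wittFil (A := A) b
  have hN := Nat.find_spec hex
  set N := Nat.find hex with hNdef
  by_contra hbn
  have hlt : n < N := by
    by_contra hle
    exact hbn (wittFil_mono (not_lt.1 hle) hN)
  have h1 : wittFrob s K b ∈ wittFil A p K s N := by
    have h1 := (wittFilSubgroup A K s N).add_mem (wittFil_mono hlt.le h) hN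
    rwa [sub_add_cancel] at h1
  exact Nat.find_min hex (Nat.div_lt_self (by omega) hp.one_lt) (wittFrob_mem_wittFil_iff.1 h1)

theorem wittVer_mem_wittFil {s n : ℕ} {a : TruncatedWittVector p s K}
    (ha : a ∈ wittFil A p K s n) : wittVer a ∈ wittFil A p K (s + 1) n := by
  intro j
  refine Fin.cases ?_ (fun j => ?_) j
  · rw [coeff_wittVer_zero, map_zero, zero_pow (pow_ne_zero _ (Fact.out : p.Prime).ne_zero)]
    exact zero_le
  · rw [coeff_wittVer_succ, Fin.rev_succ]
    exact ha j

variable (A) in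
/-- A logarithmic derivation of the fraction field of a discrete valuation ring: one that does not
decrease the valuation. -/
def IsLogDer (D : Derivation ℤ K K) : Prop := ∀ x, dvrVal A K (D x) ≤ dvrVal A K x

theorem dvrVal_wittDeriv_le {D : Derivation ℤ K K} (hD : IsLogDer A D) {s n : ℕ}
    {a : TruncatedWittVector p s K} (ha : a ∈ wittFil A p K s n) :
    dvrVal A K (wittDeriv D a) ≤ WithZero.exp (n : ℤ) := by
  refine Valuation.map_sum_le _ fun j _ => ?_
  refine le_trans ?_ (ha j)
  rw [smul_eq_mul, map_mul, map_pow]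
  refine (mul_le_mul_right (hD _) _).trans (le_of_eq ?_)
  rw [← pow_succ, Nat.sub_add_cancel (Nat.one_le_pow _ _ (Fact.out : p.Prime).pos)]

end Filtration

/-! ### Artin–Schreier–Witt characters -/

section ArtinSchreierWitt

theorem QModZ.mk_sub (r s : ℚ) : QModZ.mk (r - s) = QModZ.mk r - QModZ.mk s := rfl

theorem QModZ.mk_nsmul (m : ℕ) (r : ℚ) : QModZ.mk (m * r) = m • QModZ.mk r := by
  rw [← nsmul_eq_mul]; rfl

theorem QModZ.mk_eq_zero_iff {r : ℚ} : QModZ.mk r = 0 ↔ ∃ k : ℤ, (k : ℚ) = r := by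
  refine (QuotientAddGroup.eq_zero_iff r).trans ?_
  simp [AddSubgroup.mem_zmultiples_iff]

variable {p : ℕ} [Fact p.Prime] {K : Type*} [Field K]

/-- A fixed element is its only conjugate, so its minimal polynomial has separable degree one.
Inseparability enters because characters are defined over the algebraic closure. -/
theorem exists_pow_mem_range_of_forall_algEquiv_apply_eq [CharP K p] {y : AlgebraicClosure K}
    (hy : ∀ σ : AbsGal K, σ y = y) :
    ∃ (n : ℕ) (z : K), algebraMap K (AlgebraicClosure K) z = y ^ p ^ n := by
  have : ExpChar K p := ExpChar.prime Fact.out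
  have hint : IsIntegral K y := Algebra.IsIntegral.isIntegral y
  classical
  refine (minpoly.natSepDegree_eq_one_iff_pow_mem p (x := y) (F := K)).1 ?_
  rw [Polynomial.natSepDegree_eq_of_isAlgClosed (AlgebraicClosure K), Finset.card_eq_one]
  refine ⟨y, Finset.eq_singleton_iff_unique_mem.2 ⟨?_, fun z hz => ?_⟩⟩
  · rw [Multiset.mem_toFinset, Polynomial.mem_aroots]
    exact ⟨minpoly.ne_zero hint, minpoly.aeval K y⟩
  · rw [Multiset.mem_toFinset, Polynomial.mem_aroots] at hz
    have hconj : IsConjRoot K z y :=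
      ((isConjRoot_iff_aeval_eq_zero hint).2 hz.2).symm
    obtain ⟨σ, hσ⟩ := hconj.exists_algEquiv
    rw [← hσ, hy]

theorem IsArtinSchreierWitt.nsmul {s : ℕ} {a : TruncatedWittVector p s K}
    {χ : GalH1 K} (h : IsArtinSchreierWitt p a χ) [CharP K p] (m : ℕ) :
    IsArtinSchreierWitt p (m • a) (χ ^ m) := by
  obtain ⟨x, hx, hχ⟩ := h
  refine ⟨m • x, ?_, fun σ => ?_⟩
  · rw [← wittFrob_eq, ← wittMapHom_apply, map_nsmul, map_nsmul, wittFrob_eq, wittMapHom_apply,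
      ← hx, smul_sub]
  · obtain ⟨k, hk, hk'⟩ := hχ σ
    refine ⟨m * k, ?_, ?_⟩
    · have := map_nsmul (wittMapHom (p := p) s (σ : AlgebraicClosure K →+* AlgebraicClosure K)) m x
      rw [wittMapHom_apply, wittMapHom_apply] at this
      change wittMap p σ (m • x) = m • wittMap p σ x at this
      rw [this, ← smul_sub, hk, nsmul_eq_mul]
      push_cast; rfl
    · rw [ContinuousMonoidHom.pow_apply, hk', ← ofAdd_nsmul, ← QModZ.mk_nsmul]
      push_cast
      rw [mul_div_assoc]

theorem IsArtinSchreierWitt.div {s : ℕ} {a b : TruncatedWittVector p s K}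
    {χ ψ : GalH1 K} (h : IsArtinSchreierWitt p a χ) (h' : IsArtinSchreierWitt p b ψ) [CharP K p] :
    IsArtinSchreierWitt p (a - b) (χ / ψ) := by
  obtain ⟨x, hx, hχ⟩ := h
  obtain ⟨y, hy, hψ⟩ := h'
  refine ⟨x - y, ?_, fun σ => ?_⟩
  · rw [← wittFrob_eq, map_sub, wittMap_sub, ← hx, ← hy, wittFrob_eq, wittFrob_eq]
    abel
  · obtain ⟨k, hk, hk'⟩ := hχ σ
    obtain ⟨l, hl, hl'⟩ := hψ σ
    refine ⟨k - l, ?_, ?_⟩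
    · have := wittMap_sub (p := p) (σ : AlgebraicClosure K →+* AlgebraicClosure K) x y
      change wittMap p σ (x - y) = wittMap p σ x - wittMap p σ y at this
      rw [this, Int.cast_sub, ← hk, ← hl]
      abel
    · change (χ σ) / (ψ σ) = _
      rw [hk', hl', ← ofAdd_sub, ← QModZ.mk_sub]
      push_cast
      rw [sub_div]

theorem IsArtinSchreierWitt.sub_frob_sub {s : ℕ} {a : TruncatedWittVector p s K}
    {χ : GalH1 K} (h : IsArtinSchreierWitt p a χ) [CharP K p] (b : TruncatedWittVector p s K) :
    IsArtinSchreierWitt p (a - (wittFrob s K b - b)) χ := by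
  obtain ⟨x, hx, hχ⟩ := h
  refine ⟨x - wittMap p (algebraMap K (AlgebraicClosure K)) b, ?_, fun σ => ?_⟩
  · have hF : wittFrob s _ (wittMap p (algebraMap K (AlgebraicClosure K)) b) =
        wittMap p (algebraMap K (AlgebraicClosure K)) (wittFrob s K b) := by
      ext j; simp
    rw [← wittFrob_eq, map_sub, hF, wittMap_sub, wittMap_sub, ← hx, wittFrob_eq]
    abel
  · obtain ⟨k, hk, hk'⟩ := hχ σ
    refine ⟨k, ?_, hk'⟩
    have := wittMap_sub (p := p) (σ : AlgebraicClosure K →+* AlgebraicClosure K) x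
      (wittMap p (algebraMap K (AlgebraicClosure K)) b)
    change wittMap p σ (x - _) = wittMap p σ x - wittMap p σ _ at this
    have h2 : wittMap p σ (wittMap p (algebraMap K (AlgebraicClosure K)) b) =
        wittMap p (algebraMap K (AlgebraicClosure K)) b := by
      ext j; simp
    rw [this, h2, ← hk]
    abel

theorem IsArtinSchreierWitt.wittVer {s : ℕ} {a : TruncatedWittVector p s K}
    {χ : GalH1 K} (h : IsArtinSchreierWitt p a χ) [CharP K p] :
    IsArtinSchreierWitt p (wittVer a) χ := by
  obtain ⟨x, hx, hχ⟩ := h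
  refine ⟨_root_.wittVer x, ?_, fun σ => ?_⟩
  · rw [wittMap_wittVer, ← hx, wittVer_sub, ← wittFrob_eq, ← wittFrob_eq, wittFrob,
      wittMapHom_apply, wittMap_wittVer]
    rfl
  · obtain ⟨k, hk, hk'⟩ := hχ σ
    refine ⟨p * k, ?_, ?_⟩
    · have := wittMap_wittVer (p := p) (σ : AlgebraicClosure K →+* AlgebraicClosure K) x
      change wittMap p σ (_root_.wittVer x) = _root_.wittVer (wittMap p σ x) at this
      rw [this, ← wittVer_sub, hk, wittVer_intCast]
    · rw [hk']
      have hp : (p : ℚ) ≠ 0 := by exact_mod_cast (Fact.out : p.Prime).ne_zero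
      congr 2
      push_cast
      rw [pow_succ']
      field_simp

/-- Injectivity in Artin–Schreier–Witt theory. Triviality of the character makes the solution x
Galois-fixed, so a Frobenius iterate of x comes from K; but Fx - x = c also comes from K, so the
iterates differ from x by vectors over K and x itself is defined over K. -/
theorem IsArtinSchreierWitt.exists_frob_sub_eq [CharP K p] {s : ℕ} {c : TruncatedWittVector p s K}
    (h : IsArtinSchreierWitt p c 1) : ∃ b, wittFrob s K b - b = c := by
  obtain ⟨x, hx, hχ⟩ := h
  have hfix : ∀ σ : AbsGal K, wittMap p σ x = x := by
    intro σ
    obtain ⟨k, hk, hk'⟩ := hχ σ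
    have h0 : QModZ.mk ((k : ℚ) / (p : ℚ) ^ s) = 0 := Multiplicative.ofAdd.injective hk'.symm
    obtain ⟨l, hl⟩ := QModZ.mk_eq_zero_iff.1 h0
    have hp : (p : ℚ) ^ s ≠ 0 := pow_ne_zero _ (by exact_mod_cast (Fact.out : p.Prime).ne_zero)
    rw [eq_div_iff hp] at hl
    have hl' : k = l * (p : ℤ) ^ s := by exact_mod_cast hl.symm
    rw [hl', Int.cast_mul, Int.cast_pow, Int.cast_natCast, natCast_pow_eq_zero_truncated,
      mul_zero, sub_eq_zero] at hk
    exact hk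
  set i := algebraMap K (AlgebraicClosure K)
  have hpow : ∀ j, ∃ (n : ℕ) (z : K), i z = x.coeff j ^ p ^ n := by
    intro j
    refine exists_pow_mem_range_of_forall_algEquiv_apply_eq fun σ => ?_
    conv_rhs => rw [← hfix σ]
    rw [coeff_wittMap]
  choose n z hz using hpow
  obtain ⟨N, hN⟩ : ∃ N, ∀ j, n j ≤ N :=
    ⟨∑ j, n j, fun j => Finset.single_le_sum (fun _ _ => Nat.zero_le _) (Finset.mem_univ j)⟩
  have hF : ∀ b, wittFrob s _ (wittMap p i b) = wittMap p i (wittFrob s K b) := by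
    intro b; ext j; simp
  have hk : ∀ k, ∃ d, (wittFrob s (AlgebraicClosure K))^[k] x = x + wittMap p i d := by
    intro k
    induction k with
    | zero => exact ⟨0, by rw [← wittMapHom_apply, map_zero, add_zero]; rfl⟩
    | succ k ih =>
      obtain ⟨d, hd⟩ := ih
      refine ⟨c + wittFrob s K d, ?_⟩
      rw [Function.iterate_succ_apply', hd, map_add, hF, ← wittMapHom_apply, ← wittMapHom_apply,
        map_add, wittMapHom_apply, wittMapHom_apply, ← hx, wittFrob_eq]
      abel
  obtain ⟨d, hd⟩ := hk N
  have hco : ∀ k j, ((wittFrob s (AlgebraicClosure K))^[k] x).coeff j = x.coeff j ^ p ^ k := by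
    intro k j
    induction k with
    | zero => simp
    | succ k ih => rw [Function.iterate_succ_apply', coeff_wittFrob, ih, ← pow_mul, ← pow_succ]
  -- Component j becomes rational after n j Frobenius steps; raising it to p^(N - n j) brings all
  -- components to the common level N.
  let e : TruncatedWittVector p s K := TruncatedWittVector.mk p fun j => z j ^ p ^ (N - n j)
  have he : wittMap p i e = (wittFrob s (AlgebraicClosure K))^[N] x := by
    ext j
    rw [hco, coeff_wittMap, TruncatedWittVector.coeff_mk, map_pow, hz, ← pow_mul, ← pow_add,
      Nat.add_sub_cancel' (hN j)]
  have hxe : x = wittMap p i (e - d) := by rw [wittMap_sub, he, hd, add_sub_cancel_right]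
  refine ⟨e - d, ?_⟩
  rw [hxe, ← wittFrob_eq, hF, ← wittMap_sub] at hx
  ext j
  have := congrArg (TruncatedWittVector.coeff j) hx
  rw [coeff_wittMap, coeff_wittMap] at this
  exact i.injective this

variable {L : Type*} [Field L] [Algebra K L]

theorem IsArtinSchreierWitt.res {s : ℕ} {a : TruncatedWittVector p s K} {χ : GalH1 K}
    (h : IsArtinSchreierWitt p a χ) (ι : AlgebraicClosure K →ₐ[K] AlgebraicClosure L)
    [CharP K p] [CharP L p] :
    IsArtinSchreierWitt p (wittMap p (algebraMap K L) a) (χ.res ι) := by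
  obtain ⟨x, hx, hχ⟩ := h
  refine ⟨wittMap p ι x, ?_, fun σ => ?_⟩
  · have h1 : wittMap p (algebraMap L (AlgebraicClosure L)) (wittMap p (algebraMap K L) a) =
        wittMap p (ι : AlgebraicClosure K →+* AlgebraicClosure L)
          (wittMap p (algebraMap K (AlgebraicClosure K)) a) := by
      ext j
      simp only [coeff_wittMap, RingHom.coe_coe, AlgHom.commutes]
      exact (IsScalarTower.algebraMap_apply K L (AlgebraicClosure L) _).symm
    rw [h1, ← hx, wittMap_sub]
    congr 1
    ext j; simp
  · obtain ⟨k, hk, hk'⟩ := hχ (absGalRestrict ι σ)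
    refine ⟨k, ?_, hk'⟩
    rw [← wittMap_intCast (ι : AlgebraicClosure K →+* AlgebraicClosure L) k, ← hk, wittMap_sub]
    congr 1
    ext j
    simp only [coeff_wittMap]
    exact (absGalRestrictHom_spec ι σ _).symm

end ArtinSchreierWitt

/-! ### Derivations of a field of characteristic `p` -/

section FieldDerivations

variable {p : ℕ} [Fact p.Prime] {k : Type*} [Field k] [CharP k p]

variable (p) in
-- Zorn's lemma. Over such a maximal F the element u generates k with degree p, so d/du makes sense
-- without choosing a p-basis.
theorem exists_maximal_subfield_notMem {u : k} (hu : ∀ w : k, w ^ p ≠ u) :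
    ∃ F : Subfield k, (∀ w, w ^ p ∈ F) ∧ u ∉ F ∧ ∀ F' : Subfield k, F ≤ F' → u ∉ F' → F' = F := by
  have hub : ∀ c ⊆ {F : Subfield k | (frobenius k p).fieldRange ≤ F ∧ u ∉ F},
      IsChain (· ≤ ·) c → ∀ F ∈ c, ∃ ub ∈ {F : Subfield k | (frobenius k p).fieldRange ≤ F ∧ u ∉ F},
        ∀ z ∈ c, z ≤ ub := by
    intro c hc hchain F hF
    refine ⟨sSup c, ⟨(hc hF).1.trans (le_sSup hF), fun h => ?_⟩, fun _ => le_sSup⟩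
    obtain ⟨F', hF', hu'⟩ := (Subfield.mem_sSup_of_directedOn ⟨F, hF⟩ hchain.directedOn).1 h
    exact (hc hF').2 hu'
  obtain ⟨F, hF, hmax⟩ := zorn_le_nonempty₀ _ hub (frobenius k p).fieldRange
    ⟨le_rfl, fun ⟨w, hw⟩ => hu w hw⟩
  refine ⟨F, fun w => hmax.prop.1 ⟨w, rfl⟩, hmax.prop.2, fun F' h h' => ?_⟩
  exact le_antisymm (hmax.le_of_ge ⟨hmax.prop.1.trans h, h'⟩ h) h

theorem minpoly_eq_of_notMem (F : Subfield k) (hF : ∀ w, w ^ p ∈ F) {x : k} (hx : x ∉ F) :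
    minpoly F x = Polynomial.X ^ p - Polynomial.C (⟨x ^ p, hF x⟩ : F) := by
  have hp := (Fact.out : p.Prime)
  refine (minpoly.eq_of_irreducible_of_monic ?_ ?_ (Polynomial.monic_X_pow_sub_C _ hp.ne_zero)).symm
  · refine X_pow_sub_C_irreducible_of_prime hp fun b hb => hx ?_
    have h : (b : k) ^ p = x ^ p := congrArg Subtype.val hb
    rw [← frobenius_inj k p h]
    exact b.2
  · have h : algebraMap F k ⟨x ^ p, hF x⟩ = x ^ p := rfl
    simp [h]

open Polynomial in
variable (p) in
/-- For an element `u` which is not a `p`-th power, a derivation acting as `d/du` on the polynomials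
in `u` over a subfield over which `u` generates. -/
theorem exists_derivation_aeval {u : k} (hu : ∀ w : k, w ^ p ≠ u) :
    ∃ (F : Subfield k) (D : Derivation ℤ k k), Function.Surjective (aeval (R := F) u) ∧
      ∀ f : F[X], D (aeval u f) = aeval u (derivative f) := by
  have hp := (Fact.out : p.Prime)
  obtain ⟨F, hF, huF, hmax⟩ := exists_maximal_subfield_notMem p hu
  have hfin : ∀ x : k, x ∉ F → IsIntegral F x ∧
      Module.finrank F (IntermediateField.adjoin F {x}) = p := by
    intro x hx
    have hm := minpoly_eq_of_notMem F hF hx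
    have hint : IsIntegral F x := by
      by_contra h
      rw [minpoly.eq_zero h] at hm
      exact (monic_X_pow_sub_C _ hp.ne_zero).ne_zero hm.symm
    refine ⟨hint, ?_⟩
    rw [IntermediateField.adjoin.finrank hint, hm, natDegree_X_pow_sub_C]
  -- For x outside F, maximality puts u in F(x); both F(u) and F(x) have degree p over F, so they
  -- coincide.
  have hsurj : Function.Surjective (aeval (R := F) u) := by
    intro x
    have hmem : x ∈ IntermediateField.adjoin F {u} := by
      by_cases hx : x ∈ F
      · exact (IntermediateField.adjoin F {u}).algebraMap_mem ⟨x, hx⟩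
      have hux : u ∈ IntermediateField.adjoin F {x} := by
        by_contra h
        have h1 := hmax (IntermediateField.adjoin F {x}).toSubfield
          (fun y hy => (IntermediateField.adjoin F {x}).algebraMap_mem ⟨y, hy⟩) h
        exact hx (h1.le (IntermediateField.mem_adjoin_simple_self F x))
      have hle : IntermediateField.adjoin F {u} ≤ IntermediateField.adjoin F {x} :=
        IntermediateField.adjoin_le_iff.2 (Set.singleton_subset_iff.2 hux)
      have : FiniteDimensional F (IntermediateField.adjoin F {x}) :=
        IntermediateField.adjoin.finiteDimensional (hfin x hx).1
      rw [IntermediateField.eq_of_le_of_finrank_eq hle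
        ((hfin u huF).2.trans (hfin x hx).2.symm)]
      exact IntermediateField.mem_adjoin_simple_self F x
    have h2 : x ∈ Algebra.adjoin F {u} := by
      rw [← IntermediateField.adjoin_simple_toSubalgebra_of_isAlgebraic (hfin u huF).1.isAlgebraic]
      exact hmem
    rw [Algebra.adjoin_singleton_eq_range_aeval] at h2
    exact h2
  -- Formal differentiation descends to k because the minimal polynomial X^p - u^p of u has
  -- derivative zero.
  have hd : ∀ f : F[X], aeval u f = 0 → aeval u (derivative' f) = 0 := by
    intro f hf
    obtain ⟨g, rfl⟩ := minpoly.dvd F u hf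
    have h1 : algebraMap F k ⟨u ^ p, hF u⟩ = u ^ p := rfl
    have h2 : aeval u (X ^ p - C (⟨u ^ p, hF u⟩ : F)) = 0 := by simp [h1]
    rw [derivative'_apply, derivative_mul, minpoly_eq_of_notMem F hF huF, map_add, map_mul,
      map_mul, h2, zero_mul, add_zero, derivative_sub, derivative_X_pow, derivative_C]
    simp
  refine ⟨F, (Derivation.liftOfRightInverse (Function.rightInverse_surjInv hsurj) hd).restrictScalars
    ℤ, hsurj, fun f => ?_⟩
  exact Derivation.liftOfRightInverse_apply (Function.rightInverse_surjInv hsurj) hd f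

theorem derivation_iterate_pow_char_mul (D : Derivation ℤ k k) (c x : k) (n : ℕ) :
    D^[n] (c ^ p * x) = c ^ p * D^[n] x := by
  induction n with
  | zero => rfl
  | succ n ih =>
    rw [Function.iterate_succ_apply', ih, D.leibniz, derivation_pow_char, smul_zero, add_zero,
      smul_eq_mul, Function.iterate_succ_apply']

theorem derivation_iterate_map_add (D : Derivation ℤ k k) (x y : k) (n : ℕ) :
    D^[n] (x + y) = D^[n] x + D^[n] y :=
  iterate_map_add D n x y

open Polynomial in
variable (p) in
/-- If `u` is not a `p`-th power, there is a derivation `D` with `D u = 1`, `D ^ p = 0` and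
`D ^ (p - 1) (x ^ (p - 1) D x) = - (D x) ^ p`. -/
theorem exists_derivation_eq_one {u : k} (hu : ∀ w : k, w ^ p ≠ u) :
    ∃ D : Derivation ℤ k k, D u = 1 ∧ (∀ x, D^[p] x = 0) ∧
      ∀ x, D^[p - 1] (x ^ (p - 1) * D x) = -(D x) ^ p := by
  have hp := (Fact.out : p.Prime)
  obtain ⟨F, D, hsurj, hD⟩ := exists_derivation_aeval p hu
  have hDn : ∀ (n : ℕ) (f : F[X]), D^[n] (aeval u f) = aeval u (derivative^[n] f) := by
    intro n f
    induction n with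
    | zero => rfl
    | succ n ih => rw [Function.iterate_succ_apply', ih, hD, Function.iterate_succ_apply']
  have hDp : ∀ x, D^[p] x = 0 := by
    intro x
    obtain ⟨f, rfl⟩ := hsurj x
    rw [hDn, iterate_derivative_eq_factorial_smul_sum, ← Nat.cast_smul_eq_nsmul F,
      (CharP.cast_eq_zero_iff F p _).2 (hp.dvd_factorial.2 le_rfl), zero_smul, map_zero]
  have hu1 : D u = 1 := by simpa using hD X
  refine ⟨D, hu1, hDp, ?_⟩
  -- Additivity of `wittDeriv` on the vectors (x, 0) shows that x^{p-1}Dx is additive up to some Dg,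
  -- with g the second component of (x, 0) - (y, 0). Since D^p = 0, applying D^{p-1} removes Dg, and
  -- the identity need only be checked on monomials in u.
  have hsub : ∀ x y, D^[p - 1] (x ^ (p - 1) * D x) = -(D x) ^ p →
      D^[p - 1] (y ^ (p - 1) * D y) = -(D y) ^ p →
      D^[p - 1] ((x - y) ^ (p - 1) * D (x - y)) = -(D (x - y)) ^ p := by
    intro x y hx hy
    let e : k → TruncatedWittVector p 2 k := fun x => TruncatedWittVector.mk p ![x, 0]
    have he : ∀ x, wittDeriv D (e x) = x ^ (p - 1) * D x := by
      intro x
      simp [wittDeriv, e, Fin.sum_univ_two]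
    have h0 : (e x - e y).coeff 0 = x - y := by
      obtain ⟨a, ha⟩ := exists_truncate_eq (e x)
      obtain ⟨b, hb⟩ := exists_truncate_eq (e y)
      have ha0 : a.coeff 0 = x := by
        have := congrArg (TruncatedWittVector.coeff 0) ha
        rw [WittVector.coeff_truncate] at this
        simpa [e] using this
      have hb0 : b.coeff 0 = y := by
        have := congrArg (TruncatedWittVector.coeff 0) hb
        rw [WittVector.coeff_truncate] at this
        simpa [e] using this
      rw [← ha, ← hb, ← map_sub, WittVector.coeff_truncate]
      exact (map_sub (WittVector.constantCoeff (p := p) (R := k)) a b).trans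
        (congrArg₂ _ ha0 hb0)
    have h1 := wittDeriv_sub D (e x) (e y)
    rw [he, he, wittDeriv, Fin.sum_univ_two, h0] at h1
    set g := (e x - e y).coeff 1
    have h2 : x ^ (p - 1) * D x =
        ((x - y) ^ (p - 1) * D (x - y) + D g) + y ^ (p - 1) * D y := by
      rw [← sub_eq_iff_eq_add, ← h1]
      simp
    rw [h2, derivation_iterate_map_add, derivation_iterate_map_add, hy,
      ← Function.iterate_succ_apply, Nat.succ_eq_add_one, Nat.sub_add_cancel hp.one_le, hDp] at hx
    have h3 : (D x) ^ p - (D y) ^ p = (D (x - y)) ^ p := by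
      rw [map_sub D x y, sub_pow_char]
    linear_combination hx - h3
  have h0 : D^[p - 1] ((0 : k) ^ (p - 1) * D 0) = -(D 0) ^ p := by
    have := hsub u u
    rw [map_zero, mul_zero, zero_pow hp.ne_zero, neg_zero]
    exact iterate_map_zero D _
  have hadd : ∀ x y, D^[p - 1] (x ^ (p - 1) * D x) = -(D x) ^ p →
      D^[p - 1] (y ^ (p - 1) * D y) = -(D y) ^ p →
      D^[p - 1] ((x + y) ^ (p - 1) * D (x + y)) = -(D (x + y)) ^ p := by
    intro x y hx hy
    have := hsub x (0 - y) hx (hsub 0 y h0 hy)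
    rwa [zero_sub, sub_neg_eq_add] at this
  -- The value is (p - 1)!, which is -1 by Wilson's theorem.
  have hwilson : D^[p - 1] (u ^ (p - 1)) = -1 := by
    have h := hDn (p - 1) (X ^ (p - 1))
    rw [map_pow, aeval_X] at h
    rw [h, iterate_derivative_X_pow_eq_smul, Nat.sub_self, pow_zero, Nat.descFactorial_self]
    have hw := congrArg (ZMod.castHom (dvd_refl p) k) (ZMod.wilsons_lemma p)
    rw [map_natCast, map_neg, map_one] at hw
    rw [map_smul, map_one, Algebra.smul_def, map_natCast, hw, mul_one]
  intro x
  obtain ⟨f, rfl⟩ := hsurj x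
  induction f using Polynomial.induction_on' with
  | add f g hf hg => rw [map_add]; exact hadd _ _ hf hg
  | monomial m c =>
    obtain _ | m := m
    · simp only [hD, derivative_monomial, Nat.cast_zero, mul_zero, map_zero,
        zero_pow hp.ne_zero, neg_zero]
      exact iterate_map_zero D _
    have hm : ((m + 1 : ℕ) : k) ^ p = ((m + 1 : ℕ) : k) := map_natCast (frobenius k p) (m + 1)
    rw [hD, derivative_monomial, aeval_monomial, aeval_monomial]
    set c' := algebraMap F k c
    -- A p-th power, constant for D, is split off and only u^{p-1} is left to differentiate; (m +
    -- 1)^p = m + 1 lies in the prime field.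
    have h1 : (c' * u ^ (m + 1)) ^ (p - 1) * (algebraMap F k (c * ((m + 1 : ℕ) : F)) *
        u ^ (m + 1 - 1)) = (((m + 1 : ℕ) : k) * c' * u ^ m) ^ p * u ^ (p - 1) := by
      obtain ⟨q, hq⟩ : ∃ q, p = q + 1 := ⟨p - 1, (Nat.sub_add_cancel hp.one_le).symm⟩
      rw [mul_pow (((m + 1 : ℕ) : k) * c'), mul_pow ((m + 1 : ℕ) : k), hm, map_mul, map_natCast, hq]
      simp only [Nat.add_sub_cancel]
      ring
    rw [h1, derivation_iterate_pow_char_mul, hwilson, map_mul, map_natCast]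
    simp only [Nat.add_sub_cancel]
    ring

/-- D^{p-1} kills D y_0 and sends the term of index i + 1 to -(y_{i+1}^{p^i-1} D y_{i+1})^p. The
relation becomes, up to sign, the p-th power of the shorter relation for y_1, y_2, …, and induction
applies. -/
theorem derivation_eq_zero_of_sum_eq_zero {D : Derivation ℤ k k} (h0 : ∀ x, D^[p] x = 0)
    (h1 : ∀ x, D^[p - 1] (x ^ (p - 1) * D x) = -(D x) ^ p) (m : ℕ) (y : ℕ → k)
    (hy : ∑ i ∈ Finset.range m, y i ^ (p ^ i - 1) * D (y i) = 0) (i : ℕ) (hi : i < m) :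
    D (y i) = 0 := by
  have hp := (Fact.out : p.Prime)
  induction m generalizing y i with
  | zero => omega
  | succ m ih =>
    rw [Finset.sum_range_succ'] at hy
    have hterm : ∀ i, y (i + 1) ^ (p ^ (i + 1) - 1) * D (y (i + 1)) =
        (y (i + 1) ^ (p ^ i - 1)) ^ p * (y (i + 1) ^ (p - 1) * D (y (i + 1))) := by
      intro i
      rw [← mul_assoc, ← pow_mul, ← pow_add]
      congr 2
      have h2 : 1 ≤ p ^ i := Nat.one_le_pow _ _ hp.pos
      have h3 : p ≤ p ^ i * p := Nat.le_mul_of_pos_left p h2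
      have h4 := hp.one_le
      rw [pow_succ, Nat.sub_mul]
      omega
    have hs : ∀ i, 0 < i → i < m + 1 → D (y i) = 0 := by
      intro i hi hi'
      obtain ⟨i, rfl⟩ : ∃ j, i = j + 1 := ⟨i - 1, by omega⟩
      refine ih (fun i => y (i + 1)) ?_ i (by omega)
      have h5 := congrArg D^[p - 1] hy
      have h6 : D^[p - 1] 0 = 0 := iterate_map_zero D _
      have h7 : D^[p - 1] (D (y 0)) = 0 := by
        rw [← Function.iterate_succ_apply, Nat.succ_eq_add_one, Nat.sub_add_cancel hp.one_le, h0]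
      rw [h6, derivation_iterate_map_add, pow_zero, Nat.sub_self, pow_zero, one_mul, h7, add_zero]
        at h5
      have h8 : D^[p - 1] (∑ i ∈ Finset.range m, y (i + 1) ^ (p ^ (i + 1) - 1) * D (y (i + 1))) =
          ∑ i ∈ Finset.range m, D^[p - 1] (y (i + 1) ^ (p ^ (i + 1) - 1) * D (y (i + 1))) :=
        map_sum (AddMonoidHom.mk' D^[p - 1] fun x y => derivation_iterate_map_add D x y _) _ _
      rw [h8] at h5
      simp only [hterm, derivation_iterate_pow_char_mul, h1, mul_neg, ← mul_pow,
        Finset.sum_neg_distrib, neg_eq_zero] at h5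
      rw [← sum_pow_char] at h5
      exact pow_eq_zero_iff hp.ne_zero |>.1 h5
    obtain _ | i := i
    · rw [Finset.sum_eq_zero] at hy
      · simpa using hy
      · intro i hi
        rw [hs (i + 1) (by omega) (by have := Finset.mem_range.1 hi; omega), mul_zero]
    · exact hs _ (by omega) hi

variable (p) in
/-- If `∑ y_i ^ (p ^ i - 1) d y_i = 0` in the differentials of a field of characteristic `p`, then
the `y_i` are `p`-th powers. -/
theorem exists_pow_eq_of_forall_derivation_sum_eq_zero (m : ℕ) (y : ℕ → k)
    (h : ∀ D : Derivation ℤ k k, ∑ i ∈ Finset.range m, y i ^ (p ^ i - 1) * D (y i) = 0)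
    (i : ℕ) (hi : i < m) : ∃ w, w ^ p = y i := by
  by_contra! hu
  obtain ⟨D, hD1, hD0, hD⟩ := exists_derivation_eq_one p hu
  rw [derivation_eq_zero_of_sum_eq_zero hD0 hD m y (h D) i hi] at hD1
  exact zero_ne_one hD1

end FieldDerivations

/-! ### Formal smoothness of extensions of perfect fields -/

section FormallySmooth

variable (F : Type*) [Field F]

/-- The polynomial ring over `F` in variables indexed by `E`, with its tautological map to `E`. -/
@[reducible] def mvPolynomialSelfAlgebra (E : Type*) [CommRing E] [Algebra F E] :
    Algebra (MvPolynomial E F) E :=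
  (MvPolynomial.aeval (R := F) (id : E → E)).toRingHom.toAlgebra

attribute [local instance] mvPolynomialSelfAlgebra

theorem mvPolynomialSelf_algebraMap {E : Type*} [CommRing E] [Algebra F E] (x : MvPolynomial E F) :
    algebraMap (MvPolynomial E F) E x = MvPolynomial.aeval id x := rfl

theorem mvPolynomialSelf_isScalarTower (E : Type*) [CommRing E] [Algebra F E] :
    IsScalarTower F (MvPolynomial E F) E :=
  IsScalarTower.of_algebraMap_eq fun x => by
    rw [mvPolynomialSelf_algebraMap, MvPolynomial.algebraMap_eq, MvPolynomial.aeval_C]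

theorem one_tmul_D_eq_zero_iff {E : Type*} [CommRing E] [Algebra F E] (x : MvPolynomial E F) :
    (1 : E) ⊗ₜ[MvPolynomial E F] (KaehlerDifferential.D F (MvPolynomial E F) x) = 0 ↔
      ∀ i, MvPolynomial.aeval (id : E → E) (MvPolynomial.pderiv i x) = 0 := by
  have := mvPolynomialSelf_isScalarTower F E
  constructor
  · intro h i
    let D : Derivation F (MvPolynomial E F) E :=
      (Algebra.linearMap (MvPolynomial E F) E).compDer (MvPolynomial.pderiv i)
    have h1 := congrArg (LinearMap.liftBaseChange E D.liftKaehlerDifferential) h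
    rw [LinearMap.liftBaseChange_tmul, one_smul, Derivation.liftKaehlerDifferential_comp_D,
      map_zero] at h1
    exact h1
  · intro h
    have hrepr : ∀ i, (KaehlerDifferential.mvPolynomialBasis F E).repr
        (KaehlerDifferential.D F (MvPolynomial E F) x) i = MvPolynomial.pderiv i x := by
      intro i
      rw [KaehlerDifferential.mvPolynomialBasis_repr_D]
      have : (Finsupp.lapply i : (E →₀ MvPolynomial E F) →ₗ[MvPolynomial E F] _).compDer
          (MvPolynomial.mkDerivation F fun x => Finsupp.single x 1) = MvPolynomial.pderiv i := by
        refine MvPolynomial.derivation_ext fun j => ?_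
        classical
        simp [MvPolynomial.pderiv_X, Finsupp.single_apply, Pi.single_apply, eq_comm]
      exact DFunLike.congr_fun this x
    rw [← (KaehlerDifferential.mvPolynomialBasis F E).linearCombination_repr
      (KaehlerDifferential.D F (MvPolynomial E F) x), Finsupp.linearCombination_apply,
      Finsupp.sum, TensorProduct.tmul_sum]
    refine Finset.sum_eq_zero fun i _ => ?_
    rw [hrepr, ← TensorProduct.smul_tmul, Algebra.smul_def, mvPolynomialSelf_algebraMap, h,
      zero_mul, TensorProduct.zero_tmul]

/-- The differentials of the polynomial ring are free on the dX_i with partial derivatives as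
coordinates. The resulting Jacobian condition involves one polynomial at a time, hence finitely many
variables. -/
theorem kerCotangentToTensor_mvPolynomialSelf_injective_iff (E : Type*) [CommRing E] [Algebra F E] :
    Function.Injective (KaehlerDifferential.kerCotangentToTensor F (MvPolynomial E F) E) ↔
      ∀ x : MvPolynomial E F, MvPolynomial.aeval (id : E → E) x = 0 →
        (∀ i, MvPolynomial.aeval (id : E → E) (MvPolynomial.pderiv i x) = 0) →
          x ∈ RingHom.ker (algebraMap (MvPolynomial E F) E) ^ 2 := by
  rw [injective_iff_map_eq_zero]
  constructor
  · intro h x hx hx'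
    have h1 := h (Ideal.toCotangent _ ⟨x, hx⟩) (by
      rw [KaehlerDifferential.kerCotangentToTensor_toCotangent, one_tmul_D_eq_zero_iff]
      exact hx')
    exact (Ideal.toCotangent_eq_zero _ _).1 h1
  · intro h a ha
    obtain ⟨⟨x, hx⟩, rfl⟩ := Ideal.toCotangent_surjective _ a
    rw [KaehlerDifferential.kerCotangentToTensor_toCotangent, one_tmul_D_eq_zero_iff] at ha
    exact (Ideal.toCotangent_eq_zero _ _).2 (h x hx ha)

/-- Every extension of a perfect field is formally smooth. -/
theorem formallySmooth_of_perfectField [PerfectField F] (E : Type*) [Field E] [Algebra F E] :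
    Algebra.FormallySmooth F E := by
  have hsurj : ∀ (E' : Type _) [CommRing E'] [Algebra F E'],
      Function.Surjective (algebraMap (MvPolynomial E' F) E') :=
    fun E' _ _ x => ⟨MvPolynomial.X x, by rw [mvPolynomialSelf_algebraMap, MvPolynomial.aeval_X]; rfl⟩
  rw [Algebra.formallySmooth_iff]
  refine ⟨inferInstance, ?_⟩
  have := mvPolynomialSelf_isScalarTower F E
  rw [← Algebra.FormallySmooth.kerCotangentToTensor_injective_iff (P := MvPolynomial E F) (hsurj E),
    kerCotangentToTensor_mvPolynomialSelf_injective_iff]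
  intro x hx hx'
  -- Only the finitely many elements of E indexing variables of x matter, so the condition is
  -- inherited from the finitely generated field they generate.
  let E' : IntermediateField F E := IntermediateField.adjoin F (x.vars : Set E)
  have hfg : Algebra.EssFiniteType F E' :=
    IntermediateField.essFiniteType_iff.2 (IntermediateField.fg_adjoin_finset x.vars)
  have := mvPolynomialSelf_isScalarTower F E'
  have hsm : Algebra.FormallySmooth F E' := Algebra.FormallySmooth.of_perfectField
  rw [Algebra.formallySmooth_iff] at hsm
  have hinj := (kerCotangentToTensor_mvPolynomialSelf_injective_iff F E').1
    ((Algebra.FormallySmooth.kerCotangentToTensor_injective_iff (hsurj E')).2 hsm.2)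
  obtain ⟨y, hy⟩ := MvPolynomial.exists_rename_eq_of_vars_subset_range x
    (Subtype.val : E' → E) Subtype.val_injective (by
      intro z hz
      exact ⟨⟨z, IntermediateField.subset_adjoin F _ hz⟩, rfl⟩)
  have haeval : ∀ z : MvPolynomial E' F, MvPolynomial.aeval (id : E → E)
      (MvPolynomial.rename (Subtype.val : E' → E) z) =
      (MvPolynomial.aeval (id : E' → E') z : E') := by
    intro z
    rw [MvPolynomial.aeval_rename]
    exact (MvPolynomial.map_aeval (id : E' → E') (algebraMap E' E) z).symm ▸ rfl
  have h1 := hinj y ?_ ?_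
  · have h2 : RingHom.ker (algebraMap (MvPolynomial E' F) E') ≤
        (RingHom.ker (algebraMap (MvPolynomial E F) E)).comap
          (MvPolynomial.rename (Subtype.val : E' → E)) := by
      intro z hz
      rw [Ideal.mem_comap, RingHom.mem_ker, mvPolynomialSelf_algebraMap, haeval,
        ← mvPolynomialSelf_algebraMap, (RingHom.mem_ker).1 hz]
      rfl
    have h3 := (Ideal.pow_right_mono h2 2).trans (Ideal.le_comap_pow _ 2) h1
    rwa [Ideal.mem_comap, hy] at h3
  · apply Subtype.val_injective
    rw [← haeval, hy, hx]
    rfl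
  · intro i
    apply Subtype.val_injective
    rw [← haeval, ← MvPolynomial.pderiv_rename Subtype.val_injective, hy, hx']
    rfl

end FormallySmooth

/-! ### Complete discrete valuation rings of equal characteristic -/

section CoefficientField

variable {B : Type*} [CommRing B] [IsLocalRing B] [IsAdicComplete (maximalIdeal B) B]

variable (p : ℕ) [Fact p.Prime]

variable (B) in
-- The residue field is formally smooth over the perfect field 𝔽_p, so its identity map lifts
-- successively through the powers of the maximal ideal.
theorem exists_coefficientField [CharP B p] :
    ∃ σ : ResidueField B →+* B, ∀ a, residue B (σ a) = a := by
  let : Algebra (ZMod p) B := ZMod.algebra B p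
  let : Field (B ⧸ maximalIdeal B) := inferInstanceAs (Field (ResidueField B))
  have := formallySmooth_of_perfectField (ZMod p) (B ⧸ maximalIdeal B)
  obtain ⟨g, hg⟩ := Algebra.FormallySmooth.exists_mkₐ_comp_eq_of_isAdicComplete
    (AlgHom.id (ZMod p) (B ⧸ maximalIdeal B))
  exact ⟨g.toRingHom, fun a => DFunLike.congr_fun hg a⟩

variable {p} {R : Type*} [CommRing R]

theorem eval₂_mem_pow_of_coeff_eq_zero {I : Ideal B} (σ : R →+* B) {b : B} (hb : b ∈ I) {n : ℕ}
    {q : Polynomial R} (hq : ∀ d < n, q.coeff d = 0) : q.eval₂ σ b ∈ I ^ n := by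
  obtain ⟨r, rfl⟩ := Polynomial.X_pow_dvd_iff.2 hq
  rw [Polynomial.eval₂_mul, Polynomial.eval₂_pow, Polynomial.eval₂_X]
  exact Ideal.mul_mem_right _ _ (Ideal.pow_mem_pow hb n)

/-- Evaluation modulo `I ^ n` of a power series at an element of `I`. -/
def powerSeriesEvalMod {I : Ideal B} (σ : R →+* B) {b : B} (hb : b ∈ I) (n : ℕ) :
    PowerSeries R →+* B ⧸ I ^ n where
  toFun f := Ideal.Quotient.mk _ ((PowerSeries.trunc n f).eval₂ σ b)
  map_zero' := by simp
  map_add' f g := by simp [Polynomial.eval₂_add]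
  map_one' := by
    rw [← map_one (Ideal.Quotient.mk (I ^ n)), Ideal.Quotient.eq,
      ← Polynomial.eval₂_one σ b, ← Polynomial.eval₂_sub]
    refine eval₂_mem_pow_of_coeff_eq_zero σ hb fun d hd => ?_
    simp [PowerSeries.coeff_trunc, hd, PowerSeries.coeff_one, Polynomial.coeff_one]
  map_mul' f g := by
    rw [← map_mul, Ideal.Quotient.eq, ← Polynomial.eval₂_mul, ← Polynomial.eval₂_sub]
    refine eval₂_mem_pow_of_coeff_eq_zero σ hb fun d hd => ?_
    rw [Polynomial.coeff_sub, PowerSeries.coeff_trunc, if_pos hd,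
      PowerSeries.coeff_mul_eq_coeff_trunc_mul_trunc f g hd, ← Polynomial.coe_mul,
      Polynomial.coeff_coe, sub_self]

theorem powerSeriesEvalMod_coe {I : Ideal B} (σ : R →+* B) {b : B} (hb : b ∈ I) (n : ℕ)
    (q : Polynomial R) :
    powerSeriesEvalMod σ hb n q = Ideal.Quotient.mk _ (q.eval₂ σ b) := by
  refine Ideal.Quotient.eq.2 ?_
  rw [← Polynomial.eval₂_sub]
  refine eval₂_mem_pow_of_coeff_eq_zero σ hb fun d hd => ?_
  rw [Polynomial.coeff_sub, PowerSeries.coeff_trunc, if_pos hd, Polynomial.coeff_coe, sub_self]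

theorem factorPow_powerSeriesEvalMod {I : Ideal B} (σ : R →+* B) {b : B} (hb : b ∈ I) {m n : ℕ}
    (h : m ≤ n) : (Ideal.Quotient.factorPow I h).comp (powerSeriesEvalMod σ hb n) =
      powerSeriesEvalMod σ hb m := by
  ext f
  refine Ideal.Quotient.eq.2 ?_
  rw [← Polynomial.eval₂_sub]
  refine eval₂_mem_pow_of_coeff_eq_zero σ hb fun d hd => ?_
  rw [Polynomial.coeff_sub, PowerSeries.coeff_trunc, PowerSeries.coeff_trunc, if_pos hd,
    if_pos (hd.trans_le h), sub_self]

/-- Evaluation of a power series at an element of the maximal ideal of a complete local ring. -/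
def powerSeriesEval (σ : R →+* B) {b : B} (hb : b ∈ maximalIdeal B) : PowerSeries R →+* B :=
  IsAdicComplete.liftRingHom (maximalIdeal B) (powerSeriesEvalMod σ hb)
    (fun h => factorPow_powerSeriesEvalMod σ hb h)

theorem powerSeriesEval_coe (σ : R →+* B) {b : B} (hb : b ∈ maximalIdeal B) (q : Polynomial R) :
    powerSeriesEval σ hb q = q.eval₂ σ b := by
  refine (IsHausdorff.eq_iff_smodEq (I := maximalIdeal B)).2 fun n => ?_
  rw [SModEq.sub_mem, smul_eq_mul, Ideal.mul_top, ← Ideal.Quotient.eq, powerSeriesEval,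
    IsAdicComplete.mk_liftRingHom, powerSeriesEvalMod_coe]
  exact fun h => factorPow_powerSeriesEvalMod σ hb h

variable (p)

/-- A complete discrete valuation ring of characteristic `p` is a power series ring over its residue
field, with a prescribed uniformizer as the variable. -/
theorem exists_powerSeries_equiv {B : Type*} [CommRing B] [IsDomain B] [IsDiscreteValuationRing B]
    [IsAdicComplete (maximalIdeal B) B] [CharP B p] {b : B} (hb : Irreducible b) :
    ∃ e : PowerSeries (ResidueField B) ≃+* B, e PowerSeries.X = b ∧
      ∀ f, residue B (e f) = PowerSeries.constantCoeff f := by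
  obtain ⟨σ, hσ⟩ := exists_coefficientField B p
  have hbm : b ∈ maximalIdeal B := by rw [hb.maximalIdeal_eq]; exact Ideal.mem_span_singleton_self b
  set φ := powerSeriesEval σ hbm with hφ
  have hX : φ PowerSeries.X = b := by
    rw [← Polynomial.coe_X, hφ, powerSeriesEval_coe, Polynomial.eval₂_X]
  have hC : ∀ a, φ (PowerSeries.C a) = σ a := fun a => by
    rw [← Polynomial.coe_C, hφ, powerSeriesEval_coe, Polynomial.eval₂_C]
  have hmap : (Ideal.span {(PowerSeries.X : PowerSeries (ResidueField B))}).map φ =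
      maximalIdeal B := by
    rw [Ideal.map_span, Set.image_singleton, hX, hb.maximalIdeal_eq]
  -- By completeness, surjectivity modulo the maximal ideal is enough, and there the constants
  -- supplied by σ suffice.
  have hsurj : Function.Surjective φ := by
    have : IsHausdorff ((Ideal.span {(PowerSeries.X : PowerSeries (ResidueField B))}).map φ) B := by
      rw [hmap]; infer_instance
    refine surjective_of_mk_map_comp_surjective
      (I := Ideal.span {(PowerSeries.X : PowerSeries (ResidueField B))}) φ fun y => ?_
    obtain ⟨y, rfl⟩ := Ideal.Quotient.mk_surjective y
    refine ⟨PowerSeries.C (residue B y), Ideal.Quotient.eq.2 ?_⟩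
    rw [hmap, hC, ← residue_eq_zero_iff, map_sub, hσ, sub_self]
  have hinj : Function.Injective φ := by
    rw [injective_iff_map_eq_zero]
    intro f hf
    by_contra hf0
    obtain ⟨n, u, rfl⟩ := IsDiscreteValuationRing.eq_unit_mul_pow_irreducible hf0
      (PowerSeries.X_irreducible (R := ResidueField B))
    rw [map_mul, map_pow, hX] at hf
    exact mul_ne_zero (u.isUnit.map φ).ne_zero (pow_ne_zero n hb.ne_zero) hf
  refine ⟨RingEquiv.ofBijective φ ⟨hinj, hsurj⟩, hX, fun f => ?_⟩
  have h := PowerSeries.eq_X_mul_shift_add_const f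
  conv_lhs => rw [h]
  change residue B (φ _) = _
  rw [map_add, map_mul, hX, hC, map_add, map_mul, (residue_eq_zero_iff b).2 hbm, zero_mul, zero_add,
    hσ]

end CoefficientField

/-! ### Derivations of power series rings: coefficientwise ones and the Euler operator -/

section PowerSeriesDerivations

variable {k : Type*} [CommRing k]

/-- A derivation transported along a ring isomorphism. -/
def Derivation.ofRingEquiv {R S : Type*} [CommRing R] [CommRing S] (e : R ≃+* S) (D : R →+ R)
    (hD : ∀ f g, D (f * g) = f * D g + g * D f) : Derivation ℤ S S :=
  Derivation.mk' ((e : R ≃+ S).toAddMonoidHom.comp (D.comp (e : R ≃+ S).symm)).toIntLinearMap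
    fun s t => by
      change e (D (e.symm (s * t))) = s * e (D (e.symm t)) + t * e (D (e.symm s))
      simp [hD]

theorem Derivation.ofRingEquiv_apply {R S : Type*} [CommRing R] [CommRing S] (e : R ≃+* S)
    (D : R →+ R) (hD : ∀ f g, D (f * g) = f * D g + g * D f) (r : R) :
    Derivation.ofRingEquiv e D hD (e r) = e (D r) := by
  change e (D (e.symm (e r))) = _
  rw [e.symm_apply_apply]

/-- The coefficientwise action of an additive map on the power series over `k`. -/
def powerSeriesCoeffDer (D : k →+ k) : PowerSeries k →+ PowerSeries k :=
  AddMonoidHom.mk' (fun f => PowerSeries.mk fun n => D (PowerSeries.coeff n f))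
    fun f g => by ext n; simp

theorem coeff_powerSeriesCoeffDer (D : k →+ k) (f : PowerSeries k) (n : ℕ) :
    PowerSeries.coeff n (powerSeriesCoeffDer D f) = D (PowerSeries.coeff n f) := by
  rw [powerSeriesCoeffDer, AddMonoidHom.mk'_apply, PowerSeries.coeff_mk]

theorem powerSeriesCoeffDer_mul {D : k →+ k}
    (hD : ∀ x y, D (x * y) = x * D y + y * D x) (f g : PowerSeries k) :
    powerSeriesCoeffDer D (f * g) = f * powerSeriesCoeffDer D g + g * powerSeriesCoeffDer D f := by
  ext n
  rw [mul_comm g]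
  simp only [coeff_powerSeriesCoeffDer, PowerSeries.coeff_mul, map_sum, map_add, hD,
    Finset.sum_add_distrib]
  congr 1
  exact Finset.sum_congr rfl fun _ _ => mul_comm _ _

theorem powerSeriesCoeffDer_X {D : k →+ k} (hD : D 1 = 0) :
    powerSeriesCoeffDer D PowerSeries.X = 0 := by
  ext n
  rw [coeff_powerSeriesCoeffDer, PowerSeries.coeff_X]
  split_ifs <;> simp [hD]

variable (k) in
/-- The Euler operator `X d/dX` on power series. -/
def powerSeriesEuler : PowerSeries k →+ PowerSeries k :=
  (AddMonoidHom.mulLeft PowerSeries.X).comp (PowerSeries.derivative k).toLinearMap.toAddMonoidHom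

theorem powerSeriesEuler_apply (f : PowerSeries k) :
    powerSeriesEuler k f = PowerSeries.X * PowerSeries.derivative k f := rfl

theorem powerSeriesEuler_mul (f g : PowerSeries k) :
    powerSeriesEuler k (f * g) = f * powerSeriesEuler k g + g * powerSeriesEuler k f := by
  simp only [powerSeriesEuler_apply, Derivation.leibniz, smul_eq_mul]
  ring

theorem coeff_powerSeriesEuler (f : PowerSeries k) (n : ℕ) :
    PowerSeries.coeff n (powerSeriesEuler k f) = n * PowerSeries.coeff n f := by
  rw [powerSeriesEuler_apply]
  obtain _ | n := n
  · simp
  · rw [PowerSeries.coeff_succ_X_mul, PowerSeries.coeff_derivative, mul_comm]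
    push_cast
    rfl

theorem coeff_powerSeries_pow_char (p : ℕ) [Fact p.Prime] [CharP k p] (f : PowerSeries k) (n : ℕ) :
    PowerSeries.coeff n (f ^ p) = if p ∣ n then PowerSeries.coeff (n / p) f ^ p else 0 := by
  have hp := (Fact.out : p.Prime).ne_zero
  have : ExpChar k p := ExpChar.prime Fact.out
  have h : f ^ p = PowerSeries.map (frobenius k p) (PowerSeries.expand p hp f) :=
    (MvPowerSeries.map_frobenius_expand p hp).symm
  rw [h, PowerSeries.coeff_map, PowerSeries.coeff_expand]
  split_ifs
  · rfl
  · rw [map_zero]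

end PowerSeriesDerivations

/-! ### Logarithmic derivations of a complete discretely valued field -/

section LogDerivations

variable {B L : Type*} [CommRing B] [IsDomain B] [IsDiscreteValuationRing B]
  [Field L] [Algebra B L] [IsFractionRing B L]

/-- Localization is formally étale, so differentials commute with it. -/
theorem Derivation.exists_extend_fractionRing (D : Derivation ℤ B B) :
    ∃ D' : Derivation ℤ L L, ∀ b, D' (algebraMap B L b) = algebraMap B L (D b) := by
  have : Algebra.FormallyEtale B L :=
    Algebra.FormallyEtale.of_isLocalization (nonZeroDivisors B)
  let D₁ : Derivation ℤ B L := (Algebra.linearMap B L).compDer D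
  let f : Ω[L⁄ℤ] →ₗ[L] L := (LinearMap.liftBaseChange L D₁.liftKaehlerDifferential).comp
    (KaehlerDifferential.tensorKaehlerEquivOfFormallyEtale ℤ B L).symm.toLinearMap
  refine ⟨f.compDer (KaehlerDifferential.D ℤ L), fun b => ?_⟩
  change LinearMap.liftBaseChange L D₁.liftKaehlerDifferential
    ((KaehlerDifferential.tensorKaehlerEquivOfFormallyEtale ℤ B L).symm
      (KaehlerDifferential.D ℤ L (algebraMap B L b))) = _
  rw [KaehlerDifferential.tensorKaehlerEquivOfFormallyEtale_symm_D_algebraMap,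
    LinearMap.liftBaseChange_tmul, one_smul, Derivation.liftKaehlerDifferential_comp_D]
  rfl

theorem dvrVal_irreducible {b : B} (hb : Irreducible b) :
    dvrVal B L (algebraMap B L b) = WithZero.exp (-1 : ℤ) := by
  have h := IsDedekindDomain.HeightOneSpectrum.intValuation_singleton
    (IsDiscreteValuationRing.maximalIdeal B) hb.ne_zero hb.maximalIdeal_eq
  rw [dvrVal, IsDedekindDomain.HeightOneSpectrum.valuation_of_algebraMap, h]

theorem dvrVal_unit (u : Bˣ) : dvrVal B L (algebraMap B L u) = 1 := by
  refine le_antisymm (dvrVal_le_one _) (not_lt.1 fun h => ?_)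
  rw [dvrVal_lt_one_iff] at h
  exact h u.isUnit

/-- Since c divides Dc for a uniformizer c, the Leibniz rule makes D(uc^n) divisible by c^n;
quotients follow from Leibniz applied to x·s = a. -/
theorem isLogDer_of_map_mem {D : Derivation ℤ B B} {D' : Derivation ℤ L L}
    (h : ∀ b, D' (algebraMap B L b) = algebraMap B L (D b))
    (hD : ∀ b ∈ maximalIdeal B, D b ∈ maximalIdeal B) : IsLogDer B D' := by
  obtain ⟨c, hc⟩ := IsDiscreteValuationRing.exists_irreducible B
  have hcm : c ∈ maximalIdeal B := by rw [hc.maximalIdeal_eq]; exact Ideal.mem_span_singleton_self c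
  have h1 : ∀ b : B, dvrVal B L (algebraMap B L (D b)) ≤ dvrVal B L (algebraMap B L b) := by
    intro b
    obtain rfl | hb := eq_or_ne b 0
    · simp
    obtain ⟨n, u, rfl⟩ := IsDiscreteValuationRing.eq_unit_mul_pow_irreducible hb hc
    have hDc : c ∣ D c := by
      rw [← Ideal.mem_span_singleton, ← hc.maximalIdeal_eq]; exact hD c hcm
    have hdvd : (u : B) * c ^ n ∣ D (u * c ^ n) := by
      have hdvd : c ^ n ∣ D (u * c ^ n) := by
        rw [D.leibniz, D.leibniz_pow]
        refine dvd_add ?_ ?_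
        · obtain _ | n := n
          · simp
          · obtain ⟨d, hd⟩ := hDc
            rw [hd, Nat.add_sub_cancel]
            exact ⟨u * ((n + 1 : ℕ) * d), by simp only [smul_eq_mul, nsmul_eq_mul]; ring⟩
        · exact ⟨D u, rfl⟩
      obtain ⟨d, hd⟩ := hdvd
      exact ⟨u⁻¹ * d, by rw [hd]; linear_combination (-(c ^ n * d)) * u.mul_inv⟩
    obtain ⟨d, hd⟩ := hdvd
    rw [hd, map_mul, map_mul]
    exact mul_le_of_le_one_right' (dvrVal_le_one d)
  intro x
  obtain ⟨a, s, hs, rfl⟩ := IsFractionRing.div_surjective (A := B) x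
  have hs0 : algebraMap B L s ≠ 0 := by
    rw [Ne, IsFractionRing.to_map_eq_zero_iff]; exact nonZeroDivisors.ne_zero hs
  have hvs : 0 < dvrVal B L (algebraMap B L s) := by
    rw [zero_lt_iff, Ne, map_eq_zero]; exact hs0
  set x := algebraMap B L a / algebraMap B L s with hx
  have hxs : x * algebraMap B L s = algebraMap B L a := div_mul_cancel₀ _ hs0
  have h2 := congrArg D' hxs
  rw [D'.leibniz, h, h, smul_eq_mul, smul_eq_mul] at h2
  have h3 : dvrVal B L (algebraMap B L s * D' x) ≤ dvrVal B L (algebraMap B L a) := by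
    rw [← sub_eq_iff_eq_add'.2 h2.symm]
    refine (Valuation.map_sub _ _ _).trans (max_le (h1 a) ?_)
    rw [← hxs, map_mul, map_mul]
    exact mul_le_mul_right (h1 s) _
  rw [← hxs, map_mul, map_mul, mul_comm] at h3
  exact (mul_le_mul_iff_left₀ hvs).1 h3

variable [IsAdicComplete (maximalIdeal B) B] (p : ℕ) [Fact p.Prime] [CharP B p]

variable (B) in
theorem charP_residueField : CharP (ResidueField B) p :=
  ringChar.of_eq ((CharP.ringChar_of_prime_eq_zero (Fact.out : p.Prime) (by
    rw [← map_natCast (residue B), CharP.cast_eq_zero, map_zero])))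

/-- A derivation of the residue field lifts to a logarithmic derivation killing a uniformizer. -/
theorem exists_isLogDer_lift (p : ℕ) [Fact p.Prime] [CharP B p] {b : B} (hb : Irreducible b)
    (D : ResidueField B →+ ResidueField B) (hD : ∀ x y, D (x * y) = x * D y + y * D x) :
    ∃ D' : Derivation ℤ L L, IsLogDer B D' ∧ D' (algebraMap B L b) = 0 ∧
      ∀ x : B, ∃ y : B, D' (algebraMap B L x) = algebraMap B L y ∧
        residue B y = D (residue B x) := by
  obtain ⟨e, heX, he⟩ := exists_powerSeries_equiv p hb
  let D₀ := Derivation.ofRingEquiv e (powerSeriesCoeffDer D) (powerSeriesCoeffDer_mul hD)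
  have h1 : D 1 = 0 := by simpa using hD 1 1
  have hD₀ : ∀ x, residue B (D₀ x) = D (residue B x) := by
    intro x
    obtain ⟨f, rfl⟩ := e.surjective x
    rw [Derivation.ofRingEquiv_apply, he, he, ← PowerSeries.coeff_zero_eq_constantCoeff_apply,
      coeff_powerSeriesCoeffDer, PowerSeries.coeff_zero_eq_constantCoeff_apply]
  obtain ⟨D', hD'⟩ := D₀.exists_extend_fractionRing (L := L)
  refine ⟨D', isLogDer_of_map_mem hD' fun x hx => ?_, ?_, fun x => ⟨D₀ x, hD' x, hD₀ x⟩⟩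
  · rw [← residue_eq_zero_iff] at hx ⊢
    rw [hD₀, hx, map_zero]
  · rw [hD', ← heX, Derivation.ofRingEquiv_apply, powerSeriesCoeffDer_X h1, map_zero, map_zero]

/-- The derivation `π d/dπ`. -/
theorem exists_isLogDer_euler (p : ℕ) [Fact p.Prime] [CharP B p] {b : B} (hb : Irreducible b) :
    ∃ D' : Derivation ℤ L L, IsLogDer B D' ∧ D' (algebraMap B L b) = algebraMap B L b ∧
      ∀ x : B, dvrVal B L (D' (algebraMap B L x)) < 1 := by
  obtain ⟨e, heX, he⟩ := exists_powerSeries_equiv p hb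
  let D₀ := Derivation.ofRingEquiv e (powerSeriesEuler _) powerSeriesEuler_mul
  have hD₀ : ∀ x, D₀ x ∈ maximalIdeal B := by
    intro x
    obtain ⟨f, rfl⟩ := e.surjective x
    rw [← residue_eq_zero_iff, Derivation.ofRingEquiv_apply, he, powerSeriesEuler_apply,
      map_mul, PowerSeries.constantCoeff_X, zero_mul]
  obtain ⟨D', hD'⟩ := D₀.exists_extend_fractionRing (L := L)
  refine ⟨D', isLogDer_of_map_mem hD' fun x _ => hD₀ x, ?_, fun x => ?_⟩
  · rw [hD', ← heX, Derivation.ofRingEquiv_apply, powerSeriesEuler_apply,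
      PowerSeries.derivative_X, mul_one]
  · rw [hD', dvrVal_lt_one_iff]
    exact hD₀ x

/-- An element killed by all logarithmic derivations is a `p`-th power. -/
theorem exists_pow_eq_of_forall_isLogDer_eq_zero (x : B)
    (hx : ∀ D : Derivation ℤ L L, IsLogDer B D → D (algebraMap B L x) = 0) : ∃ w : B, w ^ p = x := by
  obtain ⟨b, hb⟩ := IsDiscreteValuationRing.exists_irreducible B
  obtain ⟨e, heX, he⟩ := exists_powerSeries_equiv p hb
  have hinj : Function.Injective (algebraMap B L) := IsFractionRing.injective B L
  have hbm : b ∈ maximalIdeal B := by rw [hb.maximalIdeal_eq]; exact Ideal.mem_span_singleton_self b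
  obtain ⟨f, rfl⟩ := e.surjective x
  have key : ∀ (D₀ : PowerSeries (ResidueField B) →+ PowerSeries (ResidueField B)),
      (∀ f g, D₀ (f * g) = f * D₀ g + g * D₀ f) →
      (∃ g, D₀ PowerSeries.X = PowerSeries.X * g) → D₀ f = 0 := by
    rintro D₀ hD₀ ⟨g, hg⟩
    obtain ⟨D', hD'⟩ := (Derivation.ofRingEquiv e D₀ hD₀).exists_extend_fractionRing (L := L)
    have h1 := hx D' (isLogDer_of_map_mem hD' fun y hy => by
      rw [hb.maximalIdeal_eq, Ideal.mem_span_singleton] at hy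
      obtain ⟨z, rfl⟩ := hy
      rw [Derivation.leibniz]
      refine Ideal.add_mem _ (Ideal.mul_mem_right _ _ hbm) (Ideal.mul_mem_left _ _ ?_)
      rw [← heX, Derivation.ofRingEquiv_apply, hg, map_mul, heX]
      exact Ideal.mul_mem_right _ _ hbm)
    rw [hD', Derivation.ofRingEquiv_apply] at h1
    exact e.injective ((hinj (h1.trans (map_zero _).symm)).trans (map_zero e).symm)
  have hchar := charP_residueField B p
  have hcoef : ∀ n, ∃ w : ResidueField B, w ^ p = PowerSeries.coeff n f := by
    intro n
    refine exists_pow_eq_of_forall_derivation_sum_eq_zero p 1 (fun _ => PowerSeries.coeff n f)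
      (fun D => ?_) 0 one_pos
    have h1 := congrArg (PowerSeries.coeff n) (key (powerSeriesCoeffDer (D : _ →+ _))
      (powerSeriesCoeffDer_mul D.leibniz)
      ⟨0, by rw [powerSeriesCoeffDer_X D.map_one_eq_zero, mul_zero]⟩)
    rw [coeff_powerSeriesCoeffDer, map_zero] at h1
    replace h1 : D (PowerSeries.coeff n f) = 0 := h1
    simpa using h1
  -- The Euler operator multiplies the n-th coefficient by n. Together with the p-th power
  -- coefficients found by coefficientwise derivations, this leaves only p-th powers of series.
  have hcoef' : ∀ n, ¬ p ∣ n → PowerSeries.coeff n f = 0 := by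
    intro n hn
    have h1 := congrArg (PowerSeries.coeff n) (key (powerSeriesEuler _) powerSeriesEuler_mul
      ⟨1, by rw [powerSeriesEuler_apply, PowerSeries.derivative_X]⟩)
    rw [coeff_powerSeriesEuler, map_zero] at h1
    refine (mul_eq_zero.1 h1).resolve_left ?_
    rwa [CharP.cast_eq_zero_iff (ResidueField B) p]
  choose w hw using hcoef
  refine ⟨e (PowerSeries.mk fun n => w (p * n)), ?_⟩
  rw [← map_pow]
  congr 1
  ext n
  rw [coeff_powerSeries_pow_char]
  split_ifs with h
  · rw [PowerSeries.coeff_mk, Nat.mul_div_cancel' h, hw]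
  · exact (hcoef' n h).symm

variable [PerfectField (ResidueField B)]

/-- If the residue field is perfect, `1, t, …, t ^ (p - 1)` generate `B` over `B ^ p`. -/
theorem exists_eq_sum_pow_mul_pow {b : B} (hb : Irreducible b) (x : B) :
    ∃ c : ℕ → B, x = ∑ i ∈ Finset.range p, b ^ i * c i ^ p := by
  obtain ⟨e, heX, he⟩ := exists_powerSeries_equiv p hb
  have hchar := charP_residueField B p
  have hp := (Fact.out : p.Prime)
  have : ExpChar (ResidueField B) p := ExpChar.prime hp
  have : PerfectRing (ResidueField B) p := PerfectField.toPerfectRing p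
  obtain ⟨f, rfl⟩ := e.surjective x
  have hcoef : ∀ n, ∃ w : ResidueField B, w ^ p = PowerSeries.coeff n f :=
    fun n => surjective_frobenius (ResidueField B) p _
  choose w hw using hcoef
  refine ⟨fun i => e (PowerSeries.mk fun n => w (p * n + i)), ?_⟩
  simp only [← heX, ← map_pow, ← map_mul, ← map_sum]
  congr 1
  ext n
  rw [map_sum, Finset.sum_eq_single (n % p)]
  · rw [PowerSeries.coeff_X_pow_mul', if_pos (Nat.mod_le n p), coeff_powerSeries_pow_char,
      if_pos (Nat.dvd_sub_mod n), PowerSeries.coeff_mk, Nat.mul_div_cancel' (Nat.dvd_sub_mod n),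
      Nat.sub_add_cancel (Nat.mod_le n p), hw]
  · intro i hi hin
    rw [PowerSeries.coeff_X_pow_mul']
    split_ifs with h
    · rw [coeff_powerSeries_pow_char, if_neg]
      intro hd
      refine hin ?_
      rw [← Nat.mod_eq_of_lt (Finset.mem_range.1 hi)]
      exact (Nat.modEq_iff_dvd' h).2 hd
    · rfl
  · intro h
    exact absurd (Finset.mem_range.2 (Nat.mod_lt n hp.pos)) h

theorem exists_eq_sum_pow_mul_pow_fractionRing {b : B} (hb : Irreducible b) (x : L) :
    ∃ c : ℕ → L, x = ∑ i ∈ Finset.range p, algebraMap B L b ^ i * c i ^ p := by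
  obtain ⟨a, s, hs, rfl⟩ := IsFractionRing.div_surjective (A := B) x
  have hs0 : algebraMap B L s ≠ 0 := by
    rw [Ne, IsFractionRing.to_map_eq_zero_iff]; exact nonZeroDivisors.ne_zero hs
  -- Writing a/s = a s^{p-1}/s^p makes the denominator a p-th power, which the c i absorb.
  obtain ⟨c, hc⟩ := exists_eq_sum_pow_mul_pow p hb (a * s ^ (p - 1))
  refine ⟨fun i => algebraMap B L (c i) / algebraMap B L s, ?_⟩
  have h := congrArg (algebraMap B L) hc
  have hp := (Fact.out : p.Prime)
  have h1 : algebraMap B L a / algebraMap B L s =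
      algebraMap B L (a * s ^ (p - 1)) / algebraMap B L s ^ p := by
    rw [div_eq_div_iff hs0 (pow_ne_zero _ hs0), map_mul, map_pow, mul_assoc, ← pow_succ,
      Nat.sub_add_cancel hp.one_le]
  rw [h1, h, map_sum, Finset.sum_div]
  refine Finset.sum_congr rfl fun i _ => ?_
  rw [map_mul, map_pow, map_pow, div_pow, mul_div_assoc]

end LogDerivations

/-! ### The graded pieces of Brylinski's filtration -/

section Graded

variable {B L : Type*} [CommRing B] [IsDomain B] [IsDiscreteValuationRing B]
  [Field L] [Algebra B L] [IsFractionRing B L] [IsAdicComplete (maximalIdeal B) B]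
  (p : ℕ) [Fact p.Prime] [CharP B p]

/-- If every logarithmic derivation is small on the Witt vector `a`, its leading coefficients are
`p`-th powers, and they vanish at the component that is prime to `p`. -/
theorem exists_residue_eq_pow_of_dvrVal_wittDeriv_lt {s n : ℕ} {a : TruncatedWittVector p s L}
    {b : B} (hb : Irreducible b) (Y : Fin s → B)
    (hY : ∀ j, a.coeff j * algebraMap B L b ^ (n / p ^ (j.rev : ℕ)) = algebraMap B L (Y j))
    (ha : a ∈ wittFil B p L s n)
    (hD : ∀ D : Derivation ℤ L L, IsLogDer B D →
      dvrVal B L (wittDeriv D a) < WithZero.exp (n : ℤ)) (j : Fin s) (hj : p ^ (j.rev : ℕ) ∣ n) :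
    (∃ w : B, residue B w ^ p = residue B (Y j)) ∧
      (¬ p ^ (j.rev + 1 : ℕ) ∣ n → residue B (Y j) = 0) := by
  classical
  have hp := (Fact.out : p.Prime)
  have hchar := charP_residueField B p
  set π := algebraMap B L b with hπ
  have hvπ : dvrVal B L π = WithZero.exp (-1 : ℤ) := dvrVal_irreducible hb
  have hvπn : dvrVal B L (π ^ n) = (WithZero.exp (n : ℤ))⁻¹ := by
    rw [map_pow, hvπ, ← WithZero.exp_nsmul, ← WithZero.exp_neg]
    simp
  set S : Finset (Fin s) := Finset.univ.filter fun j => p ^ (j.rev : ℕ) ∣ n with hS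
  -- Components whose index i has p^i ∤ n cannot satisfy p^i v(a_i) = -n, so their terms are
  -- strictly small and can be discarded.
  have hsum : ∀ D : Derivation ℤ L L, IsLogDer B D →
      dvrVal B L (∑ j ∈ S, π ^ n * (a.coeff j ^ (p ^ (j.rev : ℕ) - 1) * D (a.coeff j))) < 1 := by
    intro D hDl
    rw [← Finset.mul_sum, map_mul, hvπn, inv_mul_lt_iff₀ WithZero.exp_pos, mul_one]
    have h1 := hD D hDl
    rw [wittDeriv, ← Finset.sum_filter_add_sum_filter_not Finset.univ
      (fun j : Fin s => p ^ (j.rev : ℕ) ∣ n)] at h1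
    refine lt_of_eq_of_lt (congrArg _ (eq_sub_of_add_eq rfl))
      (lt_of_le_of_lt (Valuation.map_sub _ _ _) (max_lt h1 ?_))
    refine Valuation.map_sum_lt _ WithZero.exp_ne_zero fun j hj => ?_
    rw [smul_eq_mul, map_mul, map_pow]
    refine lt_of_le_of_lt (mul_le_mul_right (hDl _) _) ?_
    rw [← pow_succ, Nat.sub_add_cancel (Nat.one_le_pow _ _ hp.pos)]
    refine lt_of_le_of_ne (ha j) fun h => (Finset.mem_filter.1 hj).2 ?_
    have h0 : dvrVal B L (a.coeff j) ≠ 0 := fun h0 => by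
      rw [h0, zero_pow (pow_ne_zero _ hp.ne_zero)] at h
      exact WithZero.exp_ne_zero h.symm
    rw [← WithZero.exp_log h0, ← WithZero.exp_nsmul, WithZero.exp_inj, nsmul_eq_mul] at h
    exact_mod_cast Dvd.intro _ h
  -- With m = n/p^i and Y = a_i π^m, this is the Leibniz rule: Da_i · π^m = DY - mεY, where ε =
  -- Dπ/π.
  have hterm : ∀ D : Derivation ℤ L L, ∀ j ∈ S, ∀ ε : L, D π = ε * π →
      π ^ n * (a.coeff j ^ (p ^ (j.rev : ℕ) - 1) * D (a.coeff j)) =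
        algebraMap B L (Y j) ^ (p ^ (j.rev : ℕ) - 1) * (D (algebraMap B L (Y j)) -
          (n / p ^ (j.rev : ℕ) : ℕ) * ε * algebraMap B L (Y j)) := by
    intro D j hj ε hε
    obtain ⟨m, hm⟩ := (Finset.mem_filter.1 hj).2
    have hpos := Nat.pow_pos (n := (j.rev : ℕ)) hp.pos
    have hdiv : n / p ^ (j.rev : ℕ) = m := by rw [hm, Nat.mul_div_cancel_left _ hpos]
    have hYj := hY j
    rw [hdiv] at hYj ⊢
    have hD1 : D (algebraMap B L (Y j)) = D (a.coeff j) * π ^ m +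
        m * ε * algebraMap B L (Y j) := by
      rw [← hYj, D.leibniz, D.leibniz_pow, hε]
      simp only [smul_eq_mul, nsmul_eq_mul]
      obtain _ | m := m
      · simp
      · rw [Nat.add_sub_cancel, pow_succ]; ring
    rw [hD1, add_sub_cancel_right, ← hYj]
    nth_rewrite 1 [hm]
    obtain ⟨q, hq⟩ := Nat.exists_eq_add_of_lt hpos
    rw [hq, Nat.zero_add, Nat.add_sub_cancel]
    ring
  have hres : ∀ z : B, dvrVal B L (algebraMap B L z) < 1 → residue B z = 0 := fun z hz => by
    rwa [dvrVal_lt_one_iff, ← residue_eq_zero_iff] at hz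
  let y : ℕ → ResidueField B := fun i =>
    if h : i < s then (if p ^ i ∣ n then residue B (Y (Fin.rev ⟨i, h⟩)) else 0) else 0
  have hy : ∀ j : Fin s, y (j.rev : ℕ) = if p ^ (j.rev : ℕ) ∣ n then residue B (Y j) else 0 := by
    intro j
    have h1 : (⟨(j.rev : ℕ), j.rev.isLt⟩ : Fin s).rev = j := Fin.rev_rev j
    simp only [y, dif_pos j.rev.isLt, h1]
  have hyj := hy j
  rw [if_pos hj] at hyj
  constructor
  -- Derivations of the residue field lift with Dπ = 0, so ε = 0 and the reduction is ∑ y_i^{p^i-1}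
  -- D y_i = 0 for every residual D.
  · obtain ⟨w, hw⟩ := exists_pow_eq_of_forall_derivation_sum_eq_zero p s y (fun D => by
      obtain ⟨D', hD', hD'b, hD'r⟩ := exists_isLogDer_lift (L := L) p hb (D : _ →+ _) D.leibniz
      choose z hz hzr using hD'r
      have h1 := hsum D' hD'
      rw [Finset.sum_congr rfl fun j hj => hterm D' j hj 0 (by rw [hD'b, zero_mul])] at h1
      simp only [hz, mul_zero, zero_mul, sub_zero, ← map_pow, ← map_mul, ← map_sum] at h1
      have h2 := hres _ h1
      simp only [map_sum, map_mul, map_pow, hzr] at h2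
      rw [Finset.sum_range, ← Equiv.sum_comp Fin.revPerm, ← h2, hS, Finset.sum_filter]
      refine Finset.sum_congr rfl fun j _ => ?_
      rw [Fin.revPerm_apply, hy]
      split_ifs with h
      · rfl
      · rw [map_zero, mul_zero]) (j.rev : ℕ) j.rev.isLt
    obtain ⟨w, rfl⟩ := residue_surjective w
    exact ⟨w, hw.trans hyj⟩
  · intro hj'
    -- For π d/dπ one has ε = 1 and DY in the maximal ideal, leaving the terms -(n/p^i)Y^{p^i}. If
    -- p^{i+1} ∤ n, the other indices surviving in the sum are smaller and their factor n/p^{i'} is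
    -- divisible by p, so the term at i must vanish by itself.
    obtain ⟨D', hD', hD'b, hD'r⟩ := exists_isLogDer_euler (L := L) p hb
    have h1 := hsum D' hD'
    have hlt : ∀ j : Fin s, dvrVal B L (algebraMap B L (Y j) ^ (p ^ (j.rev : ℕ) - 1) *
        D' (algebraMap B L (Y j))) < 1 := by
      intro j
      rw [map_mul, ← map_pow]
      exact lt_of_le_of_lt (mul_le_of_le_one_left' (dvrVal_le_one _)) (hD'r _)
    rw [Finset.sum_congr rfl fun j hj => hterm D' j hj 1 (by rw [hD'b, one_mul]),
      ← Finset.add_sum_erase S _ (Finset.mem_filter.2 ⟨Finset.mem_univ j, hj⟩)] at h1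
    have h2 := lt_of_le_of_lt (Valuation.map_sub _ _ _) (max_lt h1
      (Valuation.map_sum_lt (dvrVal B L) one_ne_zero (s := S.erase j)
        (f := fun j => algebraMap B L (Y j) ^ (p ^ (j.rev : ℕ) - 1) * (D' (algebraMap B L (Y j)) -
          (n / p ^ (j.rev : ℕ) : ℕ) * 1 * algebraMap B L (Y j))) fun i hi => ?_))
    · rw [add_sub_cancel_right, mul_sub] at h2
      have h3 := lt_of_le_of_lt (Valuation.map_sub _ _ _) (max_lt (hlt j) h2)
      rw [sub_sub_cancel, mul_one, ← map_natCast (algebraMap B L), ← map_pow, ← map_mul,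
        ← map_mul] at h3
      have h4 := hres _ h3
      rw [map_mul, map_mul, map_pow, map_natCast, mul_left_comm, ← pow_succ,
        Nat.sub_add_cancel (Nat.one_le_pow _ _ hp.pos), mul_eq_zero,
        CharP.cast_eq_zero_iff (ResidueField B) p] at h4
      refine pow_eq_zero_iff (pow_ne_zero _ hp.ne_zero) |>.1 (h4.resolve_left fun h => hj' ?_)
      rw [pow_succ]
      exact Nat.mul_dvd_of_dvd_div hj h
    · obtain ⟨hij, hiS⟩ := Finset.mem_erase.1 hi
      have hin := (Finset.mem_filter.1 hiS).2
      have hlt' : (i.rev : ℕ) < j.rev := by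
        refine lt_of_le_of_ne (not_lt.1 fun h => hj' ((pow_dvd_pow p h).trans hin)) fun h => hij ?_
        exact Fin.rev_injective (Fin.ext h)
      have hdvd : p ∣ n / p ^ (i.rev : ℕ) :=
        (Nat.dvd_div_iff_mul_dvd hin).2 ((pow_dvd_pow p hlt').trans hj)
      have h0 : ((n / p ^ (i.rev : ℕ) : ℕ) : L) = 0 := by
        rw [← map_natCast (algebraMap B L), (CharP.cast_eq_zero_iff B p _).2 hdvd, map_zero]
      rw [h0, zero_mul, zero_mul, sub_zero]
      exact hlt i

/-- A Witt vector of `F_n W_s(L)` on which all logarithmic derivations are small lies in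
`F_{n-1} W_s(L)` up to an element in the image of `F - 1`. -/
theorem exists_sub_frob_sub_mem_wittFil_pred [CharP L p] {s n : ℕ} (hn : n ≠ 0)
    {a : TruncatedWittVector p s L} (ha : a ∈ wittFil B p L s n)
    (hD : ∀ D : Derivation ℤ L L, IsLogDer B D →
      dvrVal B L (wittDeriv D a) < WithZero.exp (n : ℤ)) :
    ∃ b ∈ wittFil B p L s (n / p), a - (wittFrob s L b - b) ∈ wittFil B p L s (n - 1) := by
  have hp := (Fact.out : p.Prime)
  obtain ⟨b, hb⟩ := IsDiscreteValuationRing.exists_irreducible B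
  set π := algebraMap B L b with hπ
  have hvπ : dvrVal B L π = WithZero.exp (-1 : ℤ) := dvrVal_irreducible hb
  have hπ0 : π ≠ 0 := by
    rintro h
    rw [h, map_zero] at hvπ
    exact WithZero.exp_ne_zero hvπ.symm
  have hvπm : ∀ m : ℕ, dvrVal B L (π ^ m) = (WithZero.exp (m : ℤ))⁻¹ := by
    intro m
    rw [map_pow, hvπ, ← WithZero.exp_nsmul, ← WithZero.exp_neg]
    simp
  have hppos : ∀ i : ℕ, 0 < p ^ i := fun i => Nat.pow_pos hp.pos
  have hY : ∀ j : Fin s, ∃ Y : B,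
      a.coeff j * π ^ (n / p ^ (j.rev : ℕ)) = algebraMap B L Y := by
    intro j
    obtain ⟨Y, hY⟩ := exists_algebraMap_eq_of_dvrVal_le_one (A := B) (K := L)
      (x := a.coeff j * π ^ (n / p ^ (j.rev : ℕ))) (by
        rw [map_mul, hvπm, mul_inv_le_iff₀ WithZero.exp_pos, one_mul,
          ← WithZero.pow_le_exp_natCast_iff (hppos _)]
        exact ha j)
    exact ⟨Y, hY.symm⟩
  choose Y hY using hY
  have hlead := exists_residue_eq_pow_of_dvrVal_wittDeriv_lt p hb Y hY ha hD
  have hsmall : ∀ (j : Fin s) (z : B), p ^ (j.rev : ℕ) ∣ n → residue B z = 0 →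
      dvrVal B L (algebraMap B L z / π ^ (n / p ^ (j.rev : ℕ))) ^ p ^ (j.rev : ℕ) <
        WithZero.exp (n : ℤ) := by
    intro j z hj hz
    rw [residue_eq_zero_iff, ← dvrVal_lt_one_iff (K := L)] at hz
    have h1 : WithZero.exp (n : ℤ) =
        WithZero.exp ((n / p ^ (j.rev : ℕ) : ℕ) : ℤ) ^ p ^ (j.rev : ℕ) := by
      rw [← WithZero.exp_nsmul, nsmul_eq_mul, ← Nat.cast_mul, Nat.mul_div_cancel' hj]
    rw [h1]
    refine pow_lt_pow_left₀ ?_ zero_le (hppos _).ne'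
    rw [map_div₀, hvπm, div_inv_eq_mul]
    exact mul_lt_of_lt_one_left WithZero.exp_pos hz
  have hadiv : ∀ j, a.coeff j = algebraMap B L (Y j) / π ^ (n / p ^ (j.rev : ℕ)) := fun j => by
    rw [← hY, mul_div_cancel_right₀ _ (pow_ne_zero _ hπ0)]
  -- Approximate p-th roots of the components: if p^{i+1} ∣ n, divide a lifted p-th root of the
  -- leading coefficient by π^{n/p^{i+1}}; otherwise the component is already small and c = 0 works.
  have hc : ∀ j : Fin s, ∃ c : L,
      dvrVal B L c ^ p ^ (j.rev : ℕ) ≤ WithZero.exp ((n / p : ℕ) : ℤ) ∧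
      dvrVal B L (a.coeff j - c ^ p) ^ p ^ (j.rev : ℕ) < WithZero.exp (n : ℤ) := by
    intro j
    by_cases hj' : p ^ (j.rev + 1 : ℕ) ∣ n
    · have hj : p ^ (j.rev : ℕ) ∣ n := (pow_dvd_pow p (Nat.le_succ _)).trans hj'
      obtain ⟨w, hw⟩ := (hlead j hj).1
      have hdiv : n / p ^ (j.rev : ℕ) = n / p ^ (j.rev + 1 : ℕ) * p := by
        obtain ⟨m, rfl⟩ := hj'
        rw [Nat.mul_div_cancel_left _ (hppos _), pow_succ, mul_assoc,
          Nat.mul_div_cancel_left _ (hppos _), mul_comm]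
      refine ⟨algebraMap B L w / π ^ (n / p ^ (j.rev + 1 : ℕ)), ?_, ?_⟩
      · rw [WithZero.pow_le_exp_natCast_iff (hppos _), Nat.div_div_eq_div_mul, mul_comm p,
          ← pow_succ, map_div₀, hvπm, div_inv_eq_mul]
        exact mul_le_of_le_one_left' (dvrVal_le_one _)
      · have h1 : a.coeff j - (algebraMap B L w / π ^ (n / p ^ (j.rev + 1 : ℕ))) ^ p =
            algebraMap B L (Y j - w ^ p) / π ^ (n / p ^ (j.rev : ℕ)) := by
          rw [hadiv, div_pow, ← pow_mul, ← hdiv, ← sub_div, map_sub, map_pow]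
        rw [h1]
        exact hsmall j _ hj (by rw [map_sub, map_pow, hw, sub_self])
    · refine ⟨0, ?_, ?_⟩
      · rw [map_zero, zero_pow (hppos _).ne']
        exact zero_le
      · rw [zero_pow hp.ne_zero, sub_zero]
        by_cases hj : p ^ (j.rev : ℕ) ∣ n
        · rw [hadiv]
          exact hsmall j _ hj ((hlead j hj).2 hj')
        · refine lt_of_le_of_ne (ha j) fun h => hj ?_
          have h0 : dvrVal B L (a.coeff j) ≠ 0 := fun h0 => by
            rw [h0, zero_pow (hppos _).ne'] at h
            exact WithZero.exp_ne_zero h.symm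
          rw [← WithZero.exp_log h0, ← WithZero.exp_nsmul, WithZero.exp_inj, nsmul_eq_mul] at h
          exact_mod_cast Dvd.intro _ h
  choose c hc1 hc2 using hc
  have hbmem : (TruncatedWittVector.mk p c : TruncatedWittVector p s L) ∈
      wittFil B p L s (n / p) := fun j => by
    rw [TruncatedWittVector.coeff_mk]
    exact hc1 j
  refine ⟨TruncatedWittVector.mk p c, hbmem, ?_⟩
  have hle : n / p ≤ n - 1 := by
    have := Nat.div_lt_self (Nat.pos_of_ne_zero hn) hp.one_lt
    omega
  -- a - (Fb - b) = (a - Fb) + b, where a - Fb has lost its leading part and ⌊n/p⌋ ≤ n - 1.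
  rw [sub_sub_eq_add_sub, add_sub_right_comm]
  refine (wittFilSubgroup B L s (n - 1)).add_mem ?_ (wittFil_mono hle hbmem)
  refine sub_mem_wittFil_pred hn ha (wittFrob_mem_wittFil_iff.2 hbmem) fun j => ?_
  rw [coeff_wittFrob, TruncatedWittVector.coeff_mk]
  exact hc2 j

end Graded

/-! ### Functionals on the logarithmic differential forms -/

section LogForms

variable {A K : Type*} [CommRing A] [Field K] [Algebra A K]

variable (A) in
/-- The logarithmic form `d log u`. -/
def dlog (u : Kˣ) : LogDiff A K :=
  (logRelations A K).mkQ (0, 1 ⊗ₜ[ℤ] Additive.ofMul u)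

theorem dlog_mul (u w : Kˣ) : dlog A (u * w) = dlog A u + dlog A w := by
  rw [dlog, dlog, dlog, ← map_add, ofMul_mul, TensorProduct.tmul_add, Prod.mk_add_mk, zero_add]

theorem dlog_one : dlog A (1 : Kˣ) = 0 := by
  have h := dlog_mul (A := A) (1 : Kˣ) 1
  rw [one_mul] at h
  exact left_eq_add.1 h

theorem dlog_inv (u : Kˣ) : dlog A u⁻¹ = -dlog A u := by
  rw [eq_neg_iff_add_eq_zero, ← dlog_mul, inv_mul_cancel, dlog_one]

variable (A K) in
/-- The universal derivation with values in the logarithmic forms. -/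
def logD : Derivation ℤ A (LogDiff A K) :=
  ((logRelations A K).mkQ ∘ₗ LinearMap.inl A _ _).compDer (KaehlerDifferential.D ℤ A)

theorem logD_eq_smul_dlog {a : A} {u : Kˣ} (h : algebraMap A K a = u) :
    logD A K a = a • dlog A u := by
  change (logRelations A K).mkQ (KaehlerDifferential.D ℤ A a, 0) = _
  rw [dlog, ← map_smul, ← sub_eq_zero, ← map_sub, Submodule.mkQ_apply,
    Submodule.Quotient.mk_eq_zero]
  refine Submodule.subset_span ⟨a, u, h, ?_⟩
  rw [Prod.smul_mk, Prod.mk_sub_mk, smul_zero, sub_zero, zero_sub, TensorProduct.smul_tmul',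
    smul_eq_mul, mul_one]

/-- The forms `d log u` generate `Ω¹(log)`. -/
theorem logDiff_hom_ext [FaithfulSMul A K] {N : Type*} [AddCommGroup N] [Module A N]
    {f g : LogDiff A K →ₗ[A] N} (h : ∀ u : Kˣ, f (dlog A u) = g (dlog A u)) : f = g := by
  refine Submodule.linearMap_qext _ (LinearMap.prod_ext (Derivation.liftKaehlerDifferential_unique
    _ _ (Derivation.ext fun a => ?_)) (TensorProduct.AlgebraTensorModule.curry_injective
      (LinearMap.ext_ring (LinearMap.ext fun u => h u.toMul))))
  change f (logD A K a) = g (logD A K a)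
  obtain rfl | ha := eq_or_ne a 0
  · simp only [map_zero]
  · have ha' : algebraMap A K a ≠ 0 := by
      rwa [Ne, FaithfulSMul.algebraMap_eq_zero_iff]
    rw [logD_eq_smul_dlog (u := Units.mk0 _ ha') rfl, map_smul, map_smul, h]

/-- A derivation `D` and a compatible logarithmic derivative define a functional on `Ω¹(log)`. -/
theorem exists_logDiff_hom {N : Type*} [AddCommGroup N] [Module A N] (D : Derivation ℤ A N)
    (l : Additive Kˣ →+ N) (h : ∀ (a : A) (u : Kˣ), algebraMap A K a = u →
      D a = a • l (Additive.ofMul u)) :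
    ∃ f : LogDiff A K →ₗ[A] N, ∀ u : Kˣ, f (dlog A u) = l (Additive.ofMul u) := by
  refine ⟨Submodule.liftQ _ (LinearMap.coprod D.liftKaehlerDifferential
    (TensorProduct.AlgebraTensorModule.lift
      ((LinearMap.lsmul A (Additive Kˣ →ₗ[ℤ] N)).flip l.toIntLinearMap))) ?_, fun u => ?_⟩
  · refine Submodule.span_le.2 ?_
    rintro _ ⟨a, u, hu, rfl⟩
    simp [h a u hu]
  · simp [dlog]

end LogForms


/-! ### Functionals on adic completions -/

section Completion

variable {R M : Type*} [CommRing R] [AddCommGroup M] [Module R M] (I : Ideal R) [IsAdicComplete I R]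

/-- The extension of a functional to the completion of a module. -/
def complHom (f : M →ₗ[R] R) : AdicCompletion I M →ₗ[R] R :=
  (AdicCompletion.ofLinearEquiv I R).symm.toLinearMap ∘ₗ
    (AdicCompletion.map I f).restrictScalars R

theorem complHom_of (f : M →ₗ[R] R) (x : M) : complHom I f (AdicCompletion.of I M x) = f x := by
  rw [complHom, LinearMap.comp_apply, LinearMap.restrictScalars_apply, AdicCompletion.map_of]
  exact AdicCompletion.ofLinearEquiv_symm_of I _

theorem mk_complHom (f : M →ₗ[R] R) {x : AdicCompletion I M} {n : ℕ} {y : M}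
    (hy : (I ^ n • ⊤ : Submodule R M).mkQ y = x.val n) :
    (I ^ n • ⊤ : Submodule R R).mkQ (complHom I f x) = (I ^ n • ⊤ : Submodule R R).mkQ (f y) := by
  have h1 : AdicCompletion.of I R (complHom I f x) = AdicCompletion.map I f x :=
    AdicCompletion.of_ofLinearEquiv_symm I _
  have h2 := congrArg (fun z => z.val n) h1
  simp only [AdicCompletion.map_val_apply, ← hy] at h2
  exact h2

theorem complHom_eq_mul {f g : M →ₗ[R] R} {c : R} (h : ∀ x, f x = c * g x)
    (x : AdicCompletion I M) : complHom I f x = c * complHom I g x := by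
  refine (IsHausdorff.eq_iff_smodEq (I := I)).2 fun n => ?_
  obtain ⟨y, hy⟩ := Submodule.mkQ_surjective _ (x.val n)
  refine (mk_complHom I f hy).trans ?_
  change _ = (I ^ n • ⊤ : Submodule R R).mkQ (c • complHom I g x)
  rw [h, ← smul_eq_mul, map_smul, map_smul, mk_complHom I g hy]

/-- Functionals that detect the adic filtration of a module separate the points of its
completion. -/
theorem eq_zero_of_forall_complHom_eq_zero {S : Set (M →ₗ[R] R)}
    (hS : ∀ (n : ℕ) (y : M), (∀ f ∈ S, f y ∈ I ^ n) → y ∈ (I ^ n • ⊤ : Submodule R M))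
    {x : AdicCompletion I M} (hx : ∀ f ∈ S, complHom I f x = 0) : x = 0 := by
  refine AdicCompletion.ext fun n => ?_
  obtain ⟨y, hy⟩ := Submodule.mkQ_surjective _ (x.val n)
  rw [← hy, AdicCompletion.val_zero_apply, Submodule.mkQ_apply, Submodule.Quotient.mk_eq_zero]
  refine hS n y fun f hf => ?_
  have h := mk_complHom I f hy
  rw [hx f hf, map_zero, eq_comm, Submodule.mkQ_apply, Submodule.Quotient.mk_eq_zero,
    smul_eq_mul, Ideal.mul_top] at h
  exact h

/-- Over a local ring, an element outside `𝔪 M` is detected by a functional with values in the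
residue field. -/
theorem exists_residueField_hom_ne_zero [IsLocalRing R] {x : M}
    (hx : x ∉ (maximalIdeal R • ⊤ : Submodule R M)) :
    ∃ f : M →ₗ[R] ResidueField R, f x ≠ 0 := by
  let : Field (R ⧸ maximalIdeal R) := Ideal.Quotient.field _
  have hx' : (Submodule.Quotient.mk x : M ⧸ (maximalIdeal R • ⊤ : Submodule R M)) ≠ 0 := by
    rwa [Ne, Submodule.Quotient.mk_eq_zero]
  obtain ⟨f, hf⟩ := not_forall.1
    (mt (Module.forall_dual_apply_eq_zero_iff (R ⧸ maximalIdeal R) _).1 hx')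
  exact ⟨(f.restrictScalars R).comp (Submodule.mkQ _), hf⟩

end Completion

/-! ### Logarithmic derivations as functionals on logarithmic forms -/

section LogDerivationHom

variable {B L : Type*} [CommRing B] [IsDomain B] [IsDiscreteValuationRing B]
  [Field L] [Algebra B L] [IsFractionRing B L]

theorem IsLogDer.exists_algebraMap_eq {D : Derivation ℤ L L} (hD : IsLogDer B D) (u : Lˣ) :
    ∃ b : B, algebraMap B L b = D u / u := by
  refine exists_algebraMap_eq_of_dvrVal_le_one ?_
  rw [map_div₀]
  exact div_le_one_of_le₀ (hD u) zero_le

theorem IsLogDer.exists_logDiff_hom {D : Derivation ℤ L L} (hD : IsLogDer B D) :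
    ∃ f : LogDiff B L →ₗ[B] B, ∀ u : Lˣ, algebraMap B L (f (dlog B u)) = D u / u := by
  have hinj : Function.Injective (algebraMap B L) := IsFractionRing.injective B L
  choose l hl using hD.exists_algebraMap_eq
  have hDb : ∀ b : B, ∃ c : B, algebraMap B L c = D (algebraMap B L b) := fun b =>
    exists_algebraMap_eq_of_dvrVal_le_one ((hD _).trans (dvrVal_le_one b))
  choose d hd using hDb
  obtain ⟨f, hf⟩ := _root_.exists_logDiff_hom (K := L)
    (Derivation.mk' (AddMonoidHom.mk' d fun a b => hinj (by simp [hd])).toIntLinearMap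
      fun a b => hinj (by
        change algebraMap B L (d (a * b)) = algebraMap B L (a * d b + b * d a)
        simp [hd]))
    (AddMonoidHom.mk' (fun u => l u.toMul) fun u w => hinj (by
      rw [hl, toMul_add, map_add, hl, hl, Units.val_mul, D.leibniz, smul_eq_mul, smul_eq_mul]
      field_simp
      ring))
    (fun a u h => hinj (by
      change algebraMap B L (d a) = algebraMap B L (a * l u)
      rw [map_mul, hl, hd, h, mul_div_cancel₀ _ u.ne_zero]))
  exact ⟨f, fun u => by rw [hf]; exact hl u⟩

/-- The functional on `Ω¹(log)` given by a logarithmic derivation `D`; it sends `d log u` to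
`D u / u`. -/
def IsLogDer.hom {D : Derivation ℤ L L} (hD : IsLogDer B D) : LogDiff B L →ₗ[B] B :=
  (IsLogDer.exists_logDiff_hom hD).choose

theorem IsLogDer.algebraMap_hom_dlog {D : Derivation ℤ L L} (hD : IsLogDer B D) (u : Lˣ) :
    algebraMap B L (hD.hom (dlog B u)) = D u / u :=
  (IsLogDer.exists_logDiff_hom hD).choose_spec u

end LogDerivationHom

section LogFunctionals

variable {B L : Type*} [CommRing B] [IsDomain B] [IsDiscreteValuationRing B]
  [Field L] [Algebra B L] [IsFractionRing B L]

theorem IsLogDer.add {D E : Derivation ℤ L L} (hD : IsLogDer B D) (hE : IsLogDer B E) :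
    IsLogDer B (D + E) := fun x =>
  (Valuation.map_add _ _ _).trans (max_le (hD x) (hE x))

theorem IsLogDer.smul {D : Derivation ℤ L L} (hD : IsLogDer B D) (c : B) :
    IsLogDer B (algebraMap B L c • D) := fun x => by
  rw [Derivation.smul_apply, smul_eq_mul, map_mul]
  exact (mul_le_of_le_one_left' (dvrVal_le_one c)).trans (hD x)

theorem units_mem_of_irreducible_mem {b : B} (hb : Irreducible b) (H : Subgroup Lˣ)
    (h1 : ∀ ϖ : Lˣ, (ϖ : L) = algebraMap B L b → ϖ ∈ H)
    (h2 : ∀ (u : Lˣ) (w : Bˣ), (u : L) = algebraMap B L w → u ∈ H) (u : Lˣ) : u ∈ H := by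
  have hB : ∀ (a : B) (u : Lˣ), (u : L) = algebraMap B L a → u ∈ H := by
    intro a u hu
    have ha : a ≠ 0 := by rintro rfl; exact u.ne_zero (hu.trans (map_zero _))
    have hb0 : algebraMap B L b ≠ 0 := by
      rw [Ne, IsFractionRing.to_map_eq_zero_iff]; exact hb.ne_zero
    obtain ⟨n, w, rfl⟩ := IsDiscreteValuationRing.eq_unit_mul_pow_irreducible ha hb
    have h : u = Units.map (algebraMap B L : B →* L) w * Units.mk0 _ hb0 ^ n := by
      ext
      rw [hu]
      simp
    rw [h]
    exact H.mul_mem (h2 _ w rfl) (H.pow_mem (h1 _ rfl) n)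
  obtain ⟨a, s, hs, h⟩ := IsFractionRing.div_surjective (A := B) (u : L)
  have hs0 : algebraMap B L s ≠ 0 := by
    rw [Ne, IsFractionRing.to_map_eq_zero_iff]; exact nonZeroDivisors.ne_zero hs
  have h3 := hB s (Units.mk0 _ hs0) rfl
  have h4 := hB a (u * Units.mk0 _ hs0) (by
    rw [Units.val_mul, Units.val_mk0, ← h, div_mul_cancel₀ _ hs0])
  exact (H.mul_mem_cancel_right h3).1 h4

theorem IsLogDer.algebraMap_hom_logD {D : Derivation ℤ L L} (hD : IsLogDer B D) (x : B) :
    algebraMap B L (hD.hom (logD B L x)) = D (algebraMap B L x) := by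
  obtain rfl | hx := eq_or_ne x 0
  · simp
  have hx' : algebraMap B L x ≠ 0 := by rwa [Ne, IsFractionRing.to_map_eq_zero_iff]
  rw [logD_eq_smul_dlog (u := Units.mk0 _ hx') rfl, map_smul, smul_eq_mul, map_mul,
    hD.algebraMap_hom_dlog, Units.val_mk0, mul_div_cancel₀ _ hx']

theorem mem_maximalIdeal_pow_smul_top_iff {M : Type*} [AddCommGroup M] [Module B M] {b : B}
    (hb : Irreducible b) {n : ℕ} {x : M} :
    x ∈ (maximalIdeal B ^ n • ⊤ : Submodule B M) ↔ ∃ y, b ^ n • y = x := by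
  rw [hb.maximalIdeal_eq, Ideal.span_singleton_pow, Submodule.ideal_span_singleton_smul,
    Submodule.mem_smul_pointwise_iff_exists]
  simp

variable [IsAdicComplete (maximalIdeal B) B]


/-- Every functional on `Ω¹(log)` with values in the residue field is the reduction of the functional
of a logarithmic derivation. -/
theorem exists_isLogDer_residue_hom_eq (p : ℕ) [Fact p.Prime] [CharP B p]
    (ψ : LogDiff B L →ₗ[B] ResidueField B) :
    ∃ (D : Derivation ℤ L L) (hD : IsLogDer B D), ∀ x, residue B (hD.hom x) = ψ x := by
  obtain ⟨b, hb⟩ := IsDiscreteValuationRing.exists_irreducible B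
  have hinj : Function.Injective (algebraMap B L) := IsFractionRing.injective B L
  have hbm : residue B b = 0 := by
    rw [residue_eq_zero_iff, hb.maximalIdeal_eq]; exact Ideal.mem_span_singleton_self b
  have hb0 : algebraMap B L b ≠ 0 := by
    rw [Ne, IsFractionRing.to_map_eq_zero_iff]; exact hb.ne_zero
  have hψ : ∀ (c : B) x, ψ (c • x) = residue B c * ψ x := fun c x => by
    rw [map_smul, Algebra.smul_def]; rfl
  obtain ⟨σ, hσ⟩ := exists_coefficientField B p
  obtain ⟨α, hα⟩ := residue_surjective (ψ (dlog B (Units.mk0 _ hb0)))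
  -- ψ determines a residual derivation d through the coefficient field and the value ψ(d log b).
  -- The required derivation is a lift of d killing b, plus α times the Euler derivation, with α
  -- lifting ψ(d log b).
  let d : ResidueField B →+ ResidueField B :=
    ψ.toAddMonoidHom.comp ((logD B L : B →+ LogDiff B L).comp σ.toAddMonoidHom)
  have hd : ∀ a, d a = ψ (logD B L (σ a)) := fun a => rfl
  obtain ⟨D', hD', hD'b, hD'r⟩ := exists_isLogDer_lift (L := L) p hb d (fun x y => by
    rw [hd, hd, hd, map_mul, Derivation.leibniz, map_add, hψ, hψ, hσ, hσ])
  obtain ⟨E, hE, hEb, hEr⟩ := exists_isLogDer_euler (L := L) p hb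
  have hD := hD'.add (hE.smul α)
  refine ⟨_, hD, ?_⟩
  have hform : ∀ x : B, residue B (hD.hom (logD B L x)) = ψ (logD B L x) := by
    intro x
    obtain ⟨y, hy, hyr⟩ := hD'r x
    obtain ⟨e, he⟩ := exists_algebraMap_eq_of_dvrVal_le_one (hEr x).le
    have he' : residue B e = 0 := by
      rw [residue_eq_zero_iff, ← dvrVal_lt_one_iff (K := L), he]; exact hEr x
    have h1 : hD.hom (logD B L x) = y + α * e := hinj (by
      rw [hD.algebraMap_hom_logD, map_add, map_mul, he, ← hy]; rfl)
    -- Writing x - σ(x̄) = bz, the form d(bz) = b dz + zb d log b is killed by ψ, so only the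
    -- coefficient field part contributes.
    have h2 : residue B (x - σ (residue B x)) = 0 := by rw [map_sub, hσ, sub_self]
    rw [residue_eq_zero_iff, hb.maximalIdeal_eq, Ideal.mem_span_singleton] at h2
    obtain ⟨z, hz⟩ := h2
    have h3 : logD B L b = b • dlog B (Units.mk0 _ hb0) := logD_eq_smul_dlog rfl
    rw [h1, map_add, map_mul, he', mul_zero, add_zero, hyr, hd, ← sub_eq_zero, ← map_sub,
      ← map_sub, ← neg_sub, hz, map_neg, map_neg, Derivation.leibniz, map_add, hψ, hψ, h3, hψ,
      hbm]
    simp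
  let H : Subgroup Lˣ :=
    { carrier := {u | residue B (hD.hom (dlog B u)) = ψ (dlog B u)}
      mul_mem' := fun {u w} hu hw => by
        rw [Set.mem_ofPred_eq] at hu hw ⊢
        rw [dlog_mul, map_add, map_add, map_add, hu, hw]
      one_mem' := by rw [Set.mem_ofPred_eq, dlog_one, map_zero, map_zero, map_zero]
      inv_mem' := fun {u} hu => by
        rw [Set.mem_ofPred_eq] at hu ⊢
        rw [dlog_inv, map_neg, map_neg, map_neg, hu] }
  have hH : ∀ u, u ∈ H := units_mem_of_irreducible_mem hb H (fun ϖ hϖ => by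
      obtain rfl : ϖ = Units.mk0 _ hb0 := Units.ext hϖ
      change residue B _ = _
      rw [← hα]
      congr 1
      refine hinj ?_
      rw [hD.algebraMap_hom_dlog, Derivation.add_apply, Derivation.smul_apply, Units.val_mk0, hD'b,
        hEb, zero_add, smul_eq_mul, mul_div_cancel_right₀ _ hb0])
    (fun u w hu => by
      have h1 := hform w
      rw [logD_eq_smul_dlog hu.symm, map_smul, hψ, smul_eq_mul, map_mul] at h1
      exact mul_left_cancel₀ (residue_ne_zero_iff_isUnit _ |>.2 w.isUnit) h1)
  have hext := logDiff_hom_ext (f := (Algebra.linearMap B (ResidueField B)).comp hD.hom) (g := ψ) hH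
  exact fun x => DFunLike.congr_fun hext x

/-- The functionals of the logarithmic derivations detect the adic filtration of `Ω¹(log)`. -/
theorem mem_maximalIdeal_pow_smul_top_of_hom_mem (p : ℕ) [Fact p.Prime] [CharP B p] (n : ℕ)
    {x : LogDiff B L}
    (hx : ∀ (D : Derivation ℤ L L) (hD : IsLogDer B D), hD.hom x ∈ maximalIdeal B ^ n) :
    x ∈ (maximalIdeal B ^ n • ⊤ : Submodule B (LogDiff B L)) := by
  obtain ⟨b, hb⟩ := IsDiscreteValuationRing.exists_irreducible B
  induction n generalizing x with
  | zero => simp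
  | succ n ih =>
    obtain ⟨y, rfl⟩ := (mem_maximalIdeal_pow_smul_top_iff hb).1
      (ih fun D hD => Ideal.pow_le_pow_right (Nat.le_succ n) (hx D hD))
    have hy : y ∈ (maximalIdeal B • ⊤ : Submodule B (LogDiff B L)) := by
      by_contra hy
      obtain ⟨ψ, hψ⟩ := exists_residueField_hom_ne_zero hy
      obtain ⟨D, hD, hDψ⟩ := exists_isLogDer_residue_hom_eq p ψ
      refine hψ ?_
      have h1 := hx D hD
      rw [map_smul, smul_eq_mul, hb.maximalIdeal_eq, Ideal.span_singleton_pow,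
        Ideal.mem_span_singleton, pow_succ, mul_dvd_mul_iff_left (pow_ne_zero n hb.ne_zero),
        ← Ideal.mem_span_singleton, ← hb.maximalIdeal_eq, ← residue_eq_zero_iff] at h1
      rw [← hDψ, h1]
    rw [← pow_one (maximalIdeal B)] at hy
    obtain ⟨z, rfl⟩ := (mem_maximalIdeal_pow_smul_top_iff hb).1 hy
    exact (mem_maximalIdeal_pow_smul_top_iff hb).2 ⟨z, by rw [smul_smul, pow_one, pow_succ]⟩

end LogFunctionals

/-! ### The length of the torsion -/

/-- Since f(z) is a unit, Rz splits off from the torsion-free module N; the quotient is R/c plus a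
torsion-free summand, so its torsion is the image of Rz. -/
theorem length_torsion_quotient_span_smul {R N : Type*} [CommRing R] [IsDomain R] [AddCommGroup N]
    [Module R N] (hN : ∀ (r : R) (x : N), r ≠ 0 → r • x = 0 → x = 0) {z : N} (f : N →ₗ[R] R)
    (hf : IsUnit (f z)) {c : R} (hc : c ≠ 0) {W : Submodule R N} (hW : W = R ∙ (c • z)) :
    Module.length R (Submodule.torsion R (N ⧸ W)) = Module.length R (R ⧸ Ideal.span {c}) := by
  subst hW
  let g : R →ₗ[R] N ⧸ (R ∙ (c • z)) := (Submodule.mkQ _).comp (LinearMap.toSpanSingleton R N z)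
  have hg : ∀ r, g r = Submodule.Quotient.mk (r • z) := fun r => rfl
  have hker : LinearMap.ker g = Ideal.span {c} := by
    ext r
    rw [LinearMap.mem_ker, hg, Submodule.Quotient.mk_eq_zero, Submodule.mem_span_singleton,
      Ideal.mem_span_singleton]
    constructor
    · rintro ⟨a, ha⟩
      have h1 := congrArg f ha
      rw [map_smul, map_smul, map_smul, smul_eq_mul, smul_eq_mul, smul_eq_mul, ← mul_assoc] at h1
      exact ⟨a, by rw [← hf.mul_right_cancel h1, mul_comm]⟩
    · rintro ⟨a, rfl⟩
      exact ⟨a, by rw [smul_smul, mul_comm]⟩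
  have hrange : LinearMap.range g = Submodule.torsion R (N ⧸ (R ∙ (c • z))) := by
    ext q
    rw [LinearMap.mem_range, Submodule.mem_torsion_iff]
    constructor
    · rintro ⟨r, rfl⟩
      refine ⟨⟨c, mem_nonZeroDivisors_of_ne_zero hc⟩, ?_⟩
      change c • g r = 0
      rw [← map_smul, ← LinearMap.mem_ker, hker, smul_eq_mul]
      exact Ideal.mul_mem_right _ _ (Ideal.mem_span_singleton_self c)
    · rintro ⟨⟨r, hr⟩, h⟩
      replace h : r • q = 0 := h
      obtain ⟨x, rfl⟩ := Submodule.Quotient.mk_surjective _ q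
      rw [← Submodule.Quotient.mk_smul, Submodule.Quotient.mk_eq_zero,
        Submodule.mem_span_singleton] at h
      obtain ⟨a, ha⟩ := h
      obtain ⟨u, hu⟩ := hf
      refine ⟨f x * ↑u⁻¹, ?_⟩
      rw [hg]
      congr 1
      rw [← sub_eq_zero]
      refine hN r _ (nonZeroDivisors.ne_zero hr) ?_
      have h1 := congrArg f ha
      rw [map_smul, map_smul, map_smul, smul_eq_mul, smul_eq_mul, smul_eq_mul, ← hu] at h1
      rw [smul_sub, ← ha, smul_smul, smul_smul, ← sub_smul, ← mul_assoc, ← h1]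
      rw [show a * (c * (u : R)) * ((u⁻¹ : Rˣ) : R) - a * c = a * c * (u * ((u⁻¹ : Rˣ) : R) - 1) by
        ring, u.mul_inv, sub_self, mul_zero, zero_smul]
  rw [← hrange, ← hker]
  exact (LinearMap.quotKerEquivRange g).length_eq.symm

/-! ### Completed logarithmic forms and perfect residue fields -/

section CompletedLogForms

variable {A K : Type*} [CommRing A] [IsDomain A] [IsDiscreteValuationRing A]
  [IsAdicComplete (maximalIdeal A) A] [Field K] [Algebra A K] [IsFractionRing A K]

/-- The functionals of the logarithmic derivations separate the completed forms. -/
theorem complLogDiff_eq_zero (p : ℕ) [Fact p.Prime] [CharP A p] {x : ComplLogDiff A K}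
    (hx : ∀ (D : Derivation ℤ K K) (hD : IsLogDer A D),
      complHom (maximalIdeal A) hD.hom x = 0) : x = 0 := by
  refine eq_zero_of_forall_complHom_eq_zero (maximalIdeal A)
    (S := {f | ∃ (D : Derivation ℤ K K) (hD : IsLogDer A D), f = hD.hom}) (fun n y hy =>
      mem_maximalIdeal_pow_smul_top_of_hom_mem p n fun D hD => hy _ ⟨D, hD, rfl⟩) ?_
  rintro _ ⟨D, hD, rfl⟩
  exact hx D hD

/-- K = ∑ t^i K^p, and a derivation in characteristic p kills K^p. -/
theorem Derivation.eq_zero_of_perfectField_residueField (p : ℕ) [Fact p.Prime] [CharP A p]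
    [PerfectField (ResidueField A)] {t : A} (ht : Irreducible t) {M : Type*} [AddCommGroup M]
    [Module K M] {D : Derivation ℤ K M} (hD : D (algebraMap A K t) = 0) : D = 0 := by
  have : CharP K p := charP_of_injective_algebraMap (IsFractionRing.injective A K) p
  ext x
  obtain ⟨c, rfl⟩ := exists_eq_sum_pow_mul_pow_fractionRing p ht x
  rw [map_sum]
  refine Finset.sum_eq_zero fun i _ => ?_
  rw [D.leibniz, D.leibniz_pow, D.leibniz_pow, hD, ← Nat.cast_smul_eq_nsmul K p,
    CharP.cast_eq_zero]
  simp

/-- If the residue field is perfect, all completed logarithmic forms are multiples of `d log t`. -/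
theorem exists_eq_smul_dlog (p : ℕ) [Fact p.Prime] [CharP A p] [PerfectField (ResidueField A)]
    {t : A} (ht : Irreducible t) {τ : Kˣ} (hτ : algebraMap A K t = τ) (x : ComplLogDiff A K) :
    ∃ a : A, x = a • AdicCompletion.of (maximalIdeal A) (LogDiff A K) (dlog A τ) := by
  have hinj : Function.Injective (algebraMap A K) := IsFractionRing.injective A K
  obtain ⟨E, hE, hEt, -⟩ := exists_isLogDer_euler (L := K) p ht
  have hE1 : hE.hom (dlog A τ) = 1 := hinj (by
    rw [hE.algebraMap_hom_dlog, ← hτ, hEt, hτ, div_self τ.ne_zero, map_one])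
  refine ⟨complHom (maximalIdeal A) hE.hom x, ?_⟩
  rw [← sub_eq_zero]
  refine complLogDiff_eq_zero p fun D hD => ?_
  have hDE : ∀ y, D y = D τ / τ * E y := fun y => by
    have h1 := Derivation.eq_zero_of_perfectField_residueField p ht
      (D := D - (D τ / τ) • E) (by
        rw [Derivation.sub_apply, Derivation.smul_apply, hEt, hτ, smul_eq_mul,
          div_mul_cancel₀ _ τ.ne_zero, sub_self])
    exact sub_eq_zero.1 (DFunLike.congr_fun h1 y)
  have h1 : hD.hom = hD.hom (dlog A τ) • hE.hom := logDiff_hom_ext fun u => hinj (by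
    rw [LinearMap.smul_apply, smul_eq_mul, map_mul, hD.algebraMap_hom_dlog,
      hD.algebraMap_hom_dlog, hE.algebraMap_hom_dlog, hDE u, mul_div_assoc])
  have h2 : ∀ y, complHom (maximalIdeal A) hD.hom y =
      hD.hom (dlog A τ) * complHom (maximalIdeal A) hE.hom y :=
    complHom_eq_mul _ fun y => DFunLike.congr_fun h1 y
  rw [h2, map_sub, map_smul, complHom_of, hE1, smul_eq_mul, mul_one, sub_self, mul_zero]

end CompletedLogForms

/-! ### The torsion length as the least valuation of Dt/t -/

section DeltaTor

variable {A K B L : Type*}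
  [CommRing A] [IsDomain A] [IsDiscreteValuationRing A] [IsAdicComplete (maximalIdeal A) A]
  [Field K] [Algebra A K] [IsFractionRing A K]
  [CommRing B] [IsDomain B] [IsDiscreteValuationRing B] [IsAdicComplete (maximalIdeal B) B]
  [Field L] [Algebra B L] [IsFractionRing B L]
  [Algebra A B] [Algebra K L] [Algebra A L] [IsScalarTower A K L] [IsScalarTower A B L]
  [IsLocalHom (algebraMap A B)]

theorem complLogMap_of_dlog (u : Kˣ) :
    complLogMap A K B L (AdicCompletion.of (maximalIdeal A) (LogDiff A K) (dlog A u)) =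
      AdicCompletion.of (maximalIdeal B) (LogDiff B L)
        (dlog B (Units.map (algebraMap K L : K →* L) u)) := by
  have h : logMap A K B L (dlog A u) = dlog B (Units.map (algebraMap K L : K →* L) u) := by
    change (logRelations B L).mkQ (logPreMap A K B L _) = _
    simp [logPreMap, dlog]
  rw [← h]
  exact AdicCompletion.ext fun n => rfl

theorem span_range_complLogMap (p : ℕ) [Fact p.Prime] [CharP A p] [PerfectField (ResidueField A)]
    {t : A} (ht : Irreducible t) {τ : Kˣ} (hτ : algebraMap A K t = τ) :
    Submodule.span B (Set.range (complLogMap A K B L)) =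
      B ∙ AdicCompletion.of (maximalIdeal B) (LogDiff B L)
        (dlog B (Units.map (algebraMap K L : K →* L) τ)) := by
  refine le_antisymm (Submodule.span_le.2 ?_) (Submodule.span_mono ?_)
  · rintro _ ⟨x, rfl⟩
    obtain ⟨a, rfl⟩ := exists_eq_smul_dlog p ht hτ x
    rw [LinearMap.map_smulₛₗ, complLogMap_of_dlog]
    exact Submodule.smul_mem _ _ (Submodule.mem_span_singleton_self _)
  · rintro _ rfl
    exact ⟨_, complLogMap_of_dlog τ⟩

/-- A uniformizer `t` of `K` has a nonzero derivative along some logarithmic derivation of `L`. -/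
theorem exists_isLogDer_apply_ne_zero (p : ℕ) [Fact p.Prime] [CharP A p] [CharP B p]
    [PerfectField (ResidueField A)]
    (hsep : ∃ x : K, ∀ y : L, y ^ p ≠ algebraMap K L x) {t : A} (ht : Irreducible t) :
    ∃ D : Derivation ℤ L L, IsLogDer B D ∧ D (algebraMap A L t) ≠ 0 := by
  by_contra! h
  -- Otherwise t would become a p-th power in B, and then K = ∑ t^i K^p would lie in L^p.
  obtain ⟨w, hw⟩ := exists_pow_eq_of_forall_isLogDer_eq_zero (L := L) p (algebraMap A B t)
    fun D hD => by rw [← IsScalarTower.algebraMap_apply]; exact h D hD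
  obtain ⟨x, hx⟩ := hsep
  obtain ⟨c, rfl⟩ := exists_eq_sum_pow_mul_pow_fractionRing p ht x
  have : CharP L p := charP_of_injective_algebraMap (IsFractionRing.injective B L) p
  have : ExpChar L p := ExpChar.prime Fact.out
  refine hx (∑ i ∈ Finset.range p, algebraMap B L w ^ i * algebraMap K L (c i)) ?_
  rw [sum_pow_char, map_sum]
  refine Finset.sum_congr rfl fun i _ => ?_
  rw [mul_pow, ← pow_mul, mul_comm i, pow_mul, ← map_pow (algebraMap B L), hw, map_mul, map_pow,
    map_pow, ← IsScalarTower.algebraMap_apply, ← IsScalarTower.algebraMap_apply]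

/-- The torsion length `δ_tor` is the least valuation of the logarithmic derivatives of a
uniformizer of `K` along the logarithmic derivations of `L`. -/
theorem exists_deltaTor_eq (p : ℕ) [Fact p.Prime] [CharP A p] [CharP B p]
    [PerfectField (ResidueField A)]
    (hsep : ∃ x : K, ∀ y : L, y ^ p ≠ algebraMap K L x) {t : A} (ht : Irreducible t) :
    ∃ δ : ℕ, deltaTor A K B L = δ ∧
      (∀ D : Derivation ℤ L L, IsLogDer B D →
        dvrVal B L (D (algebraMap A L t) / algebraMap A L t) ≤ WithZero.exp (-δ : ℤ)) ∧
      ∃ D : Derivation ℤ L L, IsLogDer B D ∧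
        dvrVal B L (D (algebraMap A L t) / algebraMap A L t) = WithZero.exp (-δ : ℤ) := by
  classical
  have ht0 : algebraMap A K t ≠ 0 := by
    rw [Ne, IsFractionRing.to_map_eq_zero_iff]; exact ht.ne_zero
  set τ : Kˣ := Units.mk0 _ ht0 with hτ
  set θ : Lˣ := Units.map (algebraMap K L : K →* L) τ with hθ
  have hθt : (θ : L) = algebraMap A L t := (IsScalarTower.algebraMap_apply A K L t).symm
  obtain ⟨b, hb⟩ := IsDiscreteValuationRing.exists_irreducible B
  have hbpow : ∀ n, maximalIdeal B ^ n = Ideal.span {b ^ n} := fun n => by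
    rw [hb.maximalIdeal_eq, Ideal.span_singleton_pow]
  -- δ will be the least such n: every functional sends d log t into the δ-th power of the maximal
  -- ideal, and some functional not into the next one.
  have hex : ∃ n, ∃ (D : Derivation ℤ L L) (hD : IsLogDer B D),
      hD.hom (dlog B θ) ∉ maximalIdeal B ^ (n + 1) := by
    obtain ⟨D, hD, hDt⟩ := exists_isLogDer_apply_ne_zero (B := B) p hsep ht
    have h0 : hD.hom (dlog B θ) ≠ 0 := fun h0 => by
      have h1 := hD.algebraMap_hom_dlog θ
      rw [h0, map_zero, hθt, eq_comm, div_eq_zero_iff, ← hθt] at h1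
      exact h1.elim (by rwa [hθt]) θ.ne_zero
    obtain ⟨n, u, hu⟩ := IsDiscreteValuationRing.eq_unit_mul_pow_irreducible h0 hb
    refine ⟨n, D, hD, ?_⟩
    rw [hu, hbpow, Ideal.mem_span_singleton, mul_comm, pow_succ,
      mul_dvd_mul_iff_left (pow_ne_zero n hb.ne_zero)]
    exact fun h => hb.not_isUnit (isUnit_of_dvd_unit h u.isUnit)
  obtain ⟨D₀, hD₀, hD₀δ⟩ := Nat.find_spec hex
  set δ := Nat.find hex with hδ
  have hall : ∀ (D : Derivation ℤ L L) (hD : IsLogDer B D),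
      hD.hom (dlog B θ) ∈ maximalIdeal B ^ δ := by
    intro D hD
    by_contra hmem
    obtain h | h := Nat.eq_zero_or_pos δ
    · rw [h, pow_zero, Ideal.one_eq_top] at hmem
      exact hmem Submodule.mem_top
    · refine Nat.find_min hex (Nat.sub_lt h one_pos) ⟨D, hD, ?_⟩
      rwa [← hδ, Nat.sub_add_cancel (m := 1) h]
  -- As the functionals detect the adic filtration, d log t is divisible by b^δ already before
  -- completion. Minimality of δ then gives a functional with unit value on z.
  obtain ⟨z, hz⟩ := (mem_maximalIdeal_pow_smul_top_iff hb).1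
    (mem_maximalIdeal_pow_smul_top_of_hom_mem p δ hall)
  have hunit : IsUnit (hD₀.hom z) := by
    by_contra hnu
    refine hD₀δ ?_
    rw [← hz, map_smul, smul_eq_mul, pow_succ]
    exact Ideal.mul_mem_mul (Ideal.pow_mem_pow (by
      rw [hb.maximalIdeal_eq]; exact Ideal.mem_span_singleton_self b) _)
      ((mem_maximalIdeal _).2 hnu)
  have hval : ∀ (D : Derivation ℤ L L) (hD : IsLogDer B D),
      dvrVal B L (D (algebraMap A L t) / algebraMap A L t) =
        WithZero.exp (-δ : ℤ) * dvrVal B L (algebraMap B L (hD.hom z)) := by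
    intro D hD
    rw [← hθt, ← hD.algebraMap_hom_dlog, ← hz, map_smul, smul_eq_mul, map_mul, map_mul, map_pow,
      map_pow, dvrVal_irreducible hb, ← WithZero.exp_nsmul]
    simp
  refine ⟨δ, ?_, fun D hD => ?_, D₀, hD₀, ?_⟩
  · rw [deltaTor, length_torsion_quotient_span_smul
      (z := AdicCompletion.of (maximalIdeal B) (LogDiff B L) z) (c := b ^ δ) (fun r x hr hx => ?_)
      (complHom (maximalIdeal B) hD₀.hom) (by rwa [complHom_of]) (pow_ne_zero _ hb.ne_zero)
      (by rw [← map_smul, hz, span_range_complLogMap p ht (τ := τ) rfl]), ← hbpow,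
      IsDiscreteValuationRing.length_quotient_pow_maximalIdeal]
    refine complLogDiff_eq_zero p fun D hD => ?_
    have h1 := congrArg (complHom (maximalIdeal B) hD.hom) hx
    rw [map_smul, map_zero, smul_eq_mul] at h1
    exact (mul_eq_zero.1 h1).resolve_left hr
  · rw [hval D hD]
    exact mul_le_of_le_one_right' (dvrVal_le_one _)
  · rw [hval D₀ hD₀]
    obtain ⟨u, hu⟩ := hunit
    rw [← hu, dvrVal_unit, mul_one]

end DeltaTor

/-! ### Swan conductors and derivations -/

theorem GalH1.res_pow {K L : Type*} [Field K] [Field L] [Algebra K L]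
    (ι : AlgebraicClosure K →ₐ[K] AlgebraicClosure L) (χ : GalH1 K) (m : ℕ) :
    (χ ^ m).res ι = χ.res ι ^ m := by
  ext σ
  rw [ContinuousMonoidHom.pow_apply]
  exact ContinuousMonoidHom.pow_apply χ m _

section SwanConductor

variable {p : ℕ} [Fact p.Prime]
variable {B L : Type*} [CommRing B] [IsDomain B] [IsDiscreteValuationRing B]
  [Field L] [Algebra B L] [IsFractionRing B L]

/-- The infimum of an empty set of naturals is 0, so a nonzero value is attained. -/
theorem mem_swanFil_swan {χ : GalH1 L} (h : swan B p χ ≠ 0) : χ ∈ swanFil B p L (swan B p χ) :=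
  Nat.sInf_mem (s := {n | χ ∈ swanFil B p L n})
    (Set.nonempty_iff_ne_empty.2 fun h0 => h (by rw [swan, h0, Nat.sInf_empty]))

theorem notMem_swanFil_of_lt_swan {χ : GalH1 L} {n : ℕ} (h : n < swan B p χ) :
    χ ∉ swanFil B p L n := fun hn => Nat.notMem_of_lt_sInf h hn

variable [CharP L p]

theorem wittDeriv_sub_frob_sub (D : Derivation ℤ L L) {s : ℕ} (a b : TruncatedWittVector p s L) :
    wittDeriv D (a - (wittFrob s L b - b)) = wittDeriv D a + wittDeriv D b := by
  rw [wittDeriv_sub, wittDeriv_sub, wittDeriv_frob, zero_sub, sub_neg_eq_add]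

/-- Verschiebung changes neither the character, nor the filtration step, nor the derivative; it
brings two representatives to a common length. -/
theorem IsArtinSchreierWitt.exists_length {s n : ℕ} {a : TruncatedWittVector p s L} {χ : GalH1 L}
    (ha : a ∈ wittFil B p L s n) (h : IsArtinSchreierWitt p a χ) {S : ℕ} (hS : s ≤ S) :
    ∃ a' ∈ wittFil B p L S n, IsArtinSchreierWitt p a' χ ∧
      ∀ D : Derivation ℤ L L, wittDeriv D a' = wittDeriv D a := by
  induction S, hS using Nat.le_induction with
  | base => exact ⟨a, ha, h, fun _ => rfl⟩
  | succ S _ ih =>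
    obtain ⟨a', ha', h', hD⟩ := ih
    exact ⟨_, wittVer_mem_wittFil ha', h'.wittVer, fun D => by rw [wittDeriv_wittVer, hD]⟩

/-- A lower bound for the Swan conductor by means of a logarithmic derivation. -/
theorem notMem_swanFil_of_dvrVal_wittDeriv_eq {s m N n' n : ℕ} {a : TruncatedWittVector p s L}
    {χ : GalH1 L} (ha : a ∈ wittFil B p L s N)
    (h : IsArtinSchreierWitt p a (χ ^ m)) {D : Derivation ℤ L L} (hD : IsLogDer B D)
    (hDa : dvrVal B L (wittDeriv D a) = WithZero.exp (n' : ℤ)) (hN : N / p < n') (hn : n < n') :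
    χ ∉ swanFil B p L n := by
  rintro ⟨m₁, hm₁, s₁, a₁, ha₁, h₁⟩
  have hn'N : n' ≤ N := by
    have h1 := dvrVal_wittDeriv_le hD ha
    rw [hDa, WithZero.exp_le_exp] at h1
    exact_mod_cast h1
  obtain ⟨α, hα, hαχ, hαD⟩ := h.exists_length ha (le_max_left s s₁)
  obtain ⟨β, hβ, hβχ, hβD⟩ := h₁.exists_length ha₁ (le_max_right s s₁)
  -- Both multiples represent χ^{m m₁}, so their difference has the form Fb - b, and its pole bound
  -- N forces b ∈ F_{⌊N/p⌋}.
  have hc := (hαχ.nsmul m₁).div (hβχ.nsmul m)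
  rw [← pow_mul, ← pow_mul, mul_comm m, div_self'] at hc
  obtain ⟨b, hb⟩ := hc.exists_frob_sub_eq
  have hbN : b ∈ wittFil B p L (max s s₁) (N / p) := by
    refine mem_wittFil_div_of_frob_sub_mem ?_
    rw [hb]
    exact (wittFilSubgroup B L _ N).sub_mem ((wittFilSubgroup B L _ N).nsmul_mem hα m₁)
      ((wittFilSubgroup B L _ N).nsmul_mem (wittFil_mono (hn.le.trans hn'N) hβ) m)
  have hnat : ∀ k : ℕ, dvrVal B L (k : L) ≤ 1 := fun k => by
    rw [← map_natCast (algebraMap B L)]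
    exact dvrVal_le_one _
  have h1 := congrArg (wittDeriv D) hb
  rw [wittDeriv_sub, wittDeriv_sub, wittDeriv_frob, wittDeriv_nsmul, wittDeriv_nsmul, hαD, hβD,
    zero_sub, nsmul_eq_mul, nsmul_eq_mul, eq_sub_iff_add_eq] at h1
  -- The relation reads -Db + m·Da₁ = m₁·Da. Both terms on the left are smaller than exp n', while
  -- |m₁| = 1 makes the right side of size exp n'.
  have h2 : dvrVal B L (m₁ * wittDeriv D a) < WithZero.exp (n' : ℤ) := by
    rw [← h1]
    refine lt_of_le_of_lt (Valuation.map_add _ _ _) (max_lt ?_ ?_)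
    · rw [Valuation.map_neg]
      exact (dvrVal_wittDeriv_le hD hbN).trans_lt (WithZero.exp_lt_exp.2 (by exact_mod_cast hN))
    · rw [map_mul]
      exact (mul_le_of_le_one_left' (hnat m)).trans_lt
        ((dvrVal_wittDeriv_le hD ha₁).trans_lt (WithZero.exp_lt_exp.2 (by exact_mod_cast hn)))
  have h3 : (m₁ : L) ≠ 0 := fun h0 => by
    rw [CharP.cast_eq_zero_iff L p] at h0
    exact (Nat.Prime.coprime_iff_not_dvd Fact.out).1 hm₁.symm h0
  have h4 : dvrVal B L (m₁ : L) = 1 := by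
    refine le_antisymm (hnat _) (not_lt.1 fun hlt => h3 ?_)
    -- The integer m₁ lies in the prime field, so a nonzero m₁ satisfies m₁^{p-1} = 1 and has
    -- absolute value 1.
    have h5 : (m₁ : L) ^ p = m₁ := by
      rw [← Nat.cast_pow, CharP.natCast_eq_natCast L p]
      exact (ZMod.natCast_eq_natCast_iff _ _ _).1 (by rw [Nat.cast_pow, ZMod.pow_card])
    by_contra h0
    have h6 : (m₁ : L) ^ (p - 1) = 1 := by
      refine mul_right_cancel₀ h0 ?_
      rw [← pow_succ, Nat.sub_add_cancel (Fact.out : p.Prime).one_le, h5, one_mul]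
    have h7 := congrArg (dvrVal B L) h6
    rw [map_pow, map_one] at h7
    exact (pow_lt_one₀ zero_le hlt (Nat.sub_ne_zero_of_lt (Fact.out : p.Prime).one_lt)).ne h7
  rw [map_mul, h4, one_mul, hDa] at h2
  exact lt_irrefl _ h2

variable [IsAdicComplete (maximalIdeal B) B]

/-- An upper bound for the Swan conductor by means of the logarithmic derivations. -/
theorem exists_sub_frob_sub_mem_wittFil {s N n' : ℕ} {a : TruncatedWittVector p s L}
    (ha : a ∈ wittFil B p L s N)
    (hD : ∀ D : Derivation ℤ L L, IsLogDer B D →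
      dvrVal B L (wittDeriv D a) ≤ WithZero.exp (n' : ℤ)) (hN : N / p < n') (hn' : n' ≤ N) :
    ∃ b, a - (wittFrob s L b - b) ∈ wittFil B p L s n' := by
  have : CharP B p := (algebraMap B L).charP (IsFractionRing.injective B L) p
  -- The level descends from N to n' one step at a time. The accumulated b stays in F_{⌊N/p⌋}, where
  -- derivatives are below exp n', so the bound needed for the next step persists.
  suffices H : ∀ n, n ≤ N → n' ≤ n → ∃ b ∈ wittFil B p L s (N / p),
      a - (wittFrob s L b - b) ∈ wittFil B p L s n by
    obtain ⟨b, -, hb⟩ := H n' hn' le_rfl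
    exact ⟨b, hb⟩
  intro n hn
  induction hn using Nat.decreasingInduction with
  | self => exact fun _ => ⟨0, (wittFilSubgroup B L s _).zero_mem, by simpa using ha⟩
  | of_succ n hnN ih =>
    intro hn
    obtain ⟨b, hb, hab⟩ := ih (hn.trans n.le_succ)
    obtain ⟨b', hb', hab'⟩ := exists_sub_frob_sub_mem_wittFil_pred p n.succ_ne_zero hab
      fun D hDl => by
        rw [wittDeriv_sub_frob_sub]
        refine lt_of_le_of_lt (Valuation.map_add _ _ _) (max_lt ?_ ?_)
        · exact (hD D hDl).trans_lt (WithZero.exp_lt_exp.2 (by exact_mod_cast Nat.lt_succ_of_le hn))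
        · exact (dvrVal_wittDeriv_le hDl hb).trans_lt (WithZero.exp_lt_exp.2 (by
            exact_mod_cast hN.trans (Nat.lt_succ_of_le hn)))
    refine ⟨b + b', (wittFilSubgroup B L s _).add_mem hb
      (wittFil_mono (Nat.div_le_div_right hnN) hb'), ?_⟩
    have h : a - (wittFrob s L (b + b') - (b + b')) =
        a - (wittFrob s L b - b) - (wittFrob s L b' - b') := by
      rw [map_add]; abel
    rw [h]
    exact hab'

/-- The Swan conductor is determined by the logarithmic derivations. -/
theorem swan_eq_of_dvrVal_wittDeriv {s m N n' : ℕ} {a : TruncatedWittVector p s L}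
    {χ : GalH1 L} (hm : m.Coprime p) (ha : a ∈ wittFil B p L s N)
    (h : IsArtinSchreierWitt p a (χ ^ m))
    (hD : ∀ D : Derivation ℤ L L, IsLogDer B D →
      dvrVal B L (wittDeriv D a) ≤ WithZero.exp (n' : ℤ))
    {D : Derivation ℤ L L} (hDl : IsLogDer B D)
    (hDa : dvrVal B L (wittDeriv D a) = WithZero.exp (n' : ℤ)) (hN : N / p < n') (hn' : n' ≤ N) :
    swan B p χ = n' := by
  obtain ⟨b, hb⟩ := exists_sub_frob_sub_mem_wittFil ha hD hN hn'
  have hmem : χ ∈ swanFil B p L n' := ⟨m, hm, s, _, hb, h.sub_frob_sub b⟩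
  refine le_antisymm (Nat.sInf_le hmem) (le_csInf ⟨n', hmem⟩ fun n hn => ?_)
  by_contra hlt
  exact notMem_swanFil_of_dvrVal_wittDeriv_eq ha h hDl hDa hN (not_le.1 hlt) hn

/-- A Witt vector that realizes the Swan conductor has a large derivative along some logarithmic
derivation. -/
theorem exists_isLogDer_dvrVal_wittDeriv_eq {s m : ℕ} {χ : GalH1 L} (hχ : swan B p χ ≠ 0)
    {a : TruncatedWittVector p s L} (hm : m.Coprime p) (ha : a ∈ wittFil B p L s (swan B p χ))
    (h : IsArtinSchreierWitt p a (χ ^ m)) :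
    ∃ D : Derivation ℤ L L, IsLogDer B D ∧
      dvrVal B L (wittDeriv D a) = WithZero.exp (swan B p χ : ℤ) := by
  have : CharP B p := (algebraMap B L).charP (IsFractionRing.injective B L) p
  by_contra! hD
  obtain ⟨b, -, hb⟩ := exists_sub_frob_sub_mem_wittFil_pred p hχ ha fun D hDl =>
    lt_of_le_of_ne (dvrVal_wittDeriv_le hDl ha) (hD D hDl)
  exact notMem_swanFil_of_lt_swan (Nat.sub_lt (Nat.pos_of_ne_zero hχ) one_pos)
    ⟨m, hm, s, _, hb, h.sub_frob_sub b⟩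

end SwanConductor

/-! ### Valuations, derivations and Brylinski's filtration in an extension -/

section Extension

variable {A K B L : Type*}
  [CommRing A] [IsDomain A] [IsDiscreteValuationRing A]
  [Field K] [Algebra A K] [IsFractionRing A K]
  [CommRing B] [IsDomain B] [IsDiscreteValuationRing B]
  [Field L] [Algebra B L] [IsFractionRing B L]
  [Algebra A B] [Algebra K L] [Algebra A L] [IsScalarTower A K L] [IsScalarTower A B L]
  [IsLocalHom (algebraMap A B)]

theorem maximalIdeal_map_eq_pow_ramificationIdx (hinj : Function.Injective (algebraMap A B)) :
    (maximalIdeal A).map (algebraMap A B) = maximalIdeal B ^ (maximalIdeal B).ramificationIdx A ∧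
      (maximalIdeal B).ramificationIdx A ≠ 0 := by
  obtain ⟨t, ht⟩ := IsDiscreteValuationRing.exists_irreducible A
  obtain ⟨b, hb⟩ := IsDiscreteValuationRing.exists_irreducible B
  have ht0 : algebraMap A B t ≠ 0 := by
    rw [Ne, map_eq_zero_iff _ hinj]; exact ht.ne_zero
  obtain ⟨m, u, hm⟩ := IsDiscreteValuationRing.eq_unit_mul_pow_irreducible ht0 hb
  have hmap : (maximalIdeal A).map (algebraMap A B) = maximalIdeal B ^ m := by
    rw [ht.maximalIdeal_eq, Ideal.map_span, Set.image_singleton, hb.maximalIdeal_eq,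
      Ideal.span_singleton_pow, hm, mul_comm, Ideal.span_singleton_mul_right_unit u.isUnit]
  have hne : (maximalIdeal B ^ m : Ideal B) ≠ ⊥ :=
    pow_ne_zero m (IsDiscreteValuationRing.not_a_field B)
  have : (maximalIdeal B).LiesOver (maximalIdeal A) := inferInstance
  have he : (maximalIdeal B).ramificationIdx A = m := by
    rw [Ideal.IsDedekindDomain.ramificationIdx_eq_multiplicity (maximalIdeal A) (maximalIdeal B)
      (by rwa [hmap]), hmap]
    exact multiplicity_pow_self (IsDiscreteValuationRing.not_a_field B)
      (mt Ideal.isUnit_iff.1 (Ideal.IsPrime.ne_top inferInstance)) m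
  rw [he]
  refine ⟨hmap, ?_⟩
  rintro rfl
  rw [pow_zero, mul_one] at hm
  exact ht.not_isUnit (isUnit_of_map_unit (algebraMap A B) t (hm ▸ u.isUnit))

theorem dvrVal_algebraMap (x : K) :
    dvrVal B L (algebraMap K L x) =
      dvrVal A K x ^ (maximalIdeal B).ramificationIdx A := by
  have hinj : Function.Injective (algebraMap A B) := by
    refine Function.Injective.of_comp (f := algebraMap B L) ?_
    rw [← RingHom.coe_comp, ← IsScalarTower.algebraMap_eq, IsScalarTower.algebraMap_eq A K L]
    exact (algebraMap K L).injective.comp (IsFractionRing.injective A K)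
  obtain ⟨hmap, he⟩ := maximalIdeal_map_eq_pow_ramificationIdx hinj
  generalize (maximalIdeal B).ramificationIdx A = e at hmap he ⊢
  obtain ⟨t, ht⟩ := IsDiscreteValuationRing.exists_irreducible A
  obtain ⟨b, hb⟩ := IsDiscreteValuationRing.exists_irreducible B
  have hcomp : ∀ a : A, algebraMap K L (algebraMap A K a) = algebraMap B L (algebraMap A B a) :=
    fun a => by rw [← IsScalarTower.algebraMap_apply, ← IsScalarTower.algebraMap_apply]
  obtain rfl | hx := eq_or_ne x 0
  · rw [map_zero, map_zero, map_zero, zero_pow he]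
  let f : Kˣ →* WithZero (Multiplicative ℤ) :=
    ((dvrVal B L : L →* _).comp (algebraMap K L : K →* L)).comp (Units.coeHom K)
  let g : Kˣ →* WithZero (Multiplicative ℤ) :=
    (powMonoidHom e).comp
      ((dvrVal A K : K →* _).comp (Units.coeHom K))
  refine units_mem_of_irreducible_mem ht (f.eqLocus g) (fun ϖ hϖ => ?_) (fun u w hu => ?_)
    (Units.mk0 x hx)
  · change dvrVal B L (algebraMap K L ϖ) = dvrVal A K ϖ ^ _
    rw [ht.maximalIdeal_eq, Ideal.map_span, Set.image_singleton, hb.maximalIdeal_eq,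
      Ideal.span_singleton_pow, Ideal.span_singleton_eq_span_singleton] at hmap
    obtain ⟨u, hu⟩ := hmap.symm
    rw [hϖ, hcomp, dvrVal_irreducible ht, ← hu, map_mul, map_mul,
      dvrVal_unit, mul_one, map_pow, map_pow, dvrVal_irreducible hb]
  · change dvrVal B L (algebraMap K L u) = dvrVal A K u ^ _
    rw [hu, hcomp, dvrVal_unit, one_pow]
    exact dvrVal_unit (Units.map (algebraMap A B : A →* B) w)

/-- The restriction to `K` of a derivation of `L` is a multiple of `t d/dt`. -/
theorem wittDeriv_wittMap_algebraMap {p : ℕ} [Fact p.Prime] [CharP A p]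
    [IsAdicComplete (maximalIdeal A) A] [PerfectField (ResidueField A)] {t : A}
    (ht : Irreducible t) {E : Derivation ℤ K K} (hE : E (algebraMap A K t) = algebraMap A K t)
    (D : Derivation ℤ L L) {s : ℕ} (a : TruncatedWittVector p s K) :
    wittDeriv D (wittMap p (algebraMap K L) a) =
      D (algebraMap A L t) / algebraMap A L t * algebraMap K L (wittDeriv E a) := by
  have ht0 : algebraMap A L t ≠ 0 := by
    rw [IsScalarTower.algebraMap_apply A K L, Ne, map_eq_zero, IsFractionRing.to_map_eq_zero_iff]
    exact ht.ne_zero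
  set c := D (algebraMap A L t) / algebraMap A L t with hc
  -- This difference kills t, and a derivation of K is determined by its value on t.
  let D' : Derivation ℤ K L := D.compAlgebraMap K - c • (Algebra.linearMap K L).compDer E
  have hD' : D' = 0 := by
    refine Derivation.eq_zero_of_perfectField_residueField p ht ?_
    change D (algebraMap K L (algebraMap A K t)) -
      c * algebraMap K L (E (algebraMap A K t)) = 0
    rw [hE, ← IsScalarTower.algebraMap_apply, hc, div_mul_cancel₀ _ ht0, sub_self]
  refine wittDeriv_comp D E ((AddMonoidHom.mulLeft c).comp (algebraMap K L).toAddMonoidHom)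
    (fun r m => ?_) (fun r => ?_) a
  · change c * algebraMap K L (r • m) = algebraMap K L r • (c * algebraMap K L m)
    rw [smul_eq_mul, smul_eq_mul, map_mul]
    ring
  · exact (sub_eq_zero.1 (DFunLike.congr_fun hD' r)).symm

theorem wittMap_mem_wittFil {p : ℕ} [Fact p.Prime] {s n : ℕ} {a : TruncatedWittVector p s K}
    (ha : a ∈ wittFil A p K s n) :
    wittMap p (algebraMap K L) a ∈
      wittFil B p L s ((maximalIdeal B).ramificationIdx A * n) := by
  intro j
  change dvrVal B L _ ^ _ ≤ _
  rw [coeff_wittMap, dvrVal_algebraMap (A := A), pow_right_comm, Nat.cast_mul, ← nsmul_eq_mul,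
    WithZero.exp_nsmul]
  exact pow_le_pow_left₀ zero_le (ha j) _

end Extension

end

/-- Here `A = O_K` and `B = O_L`; `hsep` says that `K` is not contained in `L ^ p`, that is, that
the extension `L / K` is separable; `ι` realizes the restriction map `G_L → G_K`. -/
theorem theorem2p9 {p : ℕ} [Fact p.Prime]
    {A K B L : Type*}
    [CommRing A] [IsDomain A] [IsDiscreteValuationRing A] [IsAdicComplete (maximalIdeal A) A]
    [Field K] [Algebra A K] [IsFractionRing A K]
    [CommRing B] [IsDomain B] [IsDiscreteValuationRing B] [IsAdicComplete (maximalIdeal B) B]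
    [Field L] [Algebra B L] [IsFractionRing B L]
    [Algebra A B] [Algebra K L] [Algebra A L] [IsScalarTower A K L] [IsScalarTower A B L]
    [IsLocalHom (algebraMap A B)]
    [CharP K p] [PerfectField (ResidueField A)]
    (hsep : ∃ x : K, ∀ y : L, y ^ p ≠ algebraMap K L x)
    (ι : AlgebraicClosure K →ₐ[K] AlgebraicClosure L)
    (χ : GalH1 K)
    (hχ : (swan A p χ : ℚ) > (p : ℚ) / ((p : ℚ) - 1) *
      (((deltaTor A K B L).toNat : ℚ) / ((maximalIdeal B).ramificationIdx A : ℚ))) :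
    deltaTor A K B L ≠ ⊤ ∧
      (swan B p (χ.res ι) : ℤ) =
        ((maximalIdeal B).ramificationIdx A : ℤ) * (swan A p χ : ℤ) -
          ((deltaTor A K B L).toNat : ℤ) := by
  have hp := (Fact.out : p.Prime)
  have hAK : Function.Injective (algebraMap A K) := IsFractionRing.injective A K
  have : CharP A p := (algebraMap A K).charP hAK p
  have : CharP L p := charP_of_injective_algebraMap (algebraMap K L).injective p
  have : CharP B p := (algebraMap B L).charP (IsFractionRing.injective B L) p
  obtain ⟨t, ht⟩ := IsDiscreteValuationRing.exists_irreducible A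
  obtain ⟨δ, hδ, hle, D, hD, hDt⟩ := exists_deltaTor_eq (A := A) (K := K) (B := B) (L := L)
    p hsep ht
  have hinj : Function.Injective (algebraMap A B) := by
    refine Function.Injective.of_comp (f := algebraMap B L) ?_
    rw [← RingHom.coe_comp, ← IsScalarTower.algebraMap_eq, IsScalarTower.algebraMap_eq A K L]
    exact (algebraMap K L).injective.comp hAK
  have he := (maximalIdeal_map_eq_pow_ramificationIdx hinj).2
  have hv := dvrVal_algebraMap (A := A) (K := K) (B := B) (L := L)
  have hfil := fun s n a => wittMap_mem_wittFil (A := A) (K := K) (B := B) (L := L)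
    (p := p) (s := s) (n := n) (a := a)
  rw [hδ] at hχ ⊢
  rw [ENat.toNat_natCast] at hχ ⊢
  set e := (maximalIdeal B).ramificationIdx A with he'
  set n := swan A p χ with hn
  have hlt : p * δ < (p - 1) * (e * n) := by
    have h1 : (0 : ℚ) < e := by exact_mod_cast Nat.pos_of_ne_zero he
    have h2 : (0 : ℚ) < (p : ℚ) - 1 := by
      rw [sub_pos]; exact_mod_cast hp.one_lt
    rw [gt_iff_lt, div_mul_div_comm, div_lt_iff₀ (mul_pos h2 h1)] at hχ
    have h3 : (p : ℚ) * δ < (p - 1) * (e * n) := by linarith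
    rw [← Nat.cast_pred hp.pos] at h3
    exact_mod_cast h3
  have hN : p * δ + e * n < p * (e * n) := by
    obtain ⟨q, hq⟩ := Nat.exists_eq_add_of_lt hp.pos
    rw [hq, Nat.zero_add, Nat.add_sub_cancel] at hlt
    rw [hq]
    linarith
  have hδN : δ ≤ e * n := by
    refine le_of_mul_le_mul_left ?_ hp.pos
    omega
  -- The conductor hypothesis in the form needed: the Artin–Schreier–Witt ambiguity at level ⌊en/p⌋
  -- stays below the expected conductor en - δ.
  have hNp : e * n / p < e * n - δ := by
    rw [Nat.div_lt_iff_lt_mul hp.pos, Nat.sub_mul, mul_comm _ p, mul_comm δ p]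
    omega
  have hn0 : n ≠ 0 := by
    rintro h0
    rw [h0] at hN
    omega
  refine ⟨ENat.natCast_ne_top δ, ?_⟩
  obtain ⟨m, hm, s, a, ha, haχ⟩ := mem_swanFil_swan hn0
  obtain ⟨E, hE, hEt, -⟩ := exists_isLogDer_euler (L := K) p ht
  have hderiv := fun D : Derivation ℤ L L => wittDeriv_wittMap_algebraMap (L := L) ht hEt D a
  -- Some logarithmic derivation D₁ of K attains exp n on a. It equals (D₁t/t)E with integral
  -- factor, so E attains it too.
  have hEa : dvrVal A K (wittDeriv E a) = WithZero.exp (n : ℤ) := by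
    obtain ⟨D₁, hD₁, hD₁a⟩ := exists_isLogDer_dvrVal_wittDeriv_eq hn0 hm ha haχ
    have h1 := wittDeriv_wittMap_algebraMap (L := K) ht hEt D₁ a
    have h2 : wittMap p (algebraMap K K) a = a := by ext j; simp
    rw [h2, Algebra.algebraMap_self_apply] at h1
    refine le_antisymm (dvrVal_wittDeriv_le hE ha) ?_
    rw [← hn] at hD₁a
    rw [← hD₁a, h1, map_mul, map_div₀]
    exact mul_le_of_le_one_left' (div_le_one_of_le₀ (hD₁ _) zero_le)
  have hres : IsArtinSchreierWitt p (wittMap p (algebraMap K L) a) (χ.res ι ^ m) := by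
    rw [← GalH1.res_pow]
    exact haχ.res ι
  have hval : ∀ D : Derivation ℤ L L,
      dvrVal B L (wittDeriv D (wittMap p (algebraMap K L) a)) =
        dvrVal B L (D (algebraMap A L t) / algebraMap A L t) * WithZero.exp (e * n : ℤ) := by
    intro D
    rw [hderiv, map_mul, hv, hEa, ← WithZero.exp_nsmul, nsmul_eq_mul]
  have hexp : WithZero.exp (-δ : ℤ) * WithZero.exp (e * n : ℤ) =
      WithZero.exp ((e * n - δ : ℕ) : ℤ) := by
    rw [← WithZero.exp_add, Nat.cast_sub hδN]
    congr 1
    push_cast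
    ring
  -- The same vector a, viewed over L in F_{en}, computes the restricted character; the D supplied
  -- with δ attains the maximal derivative exp(en - δ).
  rw [swan_eq_of_dvrVal_wittDeriv hm (hfil s n a ha) hres (fun D hD => ?_) hD ?_ hNp
    (Nat.sub_le _ _), Nat.cast_sub hδN, Nat.cast_mul]
  · rw [hval, hDt, hexp]
  · rw [hval, ← hexp]
    exact mul_le_mul_left (hle D hD) _
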